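/- **Setting.** Fix a first-order language with a countably infinite set of variables, user-defined (CHR) predicate symbols, and rule identifiers. Built-in constraints are atoms over the language, including $s=t$, $\mathtt{true}$ and $\mathtt{false}$; $\mathcal{CT}$ is a first-order theory that describes them and contains the Clark equality theory. A conjunction of built-in constraints is *unsatisfiable* if $\mathcal{CT}\models C\leftrightarrow\mathtt{false}$. An identified constraint $h\#i$ is a user-defined constraint $h$ with an identifier $i$; $chr(h\#i)=h$, $id(h\#i)=i$. A token $r@i_1,\dots,i_l$ is a rule identifier with a sequence of distinct identifiers; a token store is a set of tokens. $clean(B,T)$ is the set of the tokens in $T$ all of whose identifiers occur in $B$. For sequences of user-defined constraints, $A=B$ presupposes equal lengths and predicate symbols and stands for the conjunction of the equations between arguments. **Programs.** An annotated rule $r@H_1\backslash H_2\Leftrightarrow D\,|\,B;T$ has a non-empty head $H_1,H_2$ (two sequences of user-defined constraints), a guard $D$ (built-in constraints), a body $B$ of built-in constraints and identified constraints with distinct positive identifiers, and a local token store $T$ all of whose identifiers occur in $B$. An annotated program is a finite set of annotated rules; rule identifiers may be shared. **Semantics.** A configuration $\langle G,C,T\rangle_n$ consists of a multiset $G$ of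 built-in constraints and of identified constraints with distinct identifiers, a conjunction $C$ of built-in constraints, a token store $T$, and a number $n$ that no identifier in $G,T$ exceeds. It is failed if $C$ is unsatisfiable; failed configurations have no transitions. From a configuration that is not failed: * Solve': $\langle\{c\}\uplus G,C,T\rangle_n\longrightarrow\langle G,c\wedge C,T\rangle_n$ for a built-in constraint $c$. * Apply': $\langle H_1\uplus H_2\uplus G,C,T\rangle_n\longrightarrow\langle B'\uplus H_1\uplus G,\ E\wedge D\wedge C,\ T\cup\{r@id(H_1,H_2)\}\cup T'_r\rangle_m$, where $r@H_1'\backslash H_2'\Leftrightarrow D\,|\,B;T_r$ is a variant, with fresh variables, of a rule of the program, $E$ is $chr(H_1,H_2)=(H_1',H_2')$, $\mathcal{CT}\models C\to\exists(E\wedge D)$ with the variables of the rule quantified, $r@id(H_1,H_2)\notin T$, $(B',T_r')$ is $(B,T_r)$ with $n$ added to each identifier, and $m$ is the greatest identifier in $(B',T_r')$ ($m=n$ if there is none). A derivation is normal if Apply' is used only on configurations $\langle G,C,T\rangle_n$ where $G$ has no built-in constraint. A set of rules is *normally terminating* if it has no infinite normal derivation. For a set $V$ of variables, $\equiv_V$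 is the smallest equivalence relation such that (1) $\langle d\wedge G,C,T\rangle_n\equiv_V\langle G,d\wedge C,T\rangle_n$ for built-in $d$; (2) $\langle G,X=t\wedge C,T\rangle_n\equiv_V\langle G[X/t],X=t\wedge C,T\rangle_n$; (3) $\langle G,C,T\rangle_n\equiv_V\langle G[X/Y],C[X/Y],T\rangle_n$ for variables $X,Y\notin V$ with $Y$ not in $G,C$; (4) $\langle G,C,T\rangle_n\equiv_V\langle G,C',T\rangle_n$ if $\mathcal{CT}\models\exists_WC\leftrightarrow\exists_UC'$, where $W=Fv(C)\setminus(Fv(G)\cup V)$ and $U=Fv(C')\setminus(Fv(G)\cup V)$; (5) $\langle G,\mathtt{false},T\rangle_n\equiv_V\langle G',\mathtt{false},T'\rangle_m$; (6) $\langle G,C,T\rangle_n\equiv_V\langle G\rho,C,T\rho\rangle_m$ for each renaming (finite permutation) $\rho$ of identifiers such that all identifiers of $G\rho,T\rho$ are $\le m$; (7) $\langle G,C,T\rangle_n\equiv_V\langle G,C,clean(G,T)\rangle_n$. A set of rules is *confluent* if, for each configuration $\sigma$, whenever $\sigma\longrightarrow^*\sigma_1$ and $\sigma\longrightarrow^*\sigma_2$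 there are $\sigma_1\longrightarrow^*\tau_1$ and $\sigma_2\longrightarrow^*\tau_2$ with $\tau_1\equiv_{Fv(\sigma)}\tau_2$. **Unfolding.** Let $cl_r$ be $r@H_1\backslash H_2\Leftrightarrow D\,|\,K,S_1,S_2,C;T$, where $C$ is the conjunction of all built-in constraints of the body, let $v@H_1'\backslash H_2'\Leftrightarrow D'\,|\,B;T'$ be a variant, renamed apart from $cl_r$, of a rule $cl_v$, let $\theta$ be an idempotent substitution with $dom(\theta)\subseteq Fv(H_1',H_2')$ and $\mathcal{CT}\models(C\wedge D)\to chr(S_1,S_2)=(H_1',H_2')\theta$, let $m$ be the greatest identifier in $cl_r$, and let $(B_1,T_1)$ be $(B,T')$ with $m$ added to each identifier. Put $D''=D'\setminus\{d\in D'\mid\mathcal{CT}\models C\wedge D\to d\theta\}$. If $v@id(S_1,S_2)\notin T$, $Fv(D''\theta)\cap Fv((H_1',H_2')\theta)\subseteq Fv(H_1,H_2)$ and $D\wedge D''\theta$ is not unsatisfiable, then $cl_r$ can be unfolded with $cl_v$ at $(S_1,S_2)$, and the result is $$r@H_1\backslash H_2\Leftrightarrow D,D''\theta\,|\,K,S_1,B_1,C,\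 chr(S_1,S_2)=(H_1',H_2');\ T'',$$ where $T''=T\cup T_1\cup\{v@id(S_1)\}$ if $H_2'$ is empty, and $T''=clean((K,S_1),T)\cup T_1$ otherwise. $Unf_P(cl)$ is the set of the rules obtained by unfolding $cl$ with the rules $cl_v\in P$; in each possible unfolding (each $cl_v$ and each $(S_1,S_2)$) at least one choice of $\theta$ and of the variant of $cl_v$ is made, and the choice is arbitrary (one, several or all of them). The rule $cl\in P$ *can be weakly safely replaced* in $P$ if some rule obtained by unfolding $cl$ with a rule of $P$ has a guard $\hat D$ with $\mathcal{CT}\models D\leftrightarrow\hat D$, where $D$ is the guard of $cl$. **Proposition 4.** Let $P$ be an annotated program, let $cl\in P$ be a rule that can be weakly safely replaced in $P$, and let $P'=(P\setminus\{cl\})\cup Unf_P(cl)$. If $P$ is normally terminating, then $P'$ is normally terminating. If $P$ is normally terminating and confluent, then $P'$ is confluent too. -/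

import Mathlib

universe u v w x

namespace CHR

/-! ### Terms, constraints, substitutions

Variables are natural numbers, terms are the terms of the first order language `L`, built-in
constraints are the atoms over `L` together with `=`, `true`, `false`; `Q n` is the type of the
user-defined (CHR) predicate symbols of arity `n` and `N` is the type of the rule identifiers. -/

/-- Built-in constraints. -/
inductive Builtin (L : FirstOrder.Language.{u, v}) : Type (max u v)
  | tru : Builtin L
  | fls : Builtin L
  | eq (s t : L.Term ℕ) : Builtin L
  | rel {n : ℕ} (R : L.Relations n) (ts : Fin n → L.Term ℕ) : Builtin L

/-- User-defined constraints `p(t₁, …, tₙ)`. -/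
structure UserAtom (L : FirstOrder.Language.{u, v}) (Q : ℕ → Type w) : Type (max u w) where
  {arity : ℕ}
  pred : Q arity
  args : Fin arity → L.Term ℕ

/-- Identified user-defined constraints `h#i`. -/
structure IdAtom (L : FirstOrder.Language.{u, v}) (Q : ℕ → Type w) : Type (max u w) where
  chr : UserAtom L Q
  id : ℕ

/-- Tokens `r@i₁, …, iₗ`. -/
structure Token (N : Type x) : Type x where
  name : N
  ids : List ℕ

section Basics

variable {L : FirstOrder.Language.{u, v}} {Q : ℕ → Type w} {N : Type x}

/-- The free variables of a built-in constraint. -/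
def Builtin.vars : Builtin L → Set ℕ
  | .tru => ∅
  | .fls => ∅
  | .eq s t => {y | y ∈ s.varFinset ∨ y ∈ t.varFinset}
  | .rel _ ts => {y | ∃ i, y ∈ (ts i).varFinset}

/-- Application of a substitution to a built-in constraint. -/
def Builtin.subst (θ : ℕ → L.Term ℕ) : Builtin L → Builtin L
  | .tru => .tru
  | .fls => .fls
  | .eq s t => .eq (s.subst θ) (t.subst θ)
  | .rel R ts => .rel R fun i => (ts i).subst θ

def UserAtom.vars (a : UserAtom L Q) : Set ℕ := {y | ∃ i, y ∈ (a.args i).varFinset}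

def UserAtom.subst (θ : ℕ → L.Term ℕ) (a : UserAtom L Q) : UserAtom L Q :=
  ⟨a.pred, fun i => (a.args i).subst θ⟩

def IdAtom.subst (θ : ℕ → L.Term ℕ) (a : IdAtom L Q) : IdAtom L Q := ⟨a.chr.subst θ, a.id⟩

/-- The free variables of a conjunction of built-in constraints. -/
def builtinVars (C : Multiset (Builtin L)) : Set ℕ := {y | ∃ c ∈ C, y ∈ c.vars}

/-- The free variables of a sequence of user-defined constraints. -/
def headVars (H : List (UserAtom L Q)) : Set ℕ := {y | ∃ h ∈ H, y ∈ h.vars}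

/-- The free variables of a multiset of identified constraints. -/
def atomVars (B : Multiset (IdAtom L Q)) : Set ℕ := {y | ∃ b ∈ B, y ∈ b.chr.vars}

/-- The identifiers of a multiset of identified constraints. -/
def atomIds (B : Multiset (IdAtom L Q)) : Set ℕ := {i | ∃ b ∈ B, b.id = i}

/-- The identifiers of a token store. -/
def tokenIds (T : Set (Token N)) : Set ℕ := {i | ∃ t ∈ T, i ∈ t.ids}

/-- `SeqEq A B E`: the sequences `A` and `B` have the same length and the same predicate symbols,
and `E` is the conjunction of equations abbreviated by `A = B`. -/
inductive SeqEq : List (UserAtom L Q) → List (UserAtom L Q) → Multiset (Builtin L) → Prop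
  | nil : SeqEq [] [] 0
  | cons {n : ℕ} (p : Q n) (s t : Fin n → L.Term ℕ) {A B : List (UserAtom L Q)}
      {E : Multiset (Builtin L)} (h : SeqEq A B E) :
      SeqEq (⟨p, s⟩ :: A) (⟨p, t⟩ :: B)
        ((List.ofFn fun i => Builtin.eq (s i) (t i) : Multiset (Builtin L)) + E)

/-- `E` is the conjunction of equations abbreviated by `chr(H₁, H₂) = (h₁, h₂)`. -/
def HeadEq (H₁ H₂ : List (IdAtom L Q)) (h₁ h₂ : List (UserAtom L Q))
    (E : Multiset (Builtin L)) : Prop :=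
  ∃ E₁ E₂, SeqEq (H₁.map IdAtom.chr) h₁ E₁ ∧ SeqEq (H₂.map IdAtom.chr) h₂ E₂ ∧ E = E₁ + E₂

/-- Adding `n` to each identifier. -/
def shiftAtoms (n : ℕ) (B : Multiset (IdAtom L Q)) : Multiset (IdAtom L Q) :=
  B.map fun b => ⟨b.chr, n + b.id⟩

def shiftTokens (n : ℕ) (T : Set (Token N)) : Set (Token N) :=
  (fun t => ⟨t.name, t.ids.map (n + ·)⟩) '' T

/-- The greatest identifier in `(B, T)`; it is `0` when there is none. -/
noncomputable def maxId (B : Multiset (IdAtom L Q)) (T : Set (Token N)) : ℕ :=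
  sSup (atomIds B ∪ tokenIds T)

/-- `clean(B, T)`: delete the tokens some identifier of which does not occur in `B`. -/
def clean (B : Multiset (IdAtom L Q)) (T : Set (Token N)) : Set (Token N) :=
  {t ∈ T | ∀ i ∈ t.ids, i ∈ atomIds B}

end Basics

/-! ### Annotated rules and programs -/

/-- Annotated rules `r @ H₁ \ H₂ ⇔ D | B, C; T`, where the body is split into the identified
user-defined constraints `B` and the built-in constraints `C`. -/
structure Rule (L : FirstOrder.Language.{u, v}) (Q : ℕ → Type w) (N : Type x) : Type (max u v w x) where
  name : N
  kept : List (UserAtom L Q)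
  removed : List (UserAtom L Q)
  guard : Multiset (Builtin L)
  body : Multiset (IdAtom L Q)
  builtins : Multiset (Builtin L)
  tokens : Set (Token N)

section Rules

variable {L : FirstOrder.Language.{u, v}} {Q : ℕ → Type w} {N : Type x}

/-- Well-formed annotated rules: the head is non-empty, the user-defined constraints of the body
have distinct, positive identifiers, and the local token store consists of tokens (sequences of
distinct identifiers) over the identifiers of the body. -/
structure Rule.WF (cl : Rule L Q N) : Prop where
  head_ne : cl.kept ++ cl.removed ≠ []
  ids_nodup : (cl.body.map IdAtom.id).Nodup
  ids_pos : ∀ b ∈ cl.body, 1 ≤ b.id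
  tokens_nodup : ∀ t ∈ cl.tokens, t.ids.Nodup
  tokens_ids : tokenIds cl.tokens ⊆ atomIds cl.body

/-- An annotated CHR program is a finite set of annotated rules. -/
def IsProgram (P : Set (Rule L Q N)) : Prop := P.Finite ∧ ∀ cl ∈ P, cl.WF

/-- All variables of a rule. -/
def Rule.vars (cl : Rule L Q N) : Set ℕ :=
  headVars (cl.kept ++ cl.removed) ∪ builtinVars cl.guard ∪ atomVars cl.body ∪
    builtinVars cl.builtins

/-- The variant of a rule obtained by a renaming of the variables. -/
def Rule.rename (π : Equiv.Perm ℕ) (cl : Rule L Q N) : Rule L Q N where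
  name := cl.name
  kept := cl.kept.map (UserAtom.subst fun y => .var (π y))
  removed := cl.removed.map (UserAtom.subst fun y => .var (π y))
  guard := cl.guard.map (Builtin.subst fun y => .var (π y))
  body := cl.body.map (IdAtom.subst fun y => .var (π y))
  builtins := cl.builtins.map (Builtin.subst fun y => .var (π y))
  tokens := cl.tokens

end Rules

/-! ### The constraint theory -/

section Theory

variable {L : FirstOrder.Language.{u, v}}

/-- Truth of a built-in constraint in a structure, under a valuation. -/
def Builtin.Realize {M : Type*} [L.Structure M] (ν : ℕ → M) : Builtin L → Prop
  | .tru => True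
  | .fls => False
  | .eq s t => s.realize ν = t.realize ν
  | .rel R ts => FirstOrder.Language.Structure.RelMap R fun i => (ts i).realize ν

/-- Truth of a conjunction of built-in constraints. -/
def Sat {M : Type*} [L.Structure M] (ν : ℕ → M) (C : Multiset (Builtin L)) : Prop :=
  ∀ c ∈ C, c.Realize ν

/-- Truth of `∃_X C`. -/
def SatEx {M : Type*} [L.Structure M] (ν : ℕ → M) (X : Set ℕ) (C : Multiset (Builtin L)) : Prop :=
  ∃ ν' : ℕ → M, (∀ y, y ∉ X → ν' y = ν y) ∧ Sat ν' C

variable (CT : L.Theory)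

/-- `CT ⊨ C → D`. -/
def Entails (C D : Multiset (Builtin L)) : Prop :=
  ∀ (M : FirstOrder.Language.Theory.ModelType.{u, v, max u v} CT) (ν : ℕ → M), Sat ν C → Sat ν D

/-- `CT ⊨ C → ∃_X D`. -/
def EntailsEx (C : Multiset (Builtin L)) (X : Set ℕ) (D : Multiset (Builtin L)) : Prop :=
  ∀ (M : FirstOrder.Language.Theory.ModelType.{u, v, max u v} CT) (ν : ℕ → M), Sat ν C → SatEx ν X D

/-- `CT ⊨ C ↔ false`. -/
def Unsat (C : Multiset (Builtin L)) : Prop :=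
  ∀ (M : FirstOrder.Language.Theory.ModelType.{u, v, max u v} CT) (ν : ℕ → M), ¬ Sat ν C

/-- `CT` contains the Clark equality theory: function symbols are injective, distinct function
symbols have disjoint ranges, and no variable is equal to a proper superterm of itself. -/
def ClarkEquality : Prop :=
  ∀ M : FirstOrder.Language.Theory.ModelType.{u, v, max u v} CT,
    (∀ (n : ℕ) (f : L.Functions n) (a b : Fin n → M),
      FirstOrder.Language.Structure.funMap f a = FirstOrder.Language.Structure.funMap f b → a = b) ∧
    (∀ (n m : ℕ) (f : L.Functions n) (g : L.Functions m) (a : Fin n → M) (b : Fin m → M),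
      (⟨n, f⟩ : Σ k, L.Functions k) ≠ ⟨m, g⟩ →
        FirstOrder.Language.Structure.funMap f a ≠ FirstOrder.Language.Structure.funMap g b) ∧
    (∀ (t : L.Term ℕ) (y : ℕ), y ∈ t.varFinset → t ≠ .var y →
      ∀ ν : ℕ → M, t.realize ν ≠ ν y)

end Theory

/-! ### The operational semantics of annotated programs -/

/-- Configurations `⟨(G, B), C, T⟩ₙ`: the store consists of the identified user-defined
constraints `G` and the built-in constraints `B` that are still to be solved; `C` is the built-in
store, `T` the token store and `n` the counter. -/
structure Conf (L : FirstOrder.Language.{u, v}) (Q : ℕ → Type w) (N : Type x) : Type (max u v w x) where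
  atoms : Multiset (IdAtom L Q)
  pending : Multiset (Builtin L)
  store : Multiset (Builtin L)
  tokens : Set (Token N)
  counter : ℕ

section Semantics

variable {L : FirstOrder.Language.{u, v}} {Q : ℕ → Type w} {N : Type x}

/-- Fv(σ). -/
def Conf.vars (σ : Conf L Q N) : Set ℕ :=
  atomVars σ.atoms ∪ builtinVars σ.pending ∪ builtinVars σ.store

/-- Proper configurations: distinct constraints have distinct identifiers, and no identifier,
also in the token store, exceeds the counter (the last integer that has been used). -/
structure Conf.Valid (σ : Conf L Q N) : Prop where
  ids_nodup : (σ.atoms.map IdAtom.id).Nodup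
  ids_le : ∀ a ∈ σ.atoms, a.id ≤ σ.counter
  tokens_nodup : ∀ t ∈ σ.tokens, t.ids.Nodup
  tokens_le : ∀ i ∈ tokenIds σ.tokens, i ≤ σ.counter

def Conf.BuiltinFree (σ : Conf L Q N) : Prop := σ.pending = 0

variable (CT : L.Theory) (P : Set (Rule L Q N))

/-- The transition Solve'. Configurations with an unsatisfiable built-in store are failed, and
failed configurations are final. -/
inductive SolveStep : Conf L Q N → Conf L Q N → Prop
  | mk (c : Builtin L) (G : Multiset (IdAtom L Q)) (B C : Multiset (Builtin L))
      (T : Set (Token N)) (n : ℕ) (hC : ¬ Unsat CT C) :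
      SolveStep ⟨G, c ::ₘ B, C, T, n⟩ ⟨G, B, c ::ₘ C, T, n⟩

/-- The transition Apply', with a variant `cl.rename π` of a rule `cl` of the program whose
variables are fresh. -/
inductive ApplyStep : Conf L Q N → Conf L Q N → Prop
  | mk (cl : Rule L Q N) (hcl : cl ∈ P) (π : Equiv.Perm ℕ) (H₁ H₂ : List (IdAtom L Q))
      (G : Multiset (IdAtom L Q)) (B C E : Multiset (Builtin L)) (T : Set (Token N)) (n : ℕ)
      (hC : ¬ Unsat CT C)
      (hfresh : Disjoint (cl.rename π).vars
        (Conf.vars (N := N) ⟨Multiset.ofList (H₁ ++ H₂) + G, B, C, T, n⟩))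
      (hE : HeadEq H₁ H₂ (cl.rename π).kept (cl.rename π).removed E)
      (hguard : EntailsEx CT C (cl.rename π).vars (E + (cl.rename π).guard))
      (htoken : (⟨cl.name, (H₁ ++ H₂).map IdAtom.id⟩ : Token N) ∉ T) :
      ApplyStep ⟨Multiset.ofList (H₁ ++ H₂) + G, B, C, T, n⟩
        ⟨shiftAtoms n (cl.rename π).body + Multiset.ofList H₁ + G,
          (cl.rename π).builtins + B,
          E + (cl.rename π).guard + C,
          T ∪ {⟨cl.name, (H₁ ++ H₂).map IdAtom.id⟩} ∪ shiftTokens n cl.tokens,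
          n + maxId cl.body cl.tokens⟩

/-- One transition of the program. -/
def Step (σ σ' : Conf L Q N) : Prop := SolveStep CT σ σ' ∨ ApplyStep CT P σ σ'

/-- One transition of a normal derivation: Apply' is used on built-in free configurations only. -/
def NormalStep (σ σ' : Conf L Q N) : Prop :=
  SolveStep CT σ σ' ∨ (σ.BuiltinFree ∧ ApplyStep CT P σ σ')

/-- There is no infinite normal derivation. -/
def NormallyTerminating : Prop :=
  ¬ ∃ f : ℕ → Conf L Q N, (f 0).Valid ∧ ∀ k, NormalStep CT P (f k) (f (k + 1))

/-! ### Equivalence of configurations and confluence -/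

/-- The substitution `[X/t]`. -/
def single (X : ℕ) (t : L.Term ℕ) : ℕ → L.Term ℕ := Function.update FirstOrder.Language.Term.var X t

/-- Application of a renaming of identifiers. -/
def renameAtoms (ρ : Equiv.Perm ℕ) (G : Multiset (IdAtom L Q)) : Multiset (IdAtom L Q) :=
  G.map fun a => ⟨a.chr, ρ a.id⟩

def renameTokens (ρ : Equiv.Perm ℕ) (T : Set (Token N)) : Set (Token N) :=
  (fun t => ⟨t.name, t.ids.map ρ⟩) '' T

/-- The identifications that generate the equivalence of configurations with respect to `V`. -/
inductive EquivGen (V : Set ℕ) : Conf L Q N → Conf L Q N → Prop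
  | solve (d : Builtin L) (G : Multiset (IdAtom L Q)) (B C : Multiset (Builtin L))
      (T : Set (Token N)) (n : ℕ) :
      EquivGen V ⟨G, d ::ₘ B, C, T, n⟩ ⟨G, B, d ::ₘ C, T, n⟩
  | subst (X : ℕ) (t : L.Term ℕ) (G : Multiset (IdAtom L Q)) (B C : Multiset (Builtin L))
      (T : Set (Token N)) (n : ℕ) :
      EquivGen V ⟨G, B, .eq (.var X) t ::ₘ C, T, n⟩
        ⟨G.map (IdAtom.subst (single X t)), B.map (Builtin.subst (single X t)),
          .eq (.var X) t ::ₘ C, T, n⟩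
  | renameVar (X Y : ℕ) (G : Multiset (IdAtom L Q)) (B C : Multiset (Builtin L))
      (T : Set (Token N)) (n : ℕ) (hX : X ∉ V) (hY : Y ∉ V)
      (hY' : Y ∉ Conf.vars (N := N) ⟨G, B, C, T, n⟩) :
      EquivGen V ⟨G, B, C, T, n⟩
        ⟨G.map (IdAtom.subst (single X (.var Y))), B.map (Builtin.subst (single X (.var Y))),
          C.map (Builtin.subst (single X (.var Y))), T, n⟩
  | logical (G : Multiset (IdAtom L Q)) (B C C' : Multiset (Builtin L))
      (T : Set (Token N)) (n : ℕ)
      (h : ∀ (M : FirstOrder.Language.Theory.ModelType.{u, v, max u v} CT) (ν : ℕ → M),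
        SatEx ν (builtinVars C \ (atomVars G ∪ builtinVars B ∪ V)) C ↔
          SatEx ν (builtinVars C' \ (atomVars G ∪ builtinVars B ∪ V)) C') :
      EquivGen V ⟨G, B, C, T, n⟩ ⟨G, B, C', T, n⟩
  | failed (G G' : Multiset (IdAtom L Q)) (B B' : Multiset (Builtin L))
      (T T' : Set (Token N)) (n m : ℕ) :
      EquivGen V ⟨G, B, {.fls}, T, n⟩ ⟨G', B', {.fls}, T', m⟩
  | renameIds (ρ : Equiv.Perm ℕ) (hρ : {i | ρ i ≠ i}.Finite) (G : Multiset (IdAtom L Q))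
      (B C : Multiset (Builtin L)) (T : Set (Token N)) (n m : ℕ)
      (hm : ∀ i ∈ atomIds (renameAtoms ρ G) ∪ tokenIds (renameTokens ρ T), i ≤ m) :
      EquivGen V ⟨G, B, C, T, n⟩ ⟨renameAtoms ρ G, B, C, renameTokens ρ T, m⟩
  | cleaning (G : Multiset (IdAtom L Q)) (B C : Multiset (Builtin L))
      (T : Set (Token N)) (n : ℕ) :
      EquivGen V ⟨G, B, C, T, n⟩ ⟨G, B, C, clean G T, n⟩

/-- `σ ≡_V σ'`: the smallest equivalence relation that contains these identifications. -/
def ConfEquiv (V : Set ℕ) (σ σ' : Conf L Q N) : Prop := Relation.EqvGen (EquivGen CT V) σ σ'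

def Confluent : Prop :=
  ∀ σ σ₁ σ₂ : Conf L Q N, σ.Valid →
    Relation.ReflTransGen (Step CT P) σ σ₁ → Relation.ReflTransGen (Step CT P) σ σ₂ →
    ∃ τ₁ τ₂, Relation.ReflTransGen (Step CT P) σ₁ τ₁ ∧ Relation.ReflTransGen (Step CT P) σ₂ τ₂ ∧
      ConfEquiv CT σ.vars τ₁ τ₂

/-! ### Unfolding -/

open Classical in
/-- The part of the guard `D'` of the unfolding rule that is not entailed, after the application
of `θ`, by the conjunction `A` of the guard and of the built-in body constraints of the unfolded
rule. -/
noncomputable def residualGuard (A : Multiset (Builtin L)) (θ : ℕ → L.Term ℕ)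
    (D' : Multiset (Builtin L)) : Multiset (Builtin L) :=
  D'.filter fun d => ¬ Entails CT A {d.subst θ}

open Classical in
/-- `UnfoldsTo CT cl clv S₁ S₂ u`: the rule `u` is a result of unfolding the rule `cl` with (a
variant, renamed apart, of) the rule `clv`, by using the sequences `S₁`, `S₂` of identified
constraints of the body of `cl`. -/
def UnfoldsTo (cl clv : Rule L Q N) (S₁ S₂ : List (IdAtom L Q)) (u : Rule L Q N) : Prop :=
  ∃ (π : Equiv.Perm ℕ) (cv : Rule L Q N) (θ : ℕ → L.Term ℕ) (K : Multiset (IdAtom L Q))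
    (Eθ E D'' : Multiset (Builtin L)),
    cv = clv.rename π ∧ Disjoint cv.vars cl.vars ∧
    cl.body = K + Multiset.ofList (S₁ ++ S₂) ∧
    (∀ y, θ y ≠ .var y → y ∈ headVars (cv.kept ++ cv.removed)) ∧
    (∀ y, (θ y).subst θ = θ y) ∧
    HeadEq S₁ S₂ (cv.kept.map (UserAtom.subst θ)) (cv.removed.map (UserAtom.subst θ)) Eθ ∧
    Entails CT (cl.builtins + cl.guard) Eθ ∧
    HeadEq S₁ S₂ cv.kept cv.removed E ∧
    (⟨cv.name, (S₁ ++ S₂).map IdAtom.id⟩ : Token N) ∉ cl.tokens ∧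
    D'' = residualGuard CT (cl.builtins + cl.guard) θ cv.guard ∧
    builtinVars (D''.map (Builtin.subst θ)) ∩
        headVars ((cv.kept ++ cv.removed).map (UserAtom.subst θ)) ⊆
      headVars (cl.kept ++ cl.removed) ∧
    ¬ Unsat CT (cl.guard + D''.map (Builtin.subst θ)) ∧
    u = { name := cl.name
          kept := cl.kept
          removed := cl.removed
          guard := cl.guard + D''.map (Builtin.subst θ)
          body := K + Multiset.ofList S₁ + shiftAtoms (maxId cl.body cl.tokens) cv.body
          builtins := cv.builtins + cl.builtins + E
          tokens :=
            if cv.removed = [] then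
              cl.tokens ∪ shiftTokens (maxId cl.body cl.tokens) cv.tokens ∪
                {⟨cv.name, S₁.map IdAtom.id⟩}
            else
              clean (K + Multiset.ofList S₁) cl.tokens ∪ shiftTokens (maxId cl.body cl.tokens) cv.tokens }

/-- The set of all rules obtained by unfolding `cl` with a rule of `P` (with all the admissible
choices of the substitution and of the variant of the unfolding rule). -/
def Unf (cl : Rule L Q N) : Set (Rule L Q N) :=
  {u | ∃ clv ∈ P, ∃ S₁ S₂, UnfoldsTo CT cl clv S₁ S₂ u}

/-- `U` is the set of the rules obtained by unfolding `cl` with the rules of `P`, for some choice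
(at least one, possibly several or all) of the substitution and of the variant of the unfolding
rule in each possible unfolding. In particular `U` may be `Unf CT P cl`, and it may be finite. -/
structure IsUnf (cl : Rule L Q N) (U : Set (Rule L Q N)) : Prop where
  subset : U ⊆ Unf CT P cl
  covers : ∀ clv ∈ P, ∀ S₁ S₂, (∃ u, UnfoldsTo CT cl clv S₁ S₂ u) →
    ∃ u ∈ U, UnfoldsTo CT cl clv S₁ S₂ u

/-- `cl` can be weakly safely replaced in `P`: some rule obtained by unfolding `cl` in `P` has a
guard equivalent to the guard of `cl`. -/
def WeaklySafelyReplaceable (cl : Rule L Q N) : Prop :=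
  ∃ u ∈ Unf CT P cl, Entails CT cl.guard u.guard ∧ Entails CT u.guard cl.guard

end Semantics

end CHR

/-! The original program simulates the transformed one. A configuration `a` of `P` simulates a
configuration `b` of `P'` if, along a strictly increasing map of identifiers, they have the same
identified constraints and the same tokens over identifiers still present, and if projecting the
built-in constraints of `a` onto the variables of `b` gives those of `b`. Solved and pending
constraints are counted together, so Solve' steps are invisible to this relation.

A rule of `P` that fires on `b` also fires on `a` (`Simulates.exists_apply`). A firing of an
unfolded rule is answered by a firing of `cl` followed by one of the unfolding rule on the new
copies of `S₁`, `S₂` (`UnfoldsBy.fires_left`, `UnfoldsBy.fires_right`, `UnfoldsBy.simulates`). The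
semantic core is `UnfoldsBy.valSubst_eq`: once the guard and built-ins of `cl` and the equations
between `S₁`, `S₂` and the head hold, injectivity of the function symbols forces the matching
substitution to act as the identity. The residual guard is then equivalent to the full guard of the
unfolding rule. The tokens that unfolding cleans away mention consumed constraints.

Termination: an Apply' step of `P'` costs `P` at least one normal step, and a Solve' step shrinks
the pending constraints while `a` stands still. This is a lexicographic descent (`Simulates.acc`).
If the built-in constraints become unsatisfiable, only finitely many Solve' steps remain.

Confluence: two derivations of `P'` from one configuration are prolonged to normal forms. Each is
equivalent to a configuration of `P` reached from the same origin (`Simulates.confEquiv`), and that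
configuration is a normal form of `P`. Indeed, firings transfer back from `a` to `b`
(`Simulates.fires`), and if the fired rule is `cl`, weak safe replacement supplies an unfolded rule
with the same head and guard (`WeaklySafelyReplaceable.exists_rule`). Confluence of `P` makes its
two normal forms equivalent, and the equivalences compose. -/

namespace CHR

open FirstOrder.Language

/-! ### Substitution and evaluation of terms -/

section Terms

variable {L : FirstOrder.Language.{u, v}}

theorem term_subst_subst (θ η : ℕ → L.Term ℕ) (t : L.Term ℕ) :
    (t.subst θ).subst η = t.subst fun y => (θ y).subst η := by
  induction t with
  | var _ => rfl
  | func f ts ih => simp only [Term.subst, ih]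

theorem term_subst_congr {θ η : ℕ → L.Term ℕ} {t : L.Term ℕ}
    (h : ∀ y ∈ t.varFinset, θ y = η y) : t.subst θ = t.subst η := by
  induction t with
  | var _ => exact h _ (by simp [Term.varFinset])
  | func f ts ih =>
    simp only [Term.subst]
    congr 1
    funext i
    exact ih i fun y hy => h y (by simp only [Term.varFinset, Finset.mem_biUnion]; exact ⟨i, by simp, hy⟩)

theorem term_subst_var (t : L.Term ℕ) : t.subst Term.var = t := by
  induction t with
  | var _ => rfl
  | func f ts ih => simp only [Term.subst, ih]

theorem mem_varFinset_subst {θ : ℕ → L.Term ℕ} {t : L.Term ℕ} {y : ℕ} :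
    y ∈ (t.subst θ).varFinset ↔ ∃ z ∈ t.varFinset, y ∈ (θ z).varFinset := by
  induction t with
  | var _ => simp [Term.subst, Term.varFinset]
  | func f ts ih =>
    simp only [Term.subst, Term.varFinset, Finset.mem_biUnion, Finset.mem_univ, true_and, ih]
    constructor
    · rintro ⟨i, z, hz, hy⟩; exact ⟨z, ⟨i, hz⟩, hy⟩
    · rintro ⟨z, ⟨i, hz⟩, hy⟩; exact ⟨i, z, hz, hy⟩

variable {M : Type*} [L.Structure M]

theorem term_realize_congr {ν ν' : ℕ → M} {t : L.Term ℕ}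
    (h : ∀ y ∈ t.varFinset, ν y = ν' y) : t.realize ν = t.realize ν' := by
  induction t with
  | var _ => exact h _ (by simp [Term.varFinset])
  | func f ts ih =>
    simp only [Term.realize]
    congr 1
    funext i
    exact ih i fun y hy => h y (by simp only [Term.varFinset, Finset.mem_biUnion]; exact ⟨i, by simp, hy⟩)

/-- The function symbols are interpreted by injective functions. -/
def InjectiveFunctions (L : FirstOrder.Language.{u, v}) (M : Type*) [L.Structure M] : Prop :=
  ∀ (n : ℕ) (f : L.Functions n) (a b : Fin n → M),
    Structure.funMap f a = Structure.funMap f b → a = b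

/-- Injectivity can be peeled off symbol by symbol, so the value of a term determines the values of
its variables. In this form the Clark equality theory enters the proof. -/
theorem InjectiveFunctions.eq_of_realize_eq (hM : InjectiveFunctions L M) {ν ν' : ℕ → M}
    {t : L.Term ℕ} (h : t.realize ν = t.realize ν') : ∀ y ∈ t.varFinset, ν y = ν' y := by
  induction t with
  | var _ => intro y hy; simp only [Term.varFinset, Finset.mem_singleton] at hy; subst hy; exact h
  | func f ts ih =>
    intro y hy
    simp only [Term.varFinset, Finset.mem_biUnion] at hy
    obtain ⟨i, -, hy⟩ := hy
    exact ih i (congrFun (hM _ f _ _ h) i) y hy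

theorem ClarkEquality.injectiveFunctions {CT : L.Theory} (h : ClarkEquality CT)
    (M : Theory.ModelType.{u, v, max u v} CT) : InjectiveFunctions L M :=
  (h M).1

end Terms

/-! ### Built-in constraints: variables, substitution, truth -/

section Builtins

variable {L : FirstOrder.Language.{u, v}}

theorem Builtin.subst_subst (θ η : ℕ → L.Term ℕ) (c : Builtin L) :
    (c.subst θ).subst η = c.subst fun y => (θ y).subst η := by
  cases c <;> simp [Builtin.subst, term_subst_subst]

theorem Builtin.subst_congr {θ η : ℕ → L.Term ℕ} {c : Builtin L}
    (h : ∀ y ∈ c.vars, θ y = η y) : c.subst θ = c.subst η := by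
  cases c with
  | tru => rfl
  | fls => rfl
  | eq s t =>
    simp only [Builtin.subst]
    rw [term_subst_congr fun y hy => h y (Or.inl hy), term_subst_congr fun y hy => h y (Or.inr hy)]
  | rel R ts =>
    simp only [Builtin.subst]
    congr 1
    funext i
    exact term_subst_congr fun y hy => h y ⟨i, hy⟩

theorem Builtin.subst_var (c : Builtin L) : c.subst Term.var = c := by
  cases c <;> simp [Builtin.subst, term_subst_var]

theorem Builtin.mem_vars_subst {θ : ℕ → L.Term ℕ} {c : Builtin L} {y : ℕ} :
    y ∈ (c.subst θ).vars ↔ ∃ z ∈ c.vars, y ∈ (θ z).varFinset := by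
  cases c with
  | tru => simp [Builtin.subst, Builtin.vars]
  | fls => simp [Builtin.subst, Builtin.vars]
  | eq s t =>
    simp only [Builtin.subst, Builtin.vars, Set.mem_ofPred_eq, mem_varFinset_subst]
    constructor
    · rintro (⟨z, hz, hy⟩ | ⟨z, hz, hy⟩)
      exacts [⟨z, Or.inl hz, hy⟩, ⟨z, Or.inr hz, hy⟩]
    · rintro ⟨z, hz | hz, hy⟩
      exacts [Or.inl ⟨z, hz, hy⟩, Or.inr ⟨z, hz, hy⟩]
  | rel R ts =>
    simp only [Builtin.subst, Builtin.vars, Set.mem_ofPred_eq, mem_varFinset_subst]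
    constructor
    · rintro ⟨i, z, hz, hy⟩; exact ⟨z, ⟨i, hz⟩, hy⟩
    · rintro ⟨z, ⟨i, hz⟩, hy⟩; exact ⟨i, z, hz, hy⟩

theorem Builtin.finite_vars (c : Builtin L) : c.vars.Finite := by
  cases c with
  | tru => exact Set.finite_empty
  | fls => exact Set.finite_empty
  | eq s t => exact (s.varFinset.finite_toSet).union (t.varFinset.finite_toSet)
  | rel R ts =>
    have : (Builtin.rel R ts : Builtin L).vars = ⋃ i, ((ts i).varFinset : Set ℕ) := by
      ext y; simp [Builtin.vars]
    rw [this]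
    exact Set.finite_iUnion fun i => Finset.finite_toSet _

theorem mem_builtinVars_map {θ : ℕ → L.Term ℕ} {C : Multiset (Builtin L)} {y : ℕ} :
    y ∈ builtinVars (C.map (Builtin.subst θ)) ↔ ∃ z ∈ builtinVars C, y ∈ (θ z).varFinset := by
  simp only [builtinVars, Set.mem_ofPred_eq, Multiset.mem_map]
  constructor
  · rintro ⟨_, ⟨c, hc, rfl⟩, hy⟩
    obtain ⟨z, hz, hy⟩ := Builtin.mem_vars_subst.1 hy
    exact ⟨z, ⟨c, hc, hz⟩, hy⟩
  · rintro ⟨z, ⟨c, hc, hz⟩, hy⟩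
    exact ⟨_, ⟨c, hc, rfl⟩, Builtin.mem_vars_subst.2 ⟨z, hz, hy⟩⟩

theorem builtinVars_zero : builtinVars (0 : Multiset (Builtin L)) = ∅ := by
  ext; simp [builtinVars]

theorem builtinVars_add (C D : Multiset (Builtin L)) :
    builtinVars (C + D) = builtinVars C ∪ builtinVars D := by
  ext y
  simp only [builtinVars, Set.mem_ofPred_eq, Multiset.mem_add, Set.mem_union]
  constructor
  · rintro ⟨c, hc | hc, hy⟩
    exacts [Or.inl ⟨c, hc, hy⟩, Or.inr ⟨c, hc, hy⟩]
  · rintro (⟨c, hc, hy⟩ | ⟨c, hc, hy⟩)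
    exacts [⟨c, Or.inl hc, hy⟩, ⟨c, Or.inr hc, hy⟩]

theorem builtinVars_cons (c : Builtin L) (C : Multiset (Builtin L)) :
    builtinVars (c ::ₘ C) = c.vars ∪ builtinVars C := by
  ext y
  simp [builtinVars]

theorem finite_builtinVars (C : Multiset (Builtin L)) : (builtinVars C).Finite := by
  induction C using Multiset.induction_on with
  | empty => rw [builtinVars_zero]; exact Set.finite_empty
  | cons c C ih => rw [builtinVars_cons]; exact c.finite_vars.union ih

variable {M : Type*} [L.Structure M]

/-- The valuation obtained by evaluating the terms of a substitution. -/
def valSubst (θ : ℕ → L.Term ℕ) (ν : ℕ → M) : ℕ → M := fun y => (θ y).realize ν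

theorem Builtin.realize_subst {θ : ℕ → L.Term ℕ} {c : Builtin L} {ν : ℕ → M} :
    (c.subst θ).Realize ν ↔ c.Realize (valSubst θ ν) := by
  cases c <;> simp [Builtin.subst, Builtin.Realize, Term.realize_subst] <;> rfl

theorem Builtin.realize_congr {ν ν' : ℕ → M} {c : Builtin L}
    (h : ∀ y ∈ c.vars, ν y = ν' y) : c.Realize ν ↔ c.Realize ν' := by
  cases c with
  | tru => rfl
  | fls => rfl
  | eq s t =>
    simp only [Builtin.Realize]
    rw [term_realize_congr fun y hy => h y (Or.inl hy),
      term_realize_congr fun y hy => h y (Or.inr hy)]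
  | rel R ts =>
    simp only [Builtin.Realize]
    rw [show (fun i => (ts i).realize ν) = fun i => (ts i).realize ν' from
      funext fun i => term_realize_congr fun y hy => h y ⟨i, hy⟩]

theorem sat_map_subst {θ : ℕ → L.Term ℕ} {C : Multiset (Builtin L)} {ν : ℕ → M} :
    Sat ν (C.map (Builtin.subst θ)) ↔ Sat (valSubst θ ν) C := by
  simp [Sat, Builtin.realize_subst]

theorem sat_congr {ν ν' : ℕ → M} {C : Multiset (Builtin L)}
    (h : ∀ y ∈ builtinVars C, ν y = ν' y) : Sat ν C ↔ Sat ν' C :=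
  forall₂_congr fun c hc => Builtin.realize_congr fun y hy => h y ⟨c, hc, hy⟩

theorem sat_add {ν : ℕ → M} {C D : Multiset (Builtin L)} :
    Sat ν (C + D) ↔ Sat ν C ∧ Sat ν D := by
  simp only [Sat, Multiset.mem_add, or_imp, forall_and]

theorem sat_zero {ν : ℕ → M} : Sat ν (0 : Multiset (Builtin L)) := by
  simp [Sat]

theorem sat_singleton {ν : ℕ → M} {c : Builtin L} : Sat ν {c} ↔ c.Realize ν := by
  simp [Sat]

theorem sat_mono {ν : ℕ → M} {C D : Multiset (Builtin L)} (h : C ≤ D) (hD : Sat ν D) : Sat ν C :=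
  fun c hc => hD c (Multiset.mem_of_le h hc)

theorem Unsat.mono {CT : L.Theory} {C D : Multiset (Builtin L)} (hC : Unsat CT C) (h : C ≤ D) :
    Unsat CT D :=
  fun M ν hD => hC M ν (sat_mono h hD)

end Builtins

/-! ### User-defined constraints, identifiers, matching equations -/

section Atoms

variable {L : FirstOrder.Language.{u, v}} {Q : ℕ → Type w}

theorem UserAtom.subst_subst (θ η : ℕ → L.Term ℕ) (a : UserAtom L Q) :
    (a.subst θ).subst η = a.subst fun y => (θ y).subst η := by
  simp [UserAtom.subst, term_subst_subst]

theorem UserAtom.subst_congr {θ η : ℕ → L.Term ℕ} {a : UserAtom L Q}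
    (h : ∀ y ∈ a.vars, θ y = η y) : a.subst θ = a.subst η := by
  simp only [UserAtom.subst]
  congr 1
  funext i
  exact term_subst_congr fun y hy => h y ⟨i, hy⟩

theorem UserAtom.subst_var (a : UserAtom L Q) : a.subst Term.var = a := by
  simp [UserAtom.subst, term_subst_var]

theorem UserAtom.mem_vars_subst {θ : ℕ → L.Term ℕ} {a : UserAtom L Q} {y : ℕ} :
    y ∈ (a.subst θ).vars ↔ ∃ z ∈ a.vars, y ∈ (θ z).varFinset := by
  simp only [UserAtom.subst, UserAtom.vars, Set.mem_ofPred_eq, mem_varFinset_subst]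
  constructor
  · rintro ⟨i, z, hz, hy⟩; exact ⟨z, ⟨i, hz⟩, hy⟩
  · rintro ⟨z, ⟨i, hz⟩, hy⟩; exact ⟨i, z, hz, hy⟩

theorem UserAtom.finite_vars (a : UserAtom L Q) : a.vars.Finite := by
  have : a.vars = ⋃ i, ((a.args i).varFinset : Set ℕ) := by
    ext y; simp [UserAtom.vars]
  rw [this]
  exact Set.finite_iUnion fun i => Finset.finite_toSet _

theorem headVars_nil : headVars ([] : List (UserAtom L Q)) = ∅ := by
  ext; simp [headVars]

theorem headVars_cons (a : UserAtom L Q) (A : List (UserAtom L Q)) :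
    headVars (a :: A) = a.vars ∪ headVars A := by
  ext; simp [headVars]

theorem headVars_append (A B : List (UserAtom L Q)) :
    headVars (A ++ B) = headVars A ∪ headVars B := by
  induction A with
  | nil => simp [headVars_nil]
  | cons a A ih => rw [List.cons_append, headVars_cons, headVars_cons, ih, Set.union_assoc]

theorem mem_headVars_map {θ : ℕ → L.Term ℕ} {A : List (UserAtom L Q)} {y : ℕ} :
    y ∈ headVars (A.map (UserAtom.subst θ)) ↔ ∃ z ∈ headVars A, y ∈ (θ z).varFinset := by
  simp only [headVars, Set.mem_ofPred_eq, List.mem_map]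
  constructor
  · rintro ⟨_, ⟨c, hc, rfl⟩, hy⟩
    obtain ⟨z, hz, hy⟩ := UserAtom.mem_vars_subst.1 hy
    exact ⟨z, ⟨c, hc, hz⟩, hy⟩
  · rintro ⟨z, ⟨c, hc, hz⟩, hy⟩
    exact ⟨_, ⟨c, hc, rfl⟩, UserAtom.mem_vars_subst.2 ⟨z, hz, hy⟩⟩

theorem finite_headVars (A : List (UserAtom L Q)) : (headVars A).Finite := by
  induction A with
  | nil => rw [headVars_nil]; exact Set.finite_empty
  | cons a A ih => rw [headVars_cons]; exact a.finite_vars.union ih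

theorem atomVars_zero : atomVars (0 : Multiset (IdAtom L Q)) = ∅ := by
  ext; simp [atomVars]

theorem atomVars_cons (a : IdAtom L Q) (A : Multiset (IdAtom L Q)) :
    atomVars (a ::ₘ A) = a.chr.vars ∪ atomVars A := by
  ext; simp [atomVars]

theorem atomVars_add (A B : Multiset (IdAtom L Q)) :
    atomVars (A + B) = atomVars A ∪ atomVars B := by
  induction A using Multiset.induction_on with
  | empty => simp [atomVars_zero]
  | cons a A ih => rw [Multiset.cons_add, atomVars_cons, atomVars_cons, ih, Set.union_assoc]

theorem atomVars_coe (A : List (IdAtom L Q)) :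
    atomVars (Multiset.ofList A) = headVars (A.map IdAtom.chr) := by
  ext; simp [atomVars, headVars]

theorem finite_atomVars (A : Multiset (IdAtom L Q)) : (atomVars A).Finite := by
  induction A using Multiset.induction_on with
  | empty => rw [atomVars_zero]; exact Set.finite_empty
  | cons a A ih => rw [atomVars_cons]; exact a.chr.finite_vars.union ih

theorem mem_atomVars_map {θ : ℕ → L.Term ℕ} {A : Multiset (IdAtom L Q)} {y : ℕ} :
    y ∈ atomVars (A.map (IdAtom.subst θ)) ↔ ∃ z ∈ atomVars A, y ∈ (θ z).varFinset := by
  simp only [atomVars, Set.mem_ofPred_eq, Multiset.mem_map]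
  constructor
  · rintro ⟨_, ⟨c, hc, rfl⟩, hy⟩
    obtain ⟨z, hz, hy⟩ := UserAtom.mem_vars_subst.1 hy
    exact ⟨z, ⟨c, hc, hz⟩, hy⟩
  · rintro ⟨z, ⟨c, hc, hz⟩, hy⟩
    exact ⟨_, ⟨c, hc, rfl⟩, UserAtom.mem_vars_subst.2 ⟨z, hz, hy⟩⟩

/-- Application of a map to the identifiers. -/
def mapIds (g : ℕ → ℕ) (A : Multiset (IdAtom L Q)) : Multiset (IdAtom L Q) :=
  A.map fun a => ⟨a.chr, g a.id⟩

theorem mapIds_add (g : ℕ → ℕ) (A B : Multiset (IdAtom L Q)) :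
    mapIds g (A + B) = mapIds g A + mapIds g B :=
  Multiset.map_add _ _ _

theorem mapIds_coe (g : ℕ → ℕ) (A : List (IdAtom L Q)) :
    mapIds g (Multiset.ofList A) = Multiset.ofList (A.map fun a => ⟨a.chr, g a.id⟩) :=
  Multiset.map_coe _ _

theorem mapIds_mapIds (g h : ℕ → ℕ) (A : Multiset (IdAtom L Q)) :
    mapIds g (mapIds h A) = mapIds (g ∘ h) A := by
  simp [mapIds, Multiset.map_map]

theorem mapIds_id (A : Multiset (IdAtom L Q)) : mapIds id A = A := by
  simp [mapIds]

theorem mapIds_congr {g h : ℕ → ℕ} {A : Multiset (IdAtom L Q)}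
    (H : ∀ i ∈ atomIds A, g i = h i) : mapIds g A = mapIds h A :=
  Multiset.map_congr rfl fun a ha => by rw [H a.id ⟨a, ha, rfl⟩]

theorem shiftAtoms_eq (n : ℕ) (A : Multiset (IdAtom L Q)) : shiftAtoms n A = mapIds (n + ·) A := rfl

theorem renameAtoms_eq (ρ : Equiv.Perm ℕ) (A : Multiset (IdAtom L Q)) :
    renameAtoms ρ A = mapIds ρ A := rfl

theorem atomVars_mapIds (g : ℕ → ℕ) (A : Multiset (IdAtom L Q)) :
    atomVars (mapIds g A) = atomVars A := by
  ext; simp [atomVars, mapIds]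

theorem atomIds_mapIds (g : ℕ → ℕ) (A : Multiset (IdAtom L Q)) :
    atomIds (mapIds g A) = g '' atomIds A := by
  ext; simp [atomIds, mapIds]

theorem atomIds_add (A B : Multiset (IdAtom L Q)) :
    atomIds (A + B) = atomIds A ∪ atomIds B := by
  ext i
  simp only [atomIds, Set.mem_ofPred_eq, Multiset.mem_add, Set.mem_union]
  constructor
  · rintro ⟨c, hc | hc, hy⟩
    exacts [Or.inl ⟨c, hc, hy⟩, Or.inr ⟨c, hc, hy⟩]
  · rintro (⟨c, hc, hy⟩ | ⟨c, hc, hy⟩)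
    exacts [⟨c, Or.inl hc, hy⟩, ⟨c, Or.inr hc, hy⟩]

theorem atomIds_coe (A : List (IdAtom L Q)) :
    atomIds (Multiset.ofList A) = {i | i ∈ A.map IdAtom.id} := by
  ext; simp [atomIds]

theorem finite_atomIds (A : Multiset (IdAtom L Q)) : (atomIds A).Finite := by
  classical
  have : atomIds A = ((A.map IdAtom.id).toFinset : Set ℕ) := by
    ext; simp [atomIds]
  rw [this]
  exact Finset.finite_toSet _

theorem mapIds_map_subst (g : ℕ → ℕ) (θ : ℕ → L.Term ℕ) (A : Multiset (IdAtom L Q)) :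
    mapIds g (A.map (IdAtom.subst θ)) = (mapIds g A).map (IdAtom.subst θ) := by
  simp [mapIds, Multiset.map_map, Function.comp_def, IdAtom.subst]

theorem atomIds_map_subst (θ : ℕ → L.Term ℕ) (A : Multiset (IdAtom L Q)) :
    atomIds (A.map (IdAtom.subst θ)) = atomIds A := by
  ext; simp [atomIds, IdAtom.subst]

theorem IdAtom.subst_congr {θ η : ℕ → L.Term ℕ} {a : IdAtom L Q}
    (h : ∀ y ∈ a.chr.vars, θ y = η y) : a.subst θ = a.subst η := by
  simp only [IdAtom.subst, UserAtom.subst_congr h]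

theorem builtins_subst_congr {θ η : ℕ → L.Term ℕ} {C : Multiset (Builtin L)}
    (h : ∀ y ∈ builtinVars C, θ y = η y) :
    C.map (Builtin.subst θ) = C.map (Builtin.subst η) :=
  Multiset.map_congr rfl fun c hc => Builtin.subst_congr fun y hy => h y ⟨c, hc, hy⟩

theorem atoms_subst_congr {θ η : ℕ → L.Term ℕ} {A : Multiset (IdAtom L Q)}
    (h : ∀ y ∈ atomVars A, θ y = η y) :
    A.map (IdAtom.subst θ) = A.map (IdAtom.subst η) :=
  Multiset.map_congr rfl fun c hc => IdAtom.subst_congr fun y hy => h y ⟨c, hc, hy⟩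

theorem heads_subst_congr {θ η : ℕ → L.Term ℕ} {A : List (UserAtom L Q)}
    (h : ∀ y ∈ headVars A, θ y = η y) :
    A.map (UserAtom.subst θ) = A.map (UserAtom.subst η) :=
  List.map_congr_left fun c hc => UserAtom.subst_congr fun y hy => h y ⟨c, hc, hy⟩

variable {M : Type*} [L.Structure M]

/-- The value of a user-defined constraint under a valuation. -/
def UserAtom.val (ν : ℕ → M) (a : UserAtom L Q) : Σ n, Q n × (Fin n → M) :=
  ⟨a.arity, a.pred, fun i => (a.args i).realize ν⟩

theorem UserAtom.val_subst (θ : ℕ → L.Term ℕ) (ν : ℕ → M) (a : UserAtom L Q) :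
    (a.subst θ).val ν = a.val (valSubst θ ν) := by
  simp only [UserAtom.val, UserAtom.subst, Term.realize_subst]
  rfl

theorem heads_val_subst (θ : ℕ → L.Term ℕ) (ν : ℕ → M) (A : List (UserAtom L Q)) :
    (A.map (UserAtom.subst θ)).map (UserAtom.val ν) = A.map (UserAtom.val (valSubst θ ν)) := by
  simp [Function.comp_def, UserAtom.val_subst]

theorem UserAtom.val_congr {ν ν' : ℕ → M} {a : UserAtom L Q}
    (h : ∀ y ∈ a.vars, ν y = ν' y) : a.val ν = a.val ν' := by
  simp only [UserAtom.val]
  rw [show (fun i => (a.args i).realize ν) = fun i => (a.args i).realize ν' from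
    funext fun i => term_realize_congr fun y hy => h y ⟨i, hy⟩]

theorem heads_val_congr {ν ν' : ℕ → M} {A : List (UserAtom L Q)}
    (h : ∀ y ∈ headVars A, ν y = ν' y) : A.map (UserAtom.val ν) = A.map (UserAtom.val ν') :=
  List.map_congr_left fun c hc => UserAtom.val_congr fun y hy => h y ⟨c, hc, hy⟩

theorem InjectiveFunctions.eq_of_val_eq (hM : InjectiveFunctions L M) {ν ν' : ℕ → M}
    {a : UserAtom L Q} (h : a.val ν = a.val ν') : ∀ y ∈ a.vars, ν y = ν' y := by
  rintro y ⟨i, hy⟩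
  simp only [UserAtom.val, Sigma.mk.injEq, heq_eq_eq, Prod.mk.injEq, true_and] at h
  exact hM.eq_of_realize_eq (congrFun h i) y hy

theorem InjectiveFunctions.eq_of_heads_val_eq (hM : InjectiveFunctions L M) {ν ν' : ℕ → M}
    {A : List (UserAtom L Q)} (h : A.map (UserAtom.val ν) = A.map (UserAtom.val ν')) :
    ∀ y ∈ headVars A, ν y = ν' y := by
  rintro y ⟨a, ha, hy⟩
  exact hM.eq_of_val_eq (List.map_inj_left.1 h a ha) y hy

/-- Replaces a conjunction of equations by one equality between lists of values; later matching
arguments become chains of such equalities. -/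
theorem SeqEq.sat_iff {A B : List (UserAtom L Q)} {E : Multiset (Builtin L)} (h : SeqEq A B E)
    (ν : ℕ → M) : Sat ν E ↔ A.map (UserAtom.val ν) = B.map (UserAtom.val ν) := by
  induction h with
  | nil => simp [sat_zero]
  | cons p s t h ih =>
    rw [sat_add, ih, List.map_cons, List.map_cons, List.cons.injEq]
    refine and_congr_left fun _ => ?_
    simp only [UserAtom.val, Sigma.mk.injEq, heq_eq_eq, Prod.mk.injEq, true_and, funext_iff]
    simp only [Sat, Multiset.mem_coe, List.mem_ofFn]
    constructor
    · intro H i; exact H _ ⟨i, rfl⟩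
    · rintro H _ ⟨i, rfl⟩; exact H i

theorem SeqEq.vars_eq {A B : List (UserAtom L Q)} {E : Multiset (Builtin L)} (h : SeqEq A B E) :
    builtinVars E = headVars A ∪ headVars B := by
  induction h with
  | nil => simp [builtinVars_zero, headVars_nil]
  | cons p s t h ih =>
    rw [builtinVars_add, ih, headVars_cons, headVars_cons]
    have : builtinVars (List.ofFn fun i => Builtin.eq (s i) (t i) : Multiset (Builtin L)) =
        UserAtom.vars (L := L) (Q := Q) ⟨p, s⟩ ∪ UserAtom.vars (L := L) (Q := Q) ⟨p, t⟩ := by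
      ext y
      simp only [builtinVars, Multiset.mem_coe, List.mem_ofFn, Set.mem_ofPred_eq, UserAtom.vars,
        Set.mem_union]
      constructor
      · rintro ⟨_, ⟨i, rfl⟩, hy | hy⟩
        exacts [Or.inl ⟨i, hy⟩, Or.inr ⟨i, hy⟩]
      · rintro (⟨i, hy⟩ | ⟨i, hy⟩)
        exacts [⟨_, ⟨i, rfl⟩, Or.inl hy⟩, ⟨_, ⟨i, rfl⟩, Or.inr hy⟩]
    rw [this, Set.union_union_union_comm]

theorem SeqEq.subst (θ : ℕ → L.Term ℕ) {A B : List (UserAtom L Q)} {E : Multiset (Builtin L)}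
    (h : SeqEq A B E) : SeqEq (A.map (UserAtom.subst θ)) (B.map (UserAtom.subst θ))
      (E.map (Builtin.subst θ)) := by
  induction h with
  | nil => exact SeqEq.nil
  | cons p s t h ih =>
    have := SeqEq.cons p (fun i => (s i).subst θ) (fun i => (t i).subst θ) ih
    rw [Multiset.map_add, Multiset.map_coe, List.map_ofFn]
    exact this

theorem SeqEq.length_eq {A B : List (UserAtom L Q)} {E : Multiset (Builtin L)} (h : SeqEq A B E) :
    A.length = B.length := by
  induction h with
  | nil => rfl
  | cons p s t h ih => simp [ih]

theorem HeadEq.sat_iff {H₁ H₂ : List (IdAtom L Q)} {h₁ h₂ : List (UserAtom L Q)}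
    {E : Multiset (Builtin L)} (h : HeadEq H₁ H₂ h₁ h₂ E) (ν : ℕ → M) :
    Sat ν E ↔ ((H₁ ++ H₂).map IdAtom.chr).map (UserAtom.val ν) =
      (h₁ ++ h₂).map (UserAtom.val ν) := by
  obtain ⟨E₁, E₂, hE₁, hE₂, rfl⟩ := h
  rw [sat_add, hE₁.sat_iff, hE₂.sat_iff, List.map_append, List.map_append, List.map_append]
  exact ⟨fun h => by rw [h.1, h.2], fun h => List.append_inj h (by simpa using hE₁.length_eq)⟩

theorem HeadEq.vars_eq {H₁ H₂ : List (IdAtom L Q)} {h₁ h₂ : List (UserAtom L Q)}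
    {E : Multiset (Builtin L)} (h : HeadEq H₁ H₂ h₁ h₂ E) :
    builtinVars E = headVars ((H₁ ++ H₂).map IdAtom.chr) ∪ headVars (h₁ ++ h₂) := by
  obtain ⟨E₁, E₂, hE₁, hE₂, rfl⟩ := h
  rw [builtinVars_add, hE₁.vars_eq, hE₂.vars_eq, List.map_append, headVars_append,
    headVars_append, Set.union_union_union_comm]

theorem HeadEq.subst (θ : ℕ → L.Term ℕ) {H₁ H₂ : List (IdAtom L Q)} {h₁ h₂ : List (UserAtom L Q)}
    {E : Multiset (Builtin L)} (h : HeadEq H₁ H₂ h₁ h₂ E) :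
    HeadEq (H₁.map (IdAtom.subst θ)) (H₂.map (IdAtom.subst θ)) (h₁.map (UserAtom.subst θ))
      (h₂.map (UserAtom.subst θ)) (E.map (Builtin.subst θ)) := by
  obtain ⟨E₁, E₂, hE₁, hE₂, rfl⟩ := h
  refine ⟨_, _, ?_, ?_, Multiset.map_add _ _ _⟩
  · simpa [Function.comp_def, IdAtom.subst] using hE₁.subst θ
  · simpa [Function.comp_def, IdAtom.subst] using hE₂.subst θ

theorem HeadEq.mapIds (g : ℕ → ℕ) {H₁ H₂ : List (IdAtom L Q)} {h₁ h₂ : List (UserAtom L Q)}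
    {E : Multiset (Builtin L)} (h : HeadEq H₁ H₂ h₁ h₂ E) :
    HeadEq (H₁.map fun a => ⟨a.chr, g a.id⟩) (H₂.map fun a => ⟨a.chr, g a.id⟩) h₁ h₂ E := by
  obtain ⟨E₁, E₂, hE₁, hE₂, rfl⟩ := h
  exact ⟨E₁, E₂, by simpa [Function.comp_def] using hE₁, by simpa [Function.comp_def] using hE₂, rfl⟩

end Atoms

/-! ### Finite partial injections extended to permutations -/

section Permutations

theorem exists_perm_extending (s : Finset ℕ) (f : ℕ → ℕ) (hf : Set.InjOn f s) :
    ∃ ρ : Equiv.Perm ℕ, (∀ i ∈ s, ρ i = f i) ∧ {i | ρ i ≠ i}.Finite := by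
  induction s using Finset.induction_on with
  | empty => exact ⟨1, by simp, by simp⟩
  | insert a s ha ih =>
    obtain ⟨ρ, hρ, hfin⟩ := ih (hf.mono (by simp))
    -- The swap routes `a` through the preimage of `f a`. It fixes `s` pointwise, since by
    -- injectivity of `f` no element of `s` is that preimage.
    refine ⟨ρ * Equiv.swap a (ρ.symm (f a)), ?_, ?_⟩
    · intro i hi
      rw [Finset.mem_insert] at hi
      rcases hi with rfl | hi
      · simp
      · have h1 : i ≠ a := fun h => ha (h ▸ hi)
        have h2 : i ≠ ρ.symm (f a) := by
          intro h
          have : ρ i = f a := by rw [h]; simp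
          rw [hρ i hi] at this
          exact h1 (hf (by simp [hi]) (by simp) this)
        rw [Equiv.Perm.mul_apply, Equiv.swap_apply_of_ne_of_ne h1 h2, hρ i hi]
    · refine (hfin.union (Set.toFinite {a, ρ.symm (f a)})).subset ?_
      intro i hi
      by_contra h
      simp only [Set.mem_union, Set.mem_ofPred_eq, Set.mem_insert_iff, Set.mem_singleton_iff,
        not_or, not_not] at h
      apply hi
      rw [Equiv.Perm.mul_apply, Equiv.swap_apply_of_ne_of_ne h.2.1 h.2.2, h.1]

/-- The tool for all freshness conditions: a variant prescribed on `A` can be chosen so that the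
remaining variables of `X` avoid the finite set `S`. -/
theorem exists_perm_fresh (π : Equiv.Perm ℕ) {A X S : Set ℕ} (hA : A.Finite) (hX : X.Finite)
    (hS : S.Finite) :
    ∃ β : Equiv.Perm ℕ, (∀ y ∈ A, β y = π y) ∧ ∀ y ∈ X, y ∉ A → β y ∉ S := by
  classical
  obtain ⟨N, hN⟩ := ((hA.image π).union hS).bddAbove
  have hlt : ∀ y ∈ A, π y ≤ N := fun y hy => hN (Or.inl ⟨y, hy, rfl⟩)
  -- Outside `A` a variable is sent above `N`, which bounds both the images of `A` and the forbidden
  -- set; adding `y` keeps the map injective.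
  obtain ⟨β, hβ, -⟩ := exists_perm_extending (hA.union hX).toFinset
    (fun y => if y ∈ A then π y else N + 1 + y) (by
      intro y _ z _ h
      simp only at h
      split_ifs at h with hy hz hz
      · exact π.injective h
      · have := hlt y hy; omega
      · have := hlt z hz; omega
      · omega)
  refine ⟨β, fun y hy => ?_, fun y hy hyA h => ?_⟩
  · rw [hβ y (by simp [hy]), if_pos hy]
  · rw [hβ y (by simp [hy]), if_neg hyA] at h
    have := hN (Or.inr h)
    omega

end Permutations

/-! ### Invariance under renaming of variables -/

section Renaming

variable {L : FirstOrder.Language.{u, v}} {Q : ℕ → Type w} {N : Type x}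

theorem builtinVars_rename (π : ℕ → ℕ) (C : Multiset (Builtin L)) :
    builtinVars (C.map (Builtin.subst fun y => .var (π y))) = π '' builtinVars C := by
  ext y
  rw [mem_builtinVars_map]
  simp [Term.varFinset, eq_comm]

theorem headVars_rename (π : ℕ → ℕ) (A : List (UserAtom L Q)) :
    headVars (A.map (UserAtom.subst fun y => .var (π y))) = π '' headVars A := by
  ext y
  rw [mem_headVars_map]
  simp [Term.varFinset, eq_comm]

theorem atomVars_rename (π : ℕ → ℕ) (A : Multiset (IdAtom L Q)) :
    atomVars (A.map (IdAtom.subst fun y => .var (π y))) = π '' atomVars A := by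
  ext y
  rw [mem_atomVars_map]
  simp [Term.varFinset, eq_comm]

theorem Rule.vars_rename (π : Equiv.Perm ℕ) (r : Rule L Q N) :
    (r.rename π).vars = π '' r.vars := by
  simp only [Rule.vars, Rule.rename, ← List.map_append, headVars_rename, builtinVars_rename,
    atomVars_rename, Set.image_union]

theorem Rule.finite_vars (r : Rule L Q N) : r.vars.Finite :=
  (((finite_headVars _).union (finite_builtinVars _)).union (finite_atomVars _)).union
    (finite_builtinVars _)

theorem IdAtom.subst_subst (θ η : ℕ → L.Term ℕ) (a : IdAtom L Q) :
    (a.subst θ).subst η = a.subst fun y => (θ y).subst η := by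
  simp [IdAtom.subst, UserAtom.subst_subst]

theorem Rule.maxId_rename (π : Equiv.Perm ℕ) (r : Rule L Q N) :
    maxId (r.rename π).body (r.rename π).tokens = maxId r.body r.tokens := by
  simp only [maxId, Rule.rename, atomIds_map_subst]

theorem Rule.rename_rename (π β : Equiv.Perm ℕ) (r : Rule L Q N) :
    (r.rename π).rename β = r.rename (β * π) := by
  simp [Rule.rename, Function.comp_def, UserAtom.subst_subst, Builtin.subst_subst,
    IdAtom.subst_subst, Term.subst]

theorem Rule.rename_congr {π β : Equiv.Perm ℕ} {r : Rule L Q N} (h : ∀ y ∈ r.vars, π y = β y) :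
    r.rename π = r.rename β := by
  simp only [Rule.rename, Rule.mk.injEq, true_and, and_true]
  simp only [Rule.vars, headVars_append, Set.mem_union] at h
  refine ⟨?_, ?_, ?_, ?_, ?_⟩
  · exact heads_subst_congr fun y hy => by rw [h y (by tauto)]
  · exact heads_subst_congr fun y hy => by rw [h y (by tauto)]
  · exact builtins_subst_congr fun y hy => by rw [h y (by tauto)]
  · exact atoms_subst_congr fun y hy => by rw [h y (by tauto)]
  · exact builtins_subst_congr fun y hy => by rw [h y (by tauto)]

/-- The configuration obtained by a renaming of the variables. -/
def Conf.rename (π : Equiv.Perm ℕ) (σ : Conf L Q N) : Conf L Q N where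
  atoms := σ.atoms.map (IdAtom.subst fun y => .var (π y))
  pending := σ.pending.map (Builtin.subst fun y => .var (π y))
  store := σ.store.map (Builtin.subst fun y => .var (π y))
  tokens := σ.tokens
  counter := σ.counter

theorem Conf.vars_rename (π : Equiv.Perm ℕ) (σ : Conf L Q N) :
    (σ.rename π).vars = π '' σ.vars := by
  simp only [Conf.vars, Conf.rename, builtinVars_rename, atomVars_rename, Set.image_union]

theorem Conf.finite_vars (σ : Conf L Q N) : σ.vars.Finite :=
  ((finite_atomVars _).union (finite_builtinVars _)).union (finite_builtinVars _)

theorem Conf.rename_eq_self {π : Equiv.Perm ℕ} {σ : Conf L Q N} (h : ∀ y ∈ σ.vars, π y = y) :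
    σ.rename π = σ := by
  obtain ⟨G, B, C, T, n⟩ := σ
  simp only [Conf.rename, Conf.mk.injEq, and_true]
  simp only [Conf.vars, Set.mem_union] at h
  refine ⟨?_, ?_, ?_⟩
  · rw [atoms_subst_congr (η := Term.var) fun y hy => by rw [h y (by tauto)]]
    exact (Multiset.map_congr rfl fun a _ => by
      rw [IdAtom.subst, UserAtom.subst_var]).trans (Multiset.map_id' G)
  · rw [builtins_subst_congr (η := Term.var) fun y hy => by rw [h y (by tauto)]]
    simp [Builtin.subst_var]
  · rw [builtins_subst_congr (η := Term.var) fun y hy => by rw [h y (by tauto)]]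
    simp [Builtin.subst_var]

theorem sat_rename {M : Type*} [L.Structure M] {π : ℕ → ℕ} {C : Multiset (Builtin L)} {ν : ℕ → M} :
    Sat ν (C.map (Builtin.subst fun y => .var (π y))) ↔ Sat (ν ∘ π) C := by
  rw [sat_map_subst]; rfl

variable {CT : L.Theory}

theorem unsat_rename (π : Equiv.Perm ℕ) {C : Multiset (Builtin L)} :
    Unsat CT (C.map (Builtin.subst fun y => .var (π y))) ↔ Unsat CT C := by
  constructor
  · intro h M ν hν
    exact h M (ν ∘ π.symm) (sat_rename.2 (by simpa [Function.comp_assoc] using hν))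
  · exact fun h M _ hν => h M _ (sat_rename.1 hν)

theorem Entails.rename (π : Equiv.Perm ℕ) {C D : Multiset (Builtin L)} (h : Entails CT C D) :
    Entails CT (C.map (Builtin.subst fun y => .var (π y)))
      (D.map (Builtin.subst fun y => .var (π y))) :=
  fun M _ hν => sat_rename.2 (h M _ (sat_rename.1 hν))

theorem EntailsEx.rename (π : Equiv.Perm ℕ) {C D : Multiset (Builtin L)} {X : Set ℕ}
    (h : EntailsEx CT C X D) : EntailsEx CT (C.map (Builtin.subst fun y => .var (π y))) (π '' X)
      (D.map (Builtin.subst fun y => .var (π y))) := by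
  intro M ν hν
  obtain ⟨μ, hμ, hD⟩ := h M _ (sat_rename.1 hν)
  refine ⟨μ ∘ π.symm, fun y hy => ?_, sat_rename.2 (by simpa [Function.comp_assoc] using hD)⟩
  have : π.symm y ∉ X := fun h => hy ⟨_, h, by simp⟩
  simpa using hμ _ this

end Renaming

/-! ### Transitions: growth of variables and constraints, solving, renaming -/

section Transitions

variable {L : FirstOrder.Language.{u, v}} {Q : ℕ → Type w} {N : Type x}

/-- The conjunction of all the built-in constraints of a configuration. -/
def Conf.total (σ : Conf L Q N) : Multiset (Builtin L) := σ.pending + σ.store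

theorem Conf.vars_eq (σ : Conf L Q N) : σ.vars = atomVars σ.atoms ∪ builtinVars σ.total := by
  rw [Conf.vars, Conf.total, builtinVars_add, Set.union_assoc]

/-- The variants of the rules of a program. -/
def variants (P : Set (Rule L Q N)) : Set (Rule L Q N) := {r | ∃ cl ∈ P, ∃ π, r = cl.rename π}

/-- The configuration reached by firing the rule `r`. -/
noncomputable def Rule.result (r : Rule L Q N) (H₁ H₂ : List (IdAtom L Q))
    (G : Multiset (IdAtom L Q)) (B C E : Multiset (Builtin L)) (T : Set (Token N)) (n : ℕ) :
    Conf L Q N :=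
  ⟨shiftAtoms n r.body + Multiset.ofList H₁ + G, r.builtins + B, E + r.guard + C,
    T ∪ {⟨r.name, (H₁ ++ H₂).map IdAtom.id⟩} ∪ shiftTokens n r.tokens,
    n + maxId r.body r.tokens⟩

/-- The variant `r` can be fired on `H₁`, `H₂`. -/
structure Rule.Fires (CT : L.Theory) (r : Rule L Q N) (H₁ H₂ : List (IdAtom L Q))
    (G : Multiset (IdAtom L Q)) (B C E : Multiset (Builtin L)) (T : Set (Token N)) (n : ℕ) :
    Prop where
  sat : ¬ Unsat CT C
  fresh : Disjoint r.vars (Conf.vars (N := N) ⟨Multiset.ofList (H₁ ++ H₂) + G, B, C, T, n⟩)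
  headEq : HeadEq H₁ H₂ r.kept r.removed E
  guard : EntailsEx CT C r.vars (E + r.guard)
  token : (⟨r.name, (H₁ ++ H₂).map IdAtom.id⟩ : Token N) ∉ T

variable {CT : L.Theory} {P : Set (Rule L Q N)}

theorem Rule.Fires.applyStep {r : Rule L Q N} {H₁ H₂ : List (IdAtom L Q)}
    {G : Multiset (IdAtom L Q)} {B C E : Multiset (Builtin L)} {T : Set (Token N)} {n : ℕ}
    (h : r.Fires CT H₁ H₂ G B C E T n) (hr : r ∈ variants P) :
    ApplyStep CT P ⟨Multiset.ofList (H₁ ++ H₂) + G, B, C, T, n⟩ (r.result H₁ H₂ G B C E T n) := by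
  obtain ⟨cl, hcl, π, rfl⟩ := hr
  have := ApplyStep.mk (CT := CT) cl hcl π H₁ H₂ G B C E T n h.sat h.fresh h.headEq h.guard h.token
  rw [Rule.result, Rule.maxId_rename]
  exact this

theorem ApplyStep.exists_fires {b b₁ : Conf L Q N} (h : ApplyStep CT P b b₁) :
    ∃ r ∈ variants P, ∃ H₁ H₂ G B C E T n, r.Fires CT H₁ H₂ G B C E T n ∧
      b = ⟨Multiset.ofList (H₁ ++ H₂) + G, B, C, T, n⟩ ∧ b₁ = r.result H₁ H₂ G B C E T n := by
  obtain ⟨cl, hcl, π, H₁, H₂, G, B, C, E, T, n, hC, hfresh, hE, hguard, htoken⟩ := h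
  refine ⟨cl.rename π, ⟨cl, hcl, π, rfl⟩, H₁, H₂, G, B, C, E, T, n,
    ⟨hC, hfresh, hE, hguard, htoken⟩, rfl, ?_⟩
  rw [Rule.result, Rule.maxId_rename]
  rfl

/-- Removed constraints lose no variables, because their arguments survive in the matching equations
`E`. The variables thus grow by exactly those of the rule. -/
theorem Rule.vars_result {r : Rule L Q N} {H₁ H₂ : List (IdAtom L Q)}
    {G : Multiset (IdAtom L Q)} {B C E : Multiset (Builtin L)} {T : Set (Token N)} {n : ℕ}
    (h : HeadEq H₁ H₂ r.kept r.removed E) :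
    (r.result H₁ H₂ G B C E T n).vars =
      Conf.vars (N := N) ⟨Multiset.ofList (H₁ ++ H₂) + G, B, C, T, n⟩ ∪ r.vars := by
  have := h.vars_eq
  ext y
  simp only [Conf.vars, Rule.result, Rule.vars, atomVars_add, builtinVars_add, this,
    shiftAtoms_eq, atomVars_mapIds, atomVars_coe, List.map_append, headVars_append, Set.mem_union]
  tauto

theorem SolveStep.total_eq {σ σ' : Conf L Q N} (h : SolveStep CT σ σ') :
    σ'.atoms = σ.atoms ∧ σ'.tokens = σ.tokens ∧ σ'.counter = σ.counter ∧ σ'.total = σ.total ∧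
      σ.pending.card = σ'.pending.card + 1 := by
  obtain ⟨c, G, B, C, T, n, hC⟩ := h
  refine ⟨rfl, rfl, rfl, ?_, by simp⟩
  simp [Conf.total]

theorem Step.total_le {σ σ' : Conf L Q N} (h : Step CT P σ σ') : σ.total ≤ σ'.total := by
  rcases h with h | h
  · rw [h.total_eq.2.2.2.1]
  · obtain ⟨r, -, H₁, H₂, G, B, C, E, T, n, -, rfl, rfl⟩ := h.exists_fires
    refine add_le_add (Multiset.le_add_left _ _) (Multiset.le_add_left _ _)

theorem NormalStep.step {σ σ' : Conf L Q N} (h : NormalStep CT P σ σ') : Step CT P σ σ' :=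
  h.imp id And.right

theorem Step.vars_subset {σ σ' : Conf L Q N} (h : Step CT P σ σ') : σ.vars ⊆ σ'.vars := by
  rcases h with h | h
  · rw [Conf.vars_eq, Conf.vars_eq, h.total_eq.2.2.2.1, h.total_eq.1]
  · obtain ⟨r, -, H₁, H₂, G, B, C, E, T, n, hf, rfl, rfl⟩ := h.exists_fires
    rw [Rule.vars_result hf.headEq]
    exact Set.subset_union_left

theorem steps_vars_subset {σ σ' : Conf L Q N} (h : Relation.ReflTransGen (Step CT P) σ σ') :
    σ.vars ⊆ σ'.vars := by
  induction h with
  | refl => exact subset_rfl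
  | tail _ h ih => exact ih.trans h.vars_subset

theorem steps_total_le {σ σ' : Conf L Q N} (h : Relation.ReflTransGen (Step CT P) σ σ') :
    σ.total ≤ σ'.total := by
  induction h with
  | refl => exact le_rfl
  | tail _ h ih => exact ih.trans h.total_le

/-- Constraints are moved until none is pending or the store fails. The first outcome is also
possible with an empty pending part only if everything is consistent, so the two cases separate by
satisfiability of the total. -/
theorem exists_solve (CT : L.Theory) (σ : Conf L Q N) :
    ∃ σ', Relation.ReflTransGen (SolveStep CT) σ σ' ∧ σ'.atoms = σ.atoms ∧
      σ'.tokens = σ.tokens ∧ σ'.counter = σ.counter ∧ σ'.total = σ.total ∧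
      ((σ'.pending = 0 ∧ ¬ Unsat CT σ.total) ∨ (Unsat CT σ'.store ∧ Unsat CT σ.total)) := by
  obtain ⟨G, B, C, T, n⟩ := σ
  induction B using Multiset.induction_on generalizing C with
  | empty =>
    refine ⟨_, .refl, rfl, rfl, rfl, rfl, ?_⟩
    simp only [Conf.total, zero_add]
    tauto
  | cons c B ih =>
    by_cases hC : Unsat CT C
    · exact ⟨_, .refl, rfl, rfl, rfl, rfl, Or.inr ⟨hC, hC.mono (Multiset.le_add_left _ _)⟩⟩
    · obtain ⟨σ', h, h1, h2, h3, h4, h5⟩ := ih (c ::ₘ C)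
      have e : Conf.total (N := N) ⟨G, B, c ::ₘ C, T, n⟩ = Conf.total ⟨G, c ::ₘ B, C, T, n⟩ := by
        simp [Conf.total]
      rw [e] at h4 h5
      exact ⟨σ', .head (SolveStep.mk c G B C T n hC) h, h1, h2, h3, h4, h5⟩

theorem SolveStep.rename (π : Equiv.Perm ℕ) {σ σ' : Conf L Q N} (h : SolveStep CT σ σ') :
    SolveStep CT (σ.rename π) (σ'.rename π) := by
  obtain ⟨c, G, B, C, T, n, hC⟩ := h
  simp only [Conf.rename, Multiset.map_cons]
  exact SolveStep.mk _ _ _ _ _ _ (by rwa [unsat_rename])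

/-- Lets the fresh variables of a given step be chosen anew when they clash with variables of the
simulating configuration. -/
theorem ApplyStep.rename (π : Equiv.Perm ℕ) {σ σ' : Conf L Q N} (h : ApplyStep CT P σ σ') :
    ApplyStep CT P (σ.rename π) (σ'.rename π) := by
  obtain ⟨r, ⟨cl, hcl, β, rfl⟩, H₁, H₂, G, B, C, E, T, n, hf, rfl, rfl⟩ := h.exists_fires
  have hids : (H₁.map (IdAtom.subst fun y => .var (π y)) ++
      H₂.map (IdAtom.subst fun y => .var (π y))).map IdAtom.id = (H₁ ++ H₂).map IdAtom.id := by
    simp [Function.comp_def, IdAtom.subst]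
  have hsrc : (⟨Multiset.ofList (H₁.map (IdAtom.subst fun y => .var (π y)) ++
      H₂.map (IdAtom.subst fun y => .var (π y))) + G.map (IdAtom.subst fun y => .var (π y)),
      B.map (Builtin.subst fun y => .var (π y)), C.map (Builtin.subst fun y => .var (π y)), T, n⟩ :
      Conf L Q N) = Conf.rename π ⟨Multiset.ofList (H₁ ++ H₂) + G, B, C, T, n⟩ := by
    simp [Conf.rename]
  have hf' : ((cl.rename β).rename π).Fires CT (H₁.map (IdAtom.subst fun y => .var (π y)))
      (H₂.map (IdAtom.subst fun y => .var (π y))) (G.map (IdAtom.subst fun y => .var (π y)))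
      (B.map (Builtin.subst fun y => .var (π y))) (C.map (Builtin.subst fun y => .var (π y)))
      (E.map (Builtin.subst fun y => .var (π y))) T n := by
    refine ⟨by rw [unsat_rename]; exact hf.sat, ?_, hf.headEq.subst _, ?_, ?_⟩
    · rw [hsrc, Conf.vars_rename, Rule.vars_rename]
      exact (Set.disjoint_image_iff π.injective).2 hf.fresh
    · rw [Rule.vars_rename]
      have := hf.guard.rename π
      rwa [Multiset.map_add] at this
    · rw [hids]; exact hf.token
  have := hf'.applyStep (P := P) ⟨cl, hcl, π * β, Rule.rename_rename _ _ _⟩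
  rw [hsrc] at this
  convert this using 1
  simp only [Rule.result, Conf.rename, Conf.mk.injEq, Multiset.map_add, hids, Multiset.map_coe,
    shiftAtoms_eq, ← mapIds_map_subst]
  refine ⟨rfl, rfl, rfl, rfl, ?_⟩
  simp only [Rule.maxId_rename]

theorem NormalStep.rename (π : Equiv.Perm ℕ) {σ σ' : Conf L Q N} (h : NormalStep CT P σ σ') :
    NormalStep CT P (σ.rename π) (σ'.rename π) := by
  rcases h with h | ⟨h0, h⟩
  · exact Or.inl (h.rename π)
  · refine Or.inr ⟨?_, h.rename π⟩
    simp only [Conf.BuiltinFree] at h0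
    simp [Conf.BuiltinFree, Conf.rename, h0]

end Transitions

/-! ### The simulation relation and its preservation by a common rule -/

section Simulation

variable {L : FirstOrder.Language.{u, v}} {Q : ℕ → Type w} {N : Type x}

/-- `a` simulates `b`: up to an increasing renaming of the identifiers they have the same
identified constraints and the same live tokens, and the built-in constraints of `a` are equivalent
to those of `b`, up to variables that do not occur in `b`. -/
structure Simulates (CT : L.Theory) (a b : Conf L Q N) : Prop where
  ids : ∃ g : ℕ → ℕ, StrictMono g ∧ (∀ i ≤ b.counter, g i ≤ a.counter) ∧
    a.atoms = mapIds g b.atoms ∧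
    ∀ t : Token N, (∀ i ∈ t.ids, i ∈ atomIds b.atoms) →
      (t ∈ b.tokens ↔ (⟨t.name, t.ids.map g⟩ : Token N) ∈ a.tokens)
  atom_le : ∀ i ∈ atomIds b.atoms, i ≤ b.counter
  token_le : ∀ i ∈ tokenIds b.tokens, i ≤ b.counter
  token_le' : ∀ i ∈ tokenIds a.tokens, i ≤ a.counter
  vars_subset : b.vars ⊆ a.vars
  total : ∀ (M : Theory.ModelType.{u, v, max u v} CT) (ν : ℕ → M),
    Sat ν b.total ↔ SatEx ν b.varsᶜ a.total

variable {CT : L.Theory}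

theorem Conf.Valid.simulates {σ : Conf L Q N} (h : σ.Valid) : Simulates CT σ σ where
  ids := ⟨id, strictMono_id, fun _ h => h, (mapIds_id _).symm, fun t _ => by simp⟩
  atom_le := by rintro i ⟨a, ha, rfl⟩; exact h.ids_le a ha
  token_le := h.tokens_le
  token_le' := h.tokens_le
  vars_subset := subset_rfl
  total := by
    intro M ν
    refine ⟨fun h => ⟨ν, fun _ _ => rfl, h⟩, ?_⟩
    rintro ⟨μ, hμ, h⟩
    refine (sat_congr fun y hy => hμ y ?_).1 h
    simp [Conf.vars_eq, hy]

/-- The relation sees the built-in constraints only through their total, hence it survives Solve'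
steps; `Simulates.congr_right` is the same for the other side. -/
theorem Simulates.congr_left {a a' b : Conf L Q N} (h : Simulates CT a b)
    (h₁ : a'.atoms = a.atoms) (h₂ : a'.tokens = a.tokens) (h₃ : a'.counter = a.counter)
    (h₄ : a'.total = a.total) : Simulates CT a' b where
  ids := by rw [h₁, h₂, h₃]; exact h.ids
  atom_le := h.atom_le
  token_le := h.token_le
  token_le' := by rw [h₂, h₃]; exact h.token_le'
  vars_subset := by
    have := h.vars_subset
    rwa [a.vars_eq, ← h₁, ← h₄, ← a'.vars_eq] at this
  total := by rw [h₄]; exact h.total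

theorem Simulates.congr_right {a b b' : Conf L Q N} (h : Simulates CT a b)
    (h₁ : b'.atoms = b.atoms) (h₂ : b'.tokens = b.tokens) (h₃ : b'.counter = b.counter)
    (h₄ : b'.total = b.total) : Simulates CT a b' := by
  have hv : b'.vars = b.vars := by rw [Conf.vars_eq, Conf.vars_eq, h₁, h₄]
  exact
  { ids := by rw [h₁, h₂, h₃]; exact h.ids
    atom_le := by rw [h₁, h₃]; exact h.atom_le
    token_le := by rw [h₂, h₃]; exact h.token_le
    token_le' := h.token_le'
    vars_subset := by rw [hv]; exact h.vars_subset
    total := by rw [h₄, hv]; exact h.total }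

/-- Projections compose because the variable sets are nested: a valuation fixed on the variables of
`b` is fixed on those of `c`. -/
theorem Simulates.trans {a b c : Conf L Q N} (h : Simulates CT a b) (h' : Simulates CT b c) :
    Simulates CT a c where
  ids := by
    obtain ⟨g, hg, hg₁, hg₂, hg₃⟩ := h.ids
    obtain ⟨k, hk, hk₁, hk₂, hk₃⟩ := h'.ids
    refine ⟨g ∘ k, hg.comp hk, fun i hi => hg₁ _ (hk₁ _ hi), ?_, fun t ht => ?_⟩
    · rw [hg₂, hk₂, mapIds_mapIds]
    · rw [hk₃ t ht, hg₃ ⟨t.name, t.ids.map k⟩, List.map_map]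
      intro i hi
      obtain ⟨j, hj, rfl⟩ := List.mem_map.1 hi
      rw [hk₂, atomIds_mapIds]
      exact ⟨j, ht j hj, rfl⟩
  atom_le := h'.atom_le
  token_le := h'.token_le
  token_le' := h.token_le'
  vars_subset := h'.vars_subset.trans h.vars_subset
  total := by
    intro M ν
    rw [h'.total]
    constructor
    · rintro ⟨μ, hμ, h₁⟩
      obtain ⟨μ', hμ', h₂⟩ := (h.total M μ).1 h₁
      refine ⟨μ', fun y hy => ?_, h₂⟩
      rw [hμ' y (by simpa using h'.vars_subset (by simpa using hy)), hμ y hy]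
    · rintro ⟨μ, hμ, h₁⟩
      exact ⟨μ, hμ, (h.total M μ).2 ⟨μ, fun _ _ => rfl, h₁⟩⟩

theorem Simulates.entails {a b : Conf L Q N} (h : Simulates CT a b) :
    Entails CT a.total b.total :=
  fun M ν hν => (h.total M ν).2 ⟨ν, fun _ _ => rfl, hν⟩

theorem Simulates.unsat_iff {a b : Conf L Q N} (h : Simulates CT a b) :
    Unsat CT a.total ↔ Unsat CT b.total := by
  constructor
  · intro H M ν hν
    obtain ⟨μ, -, hμ⟩ := (h.total M ν).1 hν
    exact H M μ hμ
  · exact fun H M ν hν => H M ν (h.entails M ν hν)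

/-- The identifiers of the body are positive, and those of the local tokens occur in the body. -/
def Rule.LocalIds (r : Rule L Q N) : Prop :=
  (∀ i ∈ atomIds r.body, 1 ≤ i) ∧ tokenIds r.tokens ⊆ atomIds r.body

theorem Rule.WF.localIds {r : Rule L Q N} (h : r.WF) : r.LocalIds :=
  ⟨by rintro i ⟨b, hb, rfl⟩; exact h.ids_pos b hb, h.tokens_ids⟩

/-- `maxId` is a supremum in `ℕ`, meaningful only for bounded sets. Local tokens use identifiers of
the finite body, which gives the bound. -/
theorem Rule.LocalIds.le_maxId {r : Rule L Q N} (h : r.LocalIds) {i : ℕ}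
    (hi : i ∈ atomIds r.body) : i ≤ maxId r.body r.tokens :=
  le_csSup (((finite_atomIds r.body).union ((finite_atomIds r.body).subset h.2)).bddAbove)
    (Or.inl hi)

theorem atomIds_shiftAtoms (n : ℕ) (A : Multiset (IdAtom L Q)) :
    atomIds (shiftAtoms n A) = (n + ·) '' atomIds A :=
  atomIds_mapIds _ _

theorem Rule.LocalIds.of_mem_shiftTokens {r : Rule L Q N} (h : r.LocalIds) {n : ℕ} {t : Token N}
    (ht : t ∈ shiftTokens n r.tokens) {i : ℕ} (hi : i ∈ t.ids) :
    ∃ j ∈ atomIds r.body, 1 ≤ j ∧ j ≤ maxId r.body r.tokens ∧ i = n + j := by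
  obtain ⟨t, ht, rfl⟩ := ht
  obtain ⟨j, hj, rfl⟩ := List.mem_map.1 hi
  have := h.2 ⟨t, ht, hj⟩
  exact ⟨j, this, h.1 j this, h.le_maxId this, rfl⟩

theorem mem_tokenIds_union {T T' : Set (Token N)} {i : ℕ} :
    i ∈ tokenIds (T ∪ T') ↔ i ∈ tokenIds T ∨ i ∈ tokenIds T' := by
  simp only [tokenIds, Set.mem_ofPred_eq, Set.mem_union]
  constructor
  · rintro ⟨t, ht | ht, h⟩
    exacts [Or.inl ⟨t, ht, h⟩, Or.inr ⟨t, ht, h⟩]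
  · rintro (⟨t, ht, h⟩ | ⟨t, ht, h⟩)
    exacts [⟨t, Or.inl ht, h⟩, ⟨t, Or.inr ht, h⟩]

theorem Rule.LocalIds.token_le_result {r : Rule L Q N} (hr : r.LocalIds)
    {H₁ H₂ : List (IdAtom L Q)} {G : Multiset (IdAtom L Q)} {B C E : Multiset (Builtin L)}
    {T : Set (Token N)} {n : ℕ} (hT : ∀ i ∈ tokenIds T, i ≤ n)
    (hH : ∀ i ∈ (H₁ ++ H₂).map IdAtom.id, i ≤ n) :
    ∀ i ∈ tokenIds (r.result H₁ H₂ G B C E T n).tokens, i ≤ (r.result H₁ H₂ G B C E T n).counter := by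
  intro i hi
  simp only [Rule.result, mem_tokenIds_union] at hi ⊢
  rcases hi with (hi | ⟨t, rfl, hi⟩) | ⟨t, ht, hi⟩
  · have := hT i hi; omega
  · have := hH i hi; omega
  · obtain ⟨j, -, -, h, rfl⟩ := hr.of_mem_shiftTokens ht hi; omega

theorem Rule.LocalIds.atom_le_result {r : Rule L Q N} (hr : r.LocalIds)
    {H₁ H₂ : List (IdAtom L Q)} {G : Multiset (IdAtom L Q)} {B C E : Multiset (Builtin L)}
    {T : Set (Token N)} {n : ℕ}
    (hH : ∀ i ∈ atomIds (Multiset.ofList (H₁ ++ H₂) + G), i ≤ n) :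
    ∀ i ∈ atomIds (r.result H₁ H₂ G B C E T n).atoms, i ≤ (r.result H₁ H₂ G B C E T n).counter := by
  intro i hi
  simp only [Rule.result, atomIds_add, atomIds_shiftAtoms] at hi ⊢
  rcases hi with (⟨j, hj, rfl⟩ | hi) | hi
  · have := hr.le_maxId hj; simp only; omega
  · have := hH i (by simp only [atomIds_add, atomIds_coe, List.map_append] at hi ⊢; exact Or.inl (List.mem_append_left _ hi)); omega
  · have := hH i (by rw [atomIds_add]; exact Or.inr hi); omega

/-- The extension of a map of identifiers to the identifiers introduced by a rule. -/
def extendIds (g : ℕ → ℕ) (n m : ℕ) : ℕ → ℕ := fun i => if i ≤ n then g i else m + (i - n)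

theorem extendIds_of_le {g : ℕ → ℕ} {n m i : ℕ} (h : i ≤ n) : extendIds g n m i = g i := if_pos h

theorem extendIds_add {g : ℕ → ℕ} {n m i : ℕ} (h : 1 ≤ i) : extendIds g n m (n + i) = m + i := by
  rw [extendIds, if_neg (by omega)]; omega

theorem strictMono_extendIds {g : ℕ → ℕ} (hg : StrictMono g) {n m : ℕ} (h : ∀ i ≤ n, g i ≤ m) :
    StrictMono (extendIds g n m) := by
  intro i j hij
  simp only [extendIds]
  split_ifs with h1 h2
  · exact hg hij
  · have := h i h1; omega
  · omega
  · omega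

/-- The relation between the tokens is preserved when a rule is fired. -/
theorem mem_tokens_result_iff {r : Rule L Q N} (hr : r.LocalIds) {H₁ H₂ : List (IdAtom L Q)}
    {G : Multiset (IdAtom L Q)} {T T' : Set (Token N)} {n n' : ℕ} {g : ℕ → ℕ} (hg : StrictMono g)
    (hle : ∀ i ≤ n, g i ≤ n')
    (hH : ∀ i ∈ atomIds (Multiset.ofList (H₁ ++ H₂) + G), i ≤ n)
    (hT : ∀ i ∈ tokenIds T, i ≤ n) (hT' : ∀ i ∈ tokenIds T', i ≤ n')
    (hTT' : ∀ t : Token N, (∀ i ∈ t.ids, i ∈ atomIds (Multiset.ofList (H₁ ++ H₂) + G)) →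
      (t ∈ T ↔ (⟨t.name, t.ids.map g⟩ : Token N) ∈ T'))
    (t : Token N)
    (ht : ∀ i ∈ t.ids, i ∈ atomIds (shiftAtoms n r.body + Multiset.ofList H₁ + G)) :
    t ∈ T ∪ {⟨r.name, (H₁ ++ H₂).map IdAtom.id⟩} ∪ shiftTokens n r.tokens ↔
      (⟨t.name, t.ids.map (extendIds g n n')⟩ : Token N) ∈
        T' ∪ {⟨r.name, ((H₁ ++ H₂).map IdAtom.id).map g⟩} ∪ shiftTokens n' r.tokens := by
  have hinj := (strictMono_extendIds hg hle).injective
  have hold : ∀ i ∈ t.ids, i ≤ n → i ∈ atomIds (Multiset.ofList (H₁ ++ H₂) + G) := by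
    intro i hi hin
    have := ht i hi
    simp only [atomIds_add, atomIds_shiftAtoms, atomIds_coe, List.map_append] at this ⊢
    rcases this with (⟨j, hj, rfl⟩ | h) | h
    · have := hr.1 j hj; simp only at hin; omega
    · exact Or.inl (List.mem_append_left _ h)
    · exact Or.inr h
  have h₁ : t ∈ T ↔ (⟨t.name, t.ids.map (extendIds g n n')⟩ : Token N) ∈ T' := by
    constructor
    · intro h
      have hn : ∀ i ∈ t.ids, i ≤ n := fun i hi => hT i ⟨t, h, hi⟩
      rw [List.map_congr_left fun i hi => extendIds_of_le (hn i hi)]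
      exact (hTT' t fun i hi => hold i hi (hn i hi)).1 h
    · intro h
      -- New identifiers are mapped above `n'`, but those of `T'` are at most `n'`; so `t` has old
      -- identifiers only.
      have hn : ∀ i ∈ t.ids, i ≤ n := by
        intro i hi
        have := hT' _ ⟨_, h, List.mem_map_of_mem hi⟩
        by_contra hc
        rw [extendIds, if_neg hc] at this
        omega
      rw [List.map_congr_left fun i hi => extendIds_of_le (hn i hi)] at h
      exact (hTT' t fun i hi => hold i hi (hn i hi)).2 h
  have h₂ : t = ⟨r.name, (H₁ ++ H₂).map IdAtom.id⟩ ↔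
      (⟨t.name, t.ids.map (extendIds g n n')⟩ : Token N) =
        ⟨r.name, ((H₁ ++ H₂).map IdAtom.id).map g⟩ := by
    obtain ⟨nm, is⟩ := t
    have : ((H₁ ++ H₂).map IdAtom.id).map g =
        ((H₁ ++ H₂).map IdAtom.id).map (extendIds g n n') := by
      refine List.map_congr_left fun i hi => (extendIds_of_le (hH i ?_)).symm
      rw [atomIds_add, atomIds_coe]
      exact Or.inl hi
    rw [this, Token.mk.injEq, Token.mk.injEq, (List.map_injective_iff.2 hinj).eq_iff]
  have h₃ : t ∈ shiftTokens n r.tokens ↔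
      (⟨t.name, t.ids.map (extendIds g n n')⟩ : Token N) ∈ shiftTokens n' r.tokens := by
    have key : ∀ s ∈ r.tokens, (s.ids.map (n + ·)).map (extendIds g n n') = s.ids.map (n' + ·) := by
      intro s hs
      rw [List.map_map]
      exact List.map_congr_left fun i hi => extendIds_add (hr.1 i (hr.2 ⟨s, hs, hi⟩))
    constructor
    · rintro ⟨s, hs, rfl⟩
      exact ⟨s, hs, by simp only [key s hs]⟩
    · rintro ⟨s, hs, h⟩
      refine ⟨s, hs, ?_⟩
      obtain ⟨nm, is⟩ := t
      simp only [Token.mk.injEq] at h ⊢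
      refine ⟨h.1, List.map_injective_iff.2 hinj ?_⟩
      rw [key s hs, h.2]
  simp only [Set.mem_union, Set.mem_singleton_iff, h₁, h₂, h₃]

theorem solveSteps_normal {P : Set (Rule L Q N)} {σ σ' : Conf L Q N}
    (h : Relation.ReflTransGen (SolveStep CT) σ σ') :
    Relation.ReflTransGen (NormalStep CT P) σ σ' :=
  Relation.ReflTransGen.mono (r := SolveStep CT) (p := NormalStep CT P) (fun _ _ => Or.inl) _ _ h

/-- A transition by a rule of the program is simulated by the same rule, followed by the solution
of the built-in constraints of its body. -/
theorem Simulates.exists_apply {P : Set (Rule L Q N)} {a : Conf L Q N} {r : Rule L Q N}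
    (hrP : r ∈ variants P) (hr : r.LocalIds)
    {H₁ H₂ : List (IdAtom L Q)} {G : Multiset (IdAtom L Q)} {B C E : Multiset (Builtin L)}
    {T : Set (Token N)} {n : ℕ}
    (h : Simulates CT a ⟨Multiset.ofList (H₁ ++ H₂) + G, B, C, T, n⟩) (ha : a.pending = 0)
    (hsat : ¬ Unsat CT (B + C)) (hf : r.Fires CT H₁ H₂ G B C E T n)
    (hfresh : Disjoint r.vars a.vars) :
    ∃ a₁, Relation.TransGen (NormalStep CT P) a a₁ ∧
      ((Unsat CT a₁.store ∧ Unsat CT (r.result H₁ H₂ G B C E T n).total) ∨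
        (Simulates CT a₁ (r.result H₁ H₂ G B C E T n) ∧ a₁.pending = 0 ∧
          a₁.vars = a.vars ∪ r.vars)) := by
  obtain ⟨g, hg, hle, hatoms, htok⟩ := h.ids
  obtain ⟨A, B', C', T', n'⟩ := a
  simp only at ha hle hatoms htok
  subst ha hatoms
  have hatom_le := h.atom_le
  have htoken_le := h.token_le
  have htoken_le' := h.token_le'
  simp only at hatom_le htoken_le htoken_le'
  have hC' : ¬ Unsat CT C' := by
    have := h.unsat_iff
    simp only [Conf.total, zero_add] at this
    rwa [this]
  have hent := h.entails
  simp only [Conf.total, zero_add] at hent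
  set H₁' := H₁.map fun a => (⟨a.chr, g a.id⟩ : IdAtom L Q) with hH₁'
  set H₂' := H₂.map fun a => (⟨a.chr, g a.id⟩ : IdAtom L Q) with hH₂'
  have hids : (H₁' ++ H₂').map IdAtom.id = ((H₁ ++ H₂).map IdAtom.id).map g := by
    simp [hH₁', hH₂', Function.comp_def]
  have hsrc : mapIds g (Multiset.ofList (H₁ ++ H₂) + G) =
      Multiset.ofList (H₁' ++ H₂') + mapIds g G := by
    rw [mapIds_add, mapIds_coe, List.map_append]
  have hHmem : ∀ i ∈ (H₁ ++ H₂).map IdAtom.id, i ∈ atomIds (Multiset.ofList (H₁ ++ H₂) + G) := by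
    intro i hi
    rw [atomIds_add, atomIds_coe]
    exact Or.inl hi
  have hf' : r.Fires CT H₁' H₂' (mapIds g G) 0 C' E T' n' := by
    refine ⟨hC', by rwa [← hsrc], hf.headEq.mapIds g, ?_, ?_⟩
    · intro M ν hν
      -- The store of `a` entails all of `B + C`, hence the store `C` that already licensed the
      -- guard.
      exact hf.guard M ν (sat_add.1 (hent M ν hν)).2
    · rw [hids]
      exact fun hmem => hf.token ((htok ⟨_, _⟩ hHmem).2 hmem)
  have happ := hf'.applyStep hrP
  obtain ⟨a₁, hsteps, h1, h2, h3, h4, h5⟩ := exists_solve CT (r.result H₁' H₂' (mapIds g G) 0 C' E T' n')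
  have hvars : (r.result H₁' H₂' (mapIds g G) 0 C' E T' n').vars =
      Conf.vars (N := N) ⟨mapIds g (Multiset.ofList (H₁ ++ H₂) + G), 0, C', T', n'⟩ ∪ r.vars := by
    rw [Rule.vars_result hf'.headEq, hsrc]
  have hvarsb := Rule.vars_result (G := G) (B := B) (C := C) (T := T) (n := n) hf.headEq
  have hsim : Simulates CT (r.result H₁' H₂' (mapIds g G) 0 C' E T' n')
      (r.result H₁ H₂ G B C E T n) := by
    refine ⟨⟨extendIds g n n', strictMono_extendIds hg hle, ?_, ?_, ?_⟩, ?_, ?_, ?_, ?_, ?_⟩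
    · intro i hi
      simp only [Rule.result] at hi ⊢
      by_cases hin : i ≤ n
      · rw [extendIds_of_le hin]
        have := hle i hin
        omega
      · rw [extendIds, if_neg hin]; omega
    · simp only [Rule.result, mapIds_add, shiftAtoms_eq, mapIds_mapIds]
      have e₁ : mapIds (extendIds g n n' ∘ (n + ·)) r.body = mapIds (n' + ·) r.body :=
        mapIds_congr fun i hi => extendIds_add (hr.1 i hi)
      have e₂ : mapIds (extendIds g n n') (Multiset.ofList H₁) = Multiset.ofList H₁' := by
        rw [hH₁', ← mapIds_coe]
        refine mapIds_congr fun i hi => extendIds_of_le (hatom_le i ?_)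
        simp only [atomIds_add, atomIds_coe, List.map_append] at hi ⊢
        exact Or.inl (List.mem_append_left _ hi)
      have e₃ : mapIds (extendIds g n n') G = mapIds g G :=
        mapIds_congr fun i hi => extendIds_of_le (hatom_le i (by rw [atomIds_add]; exact Or.inr hi))
      rw [e₁, e₂, e₃]
    · intro t ht
      have := mem_tokens_result_iff hr hg hle hatom_le htoken_le htoken_le' htok t ht
      simp only [Rule.result]
      rw [this, hids]
    · exact hr.atom_le_result hatom_le
    · exact hr.token_le_result htoken_le fun i hi => hatom_le i (hHmem i hi)
    · refine hr.token_le_result htoken_le' fun i hi => ?_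
      rw [hids] at hi
      obtain ⟨j, hj, rfl⟩ := List.mem_map.1 hi
      exact hle j (hatom_le j (hHmem j hj))
    · rw [hvars, hvarsb]
      exact Set.union_subset_union_left _ h.vars_subset
    · intro M ν
      rw [hvarsb]
      have hR : ∀ y ∈ builtinVars (r.builtins + (E + r.guard)), y ∈
          Conf.vars (N := N) ⟨Multiset.ofList (H₁ ++ H₂) + G, B, C, T, n⟩ ∪ r.vars := by
        intro y hy
        simp only [builtinVars_add, hf.headEq.vars_eq] at hy
        simp only [Conf.vars, Rule.vars, atomVars_add, atomVars_coe, Set.mem_union] at hy ⊢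
        tauto
      have hb : (r.result H₁ H₂ G B C E T n).total = (r.builtins + (E + r.guard)) + (B + C) := by
        simp only [Rule.result, Conf.total]; abel
      have ha : (r.result H₁' H₂' (mapIds g G) 0 C' E T' n').total =
          (r.builtins + (E + r.guard)) + C' := by
        simp only [Rule.result, Conf.total]; abel
      have htot := h.total M
      simp only [Conf.total, zero_add] at htot
      rw [hb, ha, sat_add, htot]
      constructor
      · rintro ⟨hRν, μ, hμ, hCμ⟩
        classical
        -- The projection yields `μ` agreeing with `ν` only on the variables of `b`. Resetting the
        -- variables of `r` to `ν` restores the constraints of the rule and leaves `C'` true, since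
        -- `r` is fresh for `a`.
        set κ : ℕ → M := fun y => if y ∈ r.vars then ν y else μ y with hκ
        have hκν : ∀ y ∈ Conf.vars (N := N) ⟨Multiset.ofList (H₁ ++ H₂) + G, B, C, T, n⟩ ∪ r.vars,
            κ y = ν y := by
          intro y hy
          by_cases hyr : y ∈ r.vars
          · simp [hκ, hyr]
          · simp only [hκ, if_neg hyr]
            exact hμ y (by simpa using hy.resolve_right hyr)
        refine ⟨κ, fun y hy => hκν y (not_not.1 hy), sat_add.2 ⟨?_, ?_⟩⟩
        · exact (sat_congr fun y hy => hκν y (hR y hy)).2 hRν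
        · refine (sat_congr fun y hy => ?_).2 hCμ
          have : y ∉ r.vars := fun hyr => Set.disjoint_left.1 hfresh hyr (Or.inr hy)
          simp [hκ, this]
      · rintro ⟨μ, hμ, hRμ⟩
        rw [sat_add] at hRμ
        refine ⟨(sat_congr fun y hy => hμ y (not_not.2 (hR y hy))).1 hRμ.1, μ, ?_, hRμ.2⟩
        intro y hy
        exact hμ y (fun h => h (Or.inl (by simpa using hy)))
  refine ⟨a₁, ?_, ?_⟩
  · refine Relation.TransGen.head' (Or.inr ⟨rfl, ?_⟩) (solveSteps_normal hsteps)
    rw [hsrc]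
    exact happ
  · rcases h5 with ⟨h5, -⟩ | ⟨h5, h6⟩
    · refine Or.inr ⟨hsim.congr_left h1 h2 h3 h4, h5, ?_⟩
      rw [Conf.vars_eq, h1, h4, ← Conf.vars_eq, hvars]
    · exact Or.inl ⟨h5, hsim.unsat_iff.1 h6⟩

end Simulation

/-! ### Unfolding: invariance under renaming, variables -/

section Unfolding

variable {L : FirstOrder.Language.{u, v}} {Q : ℕ → Type w} {N : Type x}

open Classical in
/-- The rule that results from unfolding. -/
noncomputable def unfoldedRule (cl cv : Rule L Q N) (S₁ : List (IdAtom L Q))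
    (K : Multiset (IdAtom L Q)) (E D : Multiset (Builtin L)) : Rule L Q N where
  name := cl.name
  kept := cl.kept
  removed := cl.removed
  guard := cl.guard + D
  body := K + Multiset.ofList S₁ + shiftAtoms (maxId cl.body cl.tokens) cv.body
  builtins := cv.builtins + cl.builtins + E
  tokens :=
    if cv.removed = [] then
      cl.tokens ∪ shiftTokens (maxId cl.body cl.tokens) cv.tokens ∪ {⟨cv.name, S₁.map IdAtom.id⟩}
    else
      clean (K + Multiset.ofList S₁) cl.tokens ∪ shiftTokens (maxId cl.body cl.tokens) cv.tokens

/-- The unfolding of `cl` with the variant `cv` and the substitution `θ`. -/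
structure UnfoldsBy (CT : L.Theory) (cl cv : Rule L Q N) (S₁ S₂ : List (IdAtom L Q))
    (θ : ℕ → L.Term ℕ) (K : Multiset (IdAtom L Q)) (Eθ E D : Multiset (Builtin L)) : Prop where
  fresh : Disjoint cv.vars cl.vars
  body : cl.body = K + Multiset.ofList (S₁ ++ S₂)
  dom : ∀ y, θ y ≠ .var y → y ∈ headVars (cv.kept ++ cv.removed)
  headEq_subst : HeadEq S₁ S₂ (cv.kept.map (UserAtom.subst θ)) (cv.removed.map (UserAtom.subst θ)) Eθ
  entails : Entails CT (cl.builtins + cl.guard) Eθ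
  headEq : HeadEq S₁ S₂ cv.kept cv.removed E
  token : (⟨cv.name, (S₁ ++ S₂).map IdAtom.id⟩ : Token N) ∉ cl.tokens
  residual : D = (residualGuard CT (cl.builtins + cl.guard) θ cv.guard).map (Builtin.subst θ)
  vars_subset : builtinVars D ∩ headVars ((cv.kept ++ cv.removed).map (UserAtom.subst θ)) ⊆
    headVars (cl.kept ++ cl.removed)

variable {CT : L.Theory}

theorem UnfoldsTo.exists_unfoldsBy {cl clv u : Rule L Q N} {S₁ S₂ : List (IdAtom L Q)}
    (h : UnfoldsTo CT cl clv S₁ S₂ u) :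
    ∃ π θ K Eθ E D, UnfoldsBy CT cl (clv.rename π) S₁ S₂ θ K Eθ E D ∧
      u = unfoldedRule cl (clv.rename π) S₁ K E D := by
  obtain ⟨π, cv, θ, K, Eθ, E, D, rfl, h1, h2, h3, -, h5, h6, h7, h8, rfl, h10, -, rfl⟩ := h
  exact ⟨π, θ, K, Eθ, E, _, ⟨h1, h2, h3, h5, h6, h7, h8, rfl, h10⟩, rfl⟩

/-- The conjugate of a substitution by a renaming of the variables. -/
def conjSubst (β : Equiv.Perm ℕ) (θ : ℕ → L.Term ℕ) : ℕ → L.Term ℕ :=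
  fun y => (θ (β.symm y)).subst fun z => .var (β z)

theorem Builtin.rename_conjSubst (β : Equiv.Perm ℕ) (θ : ℕ → L.Term ℕ) (c : Builtin L) :
    (c.subst fun y => .var (β y)).subst (conjSubst β θ) =
      (c.subst θ).subst fun y => .var (β y) := by
  simp [Builtin.subst_subst, Term.subst, conjSubst]

theorem UserAtom.rename_conjSubst (β : Equiv.Perm ℕ) (θ : ℕ → L.Term ℕ) (a : UserAtom L Q) :
    (a.subst fun y => .var (β y)).subst (conjSubst β θ) =
      (a.subst θ).subst fun y => .var (β y) := by
  simp [UserAtom.subst_subst, Term.subst, conjSubst]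

theorem entails_rename_iff (β : Equiv.Perm ℕ) {C D : Multiset (Builtin L)} :
    Entails CT (C.map (Builtin.subst fun y => .var (β y)))
      (D.map (Builtin.subst fun y => .var (β y))) ↔ Entails CT C D := by
  refine ⟨fun h M ν hν => ?_, Entails.rename β⟩
  have := h M (ν ∘ β.symm) (sat_rename.2 (by simpa [Function.comp_assoc] using hν))
  simpa [Function.comp_assoc] using sat_rename.1 this

theorem residualGuard_rename (β : Equiv.Perm ℕ) (A : Multiset (Builtin L)) (θ : ℕ → L.Term ℕ)
    (D : Multiset (Builtin L)) :
    residualGuard CT (A.map (Builtin.subst fun y => .var (β y))) (conjSubst β θ)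
      (D.map (Builtin.subst fun y => .var (β y))) =
      (residualGuard CT A θ D).map (Builtin.subst fun y => .var (β y)) := by
  classical
  rw [residualGuard, residualGuard, Multiset.filter_map]
  congr 1
  refine Multiset.filter_congr fun d _ => not_congr ?_
  rw [Builtin.rename_conjSubst, ← Multiset.map_singleton, entails_rename_iff]

/-- A variant of the unfolded rule is what a derivation fires. This lemma presents it as the
unfolding of variants of the two original rules, which `P` can fire. -/
theorem UnfoldsBy.rename (β : Equiv.Perm ℕ) {cl cv : Rule L Q N} {S₁ S₂ : List (IdAtom L Q)}
    {θ : ℕ → L.Term ℕ} {K : Multiset (IdAtom L Q)} {Eθ E D : Multiset (Builtin L)}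
    (h : UnfoldsBy CT cl cv S₁ S₂ θ K Eθ E D) :
    UnfoldsBy CT (cl.rename β) (cv.rename β) (S₁.map (IdAtom.subst fun y => .var (β y)))
      (S₂.map (IdAtom.subst fun y => .var (β y))) (conjSubst β θ)
      (K.map (IdAtom.subst fun y => .var (β y))) (Eθ.map (Builtin.subst fun y => .var (β y)))
      (E.map (Builtin.subst fun y => .var (β y))) (D.map (Builtin.subst fun y => .var (β y))) where
  fresh := by
    rw [Rule.vars_rename, Rule.vars_rename]
    exact (Set.disjoint_image_iff β.injective).2 h.fresh
  body := by simp [Rule.rename, h.body]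
  dom := by
    intro y hy
    simp only [Rule.rename, ← List.map_append, headVars_rename]
    refine ⟨β.symm y, h.dom _ fun h => hy ?_, by simp⟩
    simp [conjSubst, h, Term.subst]
  headEq_subst := by
    have := h.headEq_subst.subst fun y => .var (β y)
    simpa only [Rule.rename, List.map_map, Function.comp_def, UserAtom.rename_conjSubst] using this
  entails := by
    have := h.entails.rename β
    rwa [Multiset.map_add] at this
  headEq := h.headEq.subst _
  token := by
    have e : (S₁.map (IdAtom.subst fun y => .var (β y)) ++
        S₂.map (IdAtom.subst fun y => .var (β y))).map IdAtom.id = (S₁ ++ S₂).map IdAtom.id := by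
      simp [Function.comp_def, IdAtom.subst]
    rw [e]
    exact h.token
  residual := by
    have := residualGuard_rename (CT := CT) β (cl.builtins + cl.guard) θ cv.guard
    rw [Multiset.map_add] at this
    simp only [Rule.rename, this, h.residual, Multiset.map_map, Function.comp_def,
      Builtin.rename_conjSubst]
  vars_subset := by
    have e : (cv.rename β).kept ++ (cv.rename β).removed =
        (cv.kept ++ cv.removed).map (UserAtom.subst fun y => .var (β y)) := by simp [Rule.rename]
    have e' : (cl.rename β).kept ++ (cl.rename β).removed =
        (cl.kept ++ cl.removed).map (UserAtom.subst fun y => .var (β y)) := by simp [Rule.rename]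
    have e'' : ((cv.kept ++ cv.removed).map (UserAtom.subst fun y => .var (β y))).map
        (UserAtom.subst (conjSubst β θ)) =
        ((cv.kept ++ cv.removed).map (UserAtom.subst θ)).map
          (UserAtom.subst fun y => .var (β y)) := by
      simp only [List.map_map, Function.comp_def, UserAtom.rename_conjSubst]
    rw [e, e', e'', headVars_rename, headVars_rename, builtinVars_rename,
      ← Set.image_inter β.injective]
    exact Set.image_mono h.vars_subset

theorem unfoldedRule_rename (β : Equiv.Perm ℕ) (cl cv : Rule L Q N) (S₁ : List (IdAtom L Q))
    (K : Multiset (IdAtom L Q)) (E D : Multiset (Builtin L)) :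
    (unfoldedRule cl cv S₁ K E D).rename β =
      unfoldedRule (cl.rename β) (cv.rename β) (S₁.map (IdAtom.subst fun y => .var (β y)))
        (K.map (IdAtom.subst fun y => .var (β y))) (E.map (Builtin.subst fun y => .var (β y)))
        (D.map (Builtin.subst fun y => .var (β y))) := by
  have hids : (S₁.map (IdAtom.subst fun y => .var (β y))).map IdAtom.id =
      S₁.map IdAtom.id := by
    simp [Function.comp_def, IdAtom.subst]
  have hcl : ∀ T : Set (Token N), clean (K.map (IdAtom.subst fun y => .var (β y)) +
      Multiset.ofList (S₁.map (IdAtom.subst fun y => .var (β y)))) T =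
      clean (K + Multiset.ofList S₁) T := by
    intro T
    simp only [clean]
    rw [← Multiset.map_coe, ← Multiset.map_add, atomIds_map_subst]
  have hrem : (cv.rename β).removed = [] ↔ cv.removed = [] := by simp [Rule.rename]
  simp only [unfoldedRule, Rule.maxId_rename, hids, hcl, hrem]
  simp [Rule.rename, shiftAtoms_eq, mapIds_map_subst]

variable {cl cv : Rule L Q N} {S₁ S₂ : List (IdAtom L Q)} {θ : ℕ → L.Term ℕ}
  {K : Multiset (IdAtom L Q)} {Eθ E D : Multiset (Builtin L)}

/-- The variables of the deleted `S₂` reappear in the equations `E`, so a variant fresh for the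
unfolded rule is fresh for `cl`. -/
theorem UnfoldsBy.vars_subset_unfoldedRule (h : UnfoldsBy CT cl cv S₁ S₂ θ K Eθ E D) :
    cl.vars ⊆ (unfoldedRule cl cv S₁ K E D).vars := by
  intro y hy
  simp only [Rule.vars, unfoldedRule, h.body, builtinVars_add, atomVars_add, atomVars_coe,
    h.headEq.vars_eq, List.map_append, headVars_append, Set.mem_union] at hy ⊢
  tauto

/-- A variable of the residual guard foreign to `cv` was introduced by `θ` at a head variable, so it
occurs in the instantiated head; the side condition of unfolding then puts it in the head of `cl`.
-/
theorem UnfoldsBy.mem_residual_vars (h : UnfoldsBy CT cl cv S₁ S₂ θ K Eθ E D) {y : ℕ}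
    (hy : y ∈ builtinVars D) : y ∈ headVars (cl.kept ++ cl.removed) ∨ y ∈ cv.vars := by
  classical
  by_cases hyv : y ∈ cv.vars
  · exact Or.inr hyv
  refine Or.inl (h.vars_subset ⟨hy, ?_⟩)
  rw [h.residual, mem_builtinVars_map] at hy
  obtain ⟨z, ⟨d, hd, hz⟩, hyz⟩ := hy
  have hzv : z ∈ cv.vars := by
    refine Or.inl (Or.inl (Or.inr ⟨d, ?_, hz⟩))
    exact Multiset.mem_of_mem_filter hd
  rw [mem_headVars_map]
  refine ⟨z, h.dom z fun h => ?_, hyz⟩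
  rw [h, Term.varFinset, Finset.mem_singleton] at hyz
  exact hyv (hyz ▸ hzv)

theorem UnfoldsBy.unfoldedRule_vars_subset (h : UnfoldsBy CT cl cv S₁ S₂ θ K Eθ E D) :
    (unfoldedRule cl cv S₁ K E D).vars ⊆ cl.vars ∪ cv.vars := by
  intro y hy
  have hD := @UnfoldsBy.mem_residual_vars _ _ _ _ _ _ _ _ _ _ _ _ _ h y
  simp only [Rule.vars, unfoldedRule, h.body, builtinVars_add, atomVars_add, atomVars_coe,
    h.headEq.vars_eq, List.map_append, headVars_append, shiftAtoms_eq, atomVars_mapIds,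
    Set.mem_union] at hD hy ⊢
  tauto

variable {M : Type (max u v)} [L.Structure M]

theorem valSubst_eq_of_dom (hdom : ∀ y, θ y ≠ .var y → y ∈ headVars (cv.kept ++ cv.removed))
    {ν : ℕ → M} {y : ℕ} (hy : y ∉ headVars (cv.kept ++ cv.removed)) : valSubst θ ν y = ν y := by
  have : θ y = .var y := by
    by_contra h
    exact hy (hdom y h)
  simp [valSubst, this]

end Unfolding

/-! ### Meaning of the residual guard -/

section UnfoldingSemantics

variable {L : FirstOrder.Language.{u, v}} {Q : ℕ → Type w} {N : Type x} {CT : L.Theory}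
  {cl cv : Rule L Q N} {S₁ S₂ : List (IdAtom L Q)} {θ : ℕ → L.Term ℕ}
  {K : Multiset (IdAtom L Q)} {Eθ E D : Multiset (Builtin L)}
  {M : Theory.ModelType.{u, v, max u v} CT} {ν : ℕ → M}

/-- The conjuncts deleted from the guard are exactly those implied by `A`, so under `A` nothing is
lost. -/
theorem sat_residualGuard {A D' : Multiset (Builtin L)} (hA : Sat ν A) :
    Sat ν ((residualGuard CT A θ D').map (Builtin.subst θ)) ↔ Sat (valSubst θ ν) D' := by
  classical
  rw [sat_map_subst]
  constructor
  · intro h d hd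
    by_cases he : Entails CT A {d.subst θ}
    · exact Builtin.realize_subst.1 (sat_singleton.1 (he M ν hA))
    · exact h d (Multiset.mem_filter.2 ⟨hd, he⟩)
  · exact fun h d hd => h d (Multiset.mem_of_mem_filter hd)

theorem UnfoldsBy.val_eq (h : UnfoldsBy CT cl cv S₁ S₂ θ K Eθ E D)
    (hA : Sat ν (cl.builtins + cl.guard)) :
    ((S₁ ++ S₂).map IdAtom.chr).map (UserAtom.val ν) =
      (cv.kept ++ cv.removed).map (UserAtom.val (valSubst θ ν)) := by
  have := (h.headEq_subst.sat_iff ν).1 (h.entails M ν hA)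
  rwa [← List.map_append, heads_val_subst] at this

/-- The head and its instance by `θ` both take the values of `S₁`, `S₂`, so by injectivity `θ` does
not change the value of any head variable; elsewhere `θ` is the identity. -/
theorem UnfoldsBy.valSubst_eq (hM : InjectiveFunctions L M)
    (h : UnfoldsBy CT cl cv S₁ S₂ θ K Eθ E D)
    (hA : Sat ν (cl.builtins + cl.guard)) (hE : Sat ν E) : valSubst θ ν = ν := by
  funext y
  by_cases hy : y ∈ headVars (cv.kept ++ cv.removed)
  · refine hM.eq_of_heads_val_eq ?_ y hy
    rw [← h.val_eq hA, (h.headEq.sat_iff ν).1 hE]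
  · exact valSubst_eq_of_dom h.dom hy

theorem UnfoldsBy.sat_residual (hM : InjectiveFunctions L M)
    (h : UnfoldsBy CT cl cv S₁ S₂ θ K Eθ E D)
    (hA : Sat ν (cl.builtins + cl.guard)) (hE : Sat ν E) : Sat ν D ↔ Sat ν cv.guard := by
  rw [h.residual, sat_residualGuard hA, h.valSubst_eq hM hA hE]

end UnfoldingSemantics

/-! ### Identifiers and tokens of the unfolded rule -/

section UnfoldingIds

variable {L : FirstOrder.Language.{u, v}} {Q : ℕ → Type w} {N : Type x} {CT : L.Theory}
  {cl cv : Rule L Q N} {S₁ S₂ : List (IdAtom L Q)} {θ : ℕ → L.Term ℕ}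
  {K : Multiset (IdAtom L Q)} {Eθ E D : Multiset (Builtin L)}

theorem shiftAtoms_add (n : ℕ) (A B : Multiset (IdAtom L Q)) :
    shiftAtoms n (A + B) = shiftAtoms n A + shiftAtoms n B :=
  mapIds_add _ _ _

theorem shiftAtoms_shiftAtoms (n m : ℕ) (A : Multiset (IdAtom L Q)) :
    shiftAtoms n (shiftAtoms m A) = shiftAtoms (n + m) A := by
  simp only [shiftAtoms_eq, mapIds_mapIds, Function.comp_def, add_assoc]

theorem shiftTokens_union (n : ℕ) (T T' : Set (Token N)) :
    shiftTokens n (T ∪ T') = shiftTokens n T ∪ shiftTokens n T' :=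
  Set.image_union _ _ _

theorem shiftTokens_shiftTokens (n m : ℕ) (T : Set (Token N)) :
    shiftTokens n (shiftTokens m T) = shiftTokens (n + m) T := by
  simp only [shiftTokens, Set.image_image, List.map_map, Function.comp_def, add_assoc]

theorem HeadEq.right_nil_iff {H₁ H₂ : List (IdAtom L Q)} {h₁ h₂ : List (UserAtom L Q)}
    {E : Multiset (Builtin L)} (h : HeadEq H₁ H₂ h₁ h₂ E) : H₂ = [] ↔ h₂ = [] := by
  obtain ⟨E₁, E₂, -, h, -⟩ := h
  have := h.length_eq
  rw [List.length_map] at this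
  rw [← List.length_eq_zero_iff, ← List.length_eq_zero_iff, this]

theorem HeadEq.ne_nil {H₁ H₂ : List (IdAtom L Q)} {h₁ h₂ : List (UserAtom L Q)}
    {E : Multiset (Builtin L)} (h : HeadEq H₁ H₂ h₁ h₂ E) (hne : h₁ ++ h₂ ≠ []) :
    H₁ ++ H₂ ≠ [] := by
  obtain ⟨E₁, E₂, h₁, h₂, -⟩ := h
  have e₁ := h₁.length_eq
  have e₂ := h₂.length_eq
  rw [List.length_map] at e₁ e₂
  rw [← List.length_pos_iff] at hne ⊢
  rw [List.length_append] at hne ⊢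
  omega

theorem UnfoldsBy.atomIds_body (h : UnfoldsBy CT cl cv S₁ S₂ θ K Eθ E D) :
    atomIds cl.body = atomIds (K + Multiset.ofList S₁) ∪ atomIds (Multiset.ofList S₂) := by
  rw [h.body, ← Multiset.coe_add, ← add_assoc, atomIds_add]

theorem UnfoldsBy.localIds (h : UnfoldsBy CT cl cv S₁ S₂ θ K Eθ E D) (hcl : cl.LocalIds)
    (hcv : cv.LocalIds) : (unfoldedRule cl cv S₁ K E D).LocalIds := by
  have hb := h.atomIds_body
  constructor
  · intro i hi
    simp only [unfoldedRule] at hi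
    rw [atomIds_add, atomIds_shiftAtoms] at hi
    rcases hi with hi | ⟨j, hj, rfl⟩
    · exact hcl.1 i (hb ▸ Or.inl hi)
    · have := hcv.1 j hj; simp only; omega
  · rintro i ⟨t, ht, hi⟩
    have hcvt : t ∈ shiftTokens (maxId cl.body cl.tokens) cv.tokens →
        i ∈ atomIds (unfoldedRule cl cv S₁ K E D).body := by
      intro ht
      obtain ⟨j, hj, -, -, rfl⟩ := hcv.of_mem_shiftTokens ht hi
      simp only [unfoldedRule]
      rw [atomIds_add, atomIds_shiftAtoms]
      exact Or.inr ⟨j, hj, rfl⟩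
    have hS : i ∈ atomIds (K + Multiset.ofList S₁) →
        i ∈ atomIds (unfoldedRule cl cv S₁ K E D).body := by
      intro hi
      simp only [unfoldedRule]
      rw [atomIds_add]
      exact Or.inl hi
    simp only [unfoldedRule] at ht
    split_ifs at ht with hr
    · rcases ht with (ht | ht) | rfl
      · have := hcl.2 ⟨t, ht, hi⟩
        rw [hb, h.headEq.right_nil_iff.2 hr] at this
        exact this.elim hS (by simp [atomIds])
      · exact hcvt ht
      · refine hS ?_
        rw [atomIds_add, atomIds_coe]
        exact Or.inr hi
    · rcases ht with ht | ht
      · exact hS (ht.2 i hi)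
      · exact hcvt ht

/-- Only an inequality, as the greatest identifier of `cl` may have belonged to `S₂`. Simulation
therefore compares counters through a bound and not by equality. -/
theorem UnfoldsBy.maxId_le (h : UnfoldsBy CT cl cv S₁ S₂ θ K Eθ E D) (hcl : cl.LocalIds)
    (hcv : cv.LocalIds) :
    maxId (unfoldedRule cl cv S₁ K E D).body (unfoldedRule cl cv S₁ K E D).tokens ≤
      maxId cl.body cl.tokens + maxId cv.body cv.tokens := by
  have hsub := (h.localIds hcl hcv).2
  refine csSup_le' fun i hi => ?_
  have hi : i ∈ atomIds (unfoldedRule cl cv S₁ K E D).body := hi.elim id fun h => hsub h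
  simp only [unfoldedRule] at hi
  rw [atomIds_add, atomIds_shiftAtoms] at hi
  rcases hi with hi | ⟨j, hj, rfl⟩
  · have := hcl.le_maxId (i := i) (h.atomIds_body ▸ Or.inl hi)
    omega
  · have := hcv.le_maxId hj
    simp only
    omega

/-- The live tokens after firing the unfolded rule are those after firing the two original rules. -/
theorem UnfoldsBy.mem_tokens_iff (h : UnfoldsBy CT cl cv S₁ S₂ θ K Eθ E D) (hcl : cl.LocalIds)
    (hcv : cv.LocalIds) (hnd : (cl.body.map IdAtom.id).Nodup) {G : Multiset (IdAtom L Q)} {n : ℕ}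
    (hG : ∀ i ∈ atomIds G, i ≤ n) (t : Token N)
    (ht : ∀ i ∈ t.ids, i ∈ atomIds (shiftAtoms n (unfoldedRule cl cv S₁ K E D).body + G)) :
    t ∈ shiftTokens n (unfoldedRule cl cv S₁ K E D).tokens ↔
      t ∈ shiftTokens n cl.tokens ∨
        t = ⟨cv.name, ((S₁ ++ S₂).map IdAtom.id).map (n + ·)⟩ ∨
        t ∈ shiftTokens (n + maxId cl.body cl.tokens) cv.tokens := by
  by_cases hr : cv.removed = []
  · have hS : S₂ = [] := h.headEq.right_nil_iff.2 hr
    simp only [unfoldedRule, if_pos hr, shiftTokens_union, shiftTokens_shiftTokens, Set.mem_union,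
      hS, List.append_nil]
    have : t ∈ shiftTokens n {(⟨cv.name, S₁.map IdAtom.id⟩ : Token N)} ↔
        t = ⟨cv.name, (S₁.map IdAtom.id).map (n + ·)⟩ := by
      simp only [shiftTokens, Set.image_singleton, Set.mem_singleton_iff]
    rw [this]
    tauto
  -- Identifiers of a live token that come from `cl` survive in `K`, `S₁`: those of `cv` are shifted
  -- past the greatest one of `cl`, and those of `G` are at most `n`.
  · have hlive : ∀ i ∈ atomIds cl.body, n + i ∈ t.ids → i ∈ atomIds (K + Multiset.ofList S₁) := by
      intro i hi hit
      have h1 := hcl.1 i hi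
      have h2 := hcl.le_maxId hi
      have := ht _ hit
      simp only [unfoldedRule] at this
      rw [atomIds_add, atomIds_shiftAtoms, atomIds_add, atomIds_shiftAtoms] at this
      rcases this with ⟨j, hj | ⟨k, hk, rfl⟩, hji⟩ | this
      · have : j = i := by simp only at hji; omega
        exact this ▸ hj
      · have := hcv.1 k hk
        simp only at hji
        omega
      · have := hG _ this
        omega
    simp only [unfoldedRule, if_neg hr, shiftTokens_union, shiftTokens_shiftTokens, Set.mem_union]
    have e₁ : t ∈ shiftTokens n (clean (K + Multiset.ofList S₁) cl.tokens) ↔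
        t ∈ shiftTokens n cl.tokens := by
      constructor
      · rintro ⟨s, hs, rfl⟩
        exact ⟨s, hs.1, rfl⟩
      · rintro ⟨s, hs, rfl⟩
        exact ⟨s, ⟨hs, fun i hi => hlive i (hcl.2 ⟨s, hs, hi⟩) (List.mem_map_of_mem hi)⟩, rfl⟩
    -- With a non-empty removed part the token of `cv` mentions an element of `S₂`; were it live,
    -- that identifier would occur twice in the body of `cl`.
    have e₂ : t ≠ ⟨cv.name, ((S₁ ++ S₂).map IdAtom.id).map (n + ·)⟩ := by
      rintro rfl
      have hne : S₂ ≠ [] := fun h' => hr (h.headEq.right_nil_iff.1 h')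
      obtain ⟨s, hs⟩ := List.exists_mem_of_ne_nil _ hne
      have hsid : s.id ∈ atomIds (Multiset.ofList S₂) := ⟨s, hs, rfl⟩
      have hs1 := hlive s.id (h.atomIds_body ▸ Or.inr hsid) (by
        simp only [List.map_append, List.mem_append]
        exact Or.inr (List.mem_map_of_mem (List.mem_map_of_mem hs)))
      obtain ⟨a, ha, hai⟩ := hs1
      rw [h.body, ← Multiset.coe_add, ← add_assoc, Multiset.map_add, Multiset.nodup_add] at hnd
      exact Multiset.disjoint_left.1 hnd.2.2 (Multiset.mem_map_of_mem _ ha)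
        (hai ▸ Multiset.mem_map_of_mem _ hs)
    rw [e₁]
    tauto

end UnfoldingIds

/-! ### One unfolded firing as two original firings -/

section UnfoldingStep

variable {L : FirstOrder.Language.{u, v}} {Q : ℕ → Type w} {N : Type x} {CT : L.Theory}
  {cl cv : Rule L Q N} {S₁ S₂ : List (IdAtom L Q)} {θ : ℕ → L.Term ℕ}
  {K : Multiset (IdAtom L Q)} {Eθ E D : Multiset (Builtin L)}
  {H₁ H₂ : List (IdAtom L Q)} {G : Multiset (IdAtom L Q)} {B C F : Multiset (Builtin L)}
  {T : Set (Token N)} {n : ℕ}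

/-- The guard of `cl` is part of the unfolded guard. The witness for the latter is cut down to the
variables of `cl`; the other variables of `F` belong to the fresh-separated constraints `H₁`, `H₂`,
where it did not move. -/
theorem UnfoldsBy.fires_left (h : UnfoldsBy CT cl cv S₁ S₂ θ K Eθ E D)
    (hf : (unfoldedRule cl cv S₁ K E D).Fires CT H₁ H₂ G B C F T n) :
    cl.Fires CT H₁ H₂ G B C F T n := by
  have hsub := h.vars_subset_unfoldedRule
  refine ⟨hf.sat, hf.fresh.mono_left hsub, hf.headEq, ?_, hf.token⟩
  classical
  intro M ν hν
  obtain ⟨μ, hμ, hsat⟩ := hf.guard M ν hν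
  refine ⟨fun y => if y ∈ cl.vars then μ y else ν y, fun y hy => if_neg hy, ?_⟩
  have hsat' : Sat μ (F + cl.guard) :=
    sat_mono (add_le_add le_rfl (Multiset.le_add_right _ _)) hsat
  refine (sat_congr fun y hy => ?_).1 hsat'
  by_cases hyc : y ∈ cl.vars
  · rw [if_pos hyc]
  · rw [if_neg hyc]
    refine hμ y fun hyu => ?_
    have hyF : y ∈ headVars ((H₁ ++ H₂).map IdAtom.chr) := by
      rw [builtinVars_add, hf.headEq.vars_eq] at hy
      simp only [Rule.vars, Set.mem_union] at hyc
      rcases hy with (hy | hy) | hy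
      · exact hy
      · exact absurd hy (by simp only [unfoldedRule]; tauto)
      · tauto
    refine Set.disjoint_left.1 hf.fresh hyu (Or.inl (Or.inl ?_))
    rw [atomVars_add, atomVars_coe]
    exact Or.inl hyF

/-- The sequence of identified constraints whose identifiers are increased by `n`. -/
def shiftList (n : ℕ) (S : List (IdAtom L Q)) : List (IdAtom L Q) := S.map fun a => ⟨a.chr, n + a.id⟩

theorem coe_shiftList (n : ℕ) (S : List (IdAtom L Q)) :
    Multiset.ofList (shiftList n S) = shiftAtoms n (Multiset.ofList S) :=
  (mapIds_coe _ _).symm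

theorem UnfoldsBy.source_atoms_eq (h : UnfoldsBy CT cl cv S₁ S₂ θ K Eθ E D) :
    Multiset.ofList (shiftList n S₁ ++ shiftList n S₂) +
      (shiftAtoms n K + Multiset.ofList H₁ + G) = (cl.result H₁ H₂ G B C F T n).atoms := by
  rw [Rule.result, h.body, ← Multiset.coe_add, ← Multiset.coe_add, shiftAtoms_add, shiftAtoms_add,
    coe_shiftList, coe_shiftList]
  ac_rfl

theorem Rule.result_total_eq (r : Rule L Q N) :
    B + (r.builtins + (F + r.guard + C)) = (r.result H₁ H₂ G B C F T n).total := by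
  simp only [Rule.result, Conf.total]
  ac_rfl

theorem UnfoldsBy.source_vars_eq (h : UnfoldsBy CT cl cv S₁ S₂ θ K Eθ E D) :
    Conf.vars (N := N) ⟨Multiset.ofList (shiftList n S₁ ++ shiftList n S₂) +
      (shiftAtoms n K + Multiset.ofList H₁ + G), B, cl.builtins + (F + cl.guard + C),
      (cl.result H₁ H₂ G B C F T n).tokens, (cl.result H₁ H₂ G B C F T n).counter⟩ =
      (cl.result H₁ H₂ G B C F T n).vars := by
  rw [Conf.vars_eq, Conf.vars_eq, h.source_atoms_eq (H₂ := H₂) (B := B) (C := C) (F := F) (T := T),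
    ← cl.result_total_eq, Conf.total]

/-- The residual guard was checked when the unfolded rule fired, and the rest of the guard of `cv`
follows from the constraints that `cl` has put into the store. -/
theorem UnfoldsBy.fires_right (hCT : ClarkEquality CT) (h : UnfoldsBy CT cl cv S₁ S₂ θ K Eθ E D)
    (hne : cv.kept ++ cv.removed ≠ []) (hcl : cl.LocalIds)
    (hf : (unfoldedRule cl cv S₁ K E D).Fires CT H₁ H₂ G B C F T n)
    (hH : ∀ i ∈ (H₁ ++ H₂).map IdAtom.id, i ≤ n) (hT : ∀ i ∈ tokenIds T, i ≤ n)
    (hfresh : Disjoint cv.vars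
      (Conf.vars (N := N) ⟨Multiset.ofList (H₁ ++ H₂) + G, B, C, T, n⟩))
    (hsat : ¬ Unsat CT (cl.builtins + (F + cl.guard + C))) :
    cv.Fires CT (shiftList n S₁) (shiftList n S₂) (shiftAtoms n K + Multiset.ofList H₁ + G) B
      (cl.builtins + (F + cl.guard + C)) E (cl.result H₁ H₂ G B C F T n).tokens
      (cl.result H₁ H₂ G B C F T n).counter := by
  have hclf := h.fires_left hf
  have hSbody : ∀ s ∈ S₁ ++ S₂, s ∈ cl.body := by
    intro s hs
    rw [h.body, Multiset.mem_add]
    exact Or.inr hs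
  refine ⟨hsat, ?_, h.headEq.mapIds _, ?_, ?_⟩
  · have hv := Rule.vars_result (G := G) (B := B) (C := C) (T := T) (n := n) hclf.headEq
    rw [h.source_vars_eq, hv, Set.disjoint_union_right]
    exact ⟨hfresh, h.fresh⟩
  · classical
    intro M ν hν
    have hM := hCT.injectiveFunctions M
    simp only [sat_add] at hν
    obtain ⟨hνb, ⟨hνF, hνg⟩, hνC⟩ := hν
    obtain ⟨μ, hμ, hsatμ⟩ := hf.guard M ν hνC
    simp only [unfoldedRule, sat_add] at hsatμ
    obtain ⟨hμF, -, hμD⟩ := hsatμ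
    -- Both valuations match the head of `cl` with the same constraints `H₁`, `H₂`, whose values
    -- coincide by freshness; injectivity transfers this to the head variables.
    have hagree : ∀ y ∈ headVars (cl.kept ++ cl.removed), ν y = μ y := by
      refine hM.eq_of_heads_val_eq ?_
      rw [← (hclf.headEq.sat_iff ν).1 hνF, ← (hclf.headEq.sat_iff μ).1 hμF]
      refine heads_val_congr fun y hy => (hμ y fun hyu => ?_).symm
      refine Set.disjoint_left.1 hf.fresh hyu (Or.inl (Or.inl ?_))
      rw [atomVars_add, atomVars_coe]
      exact Or.inl hy
    -- Take `μ` for the variables of `cv` and `ν` elsewhere. Then `cl` keeps its current values, and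
    -- the residual guard holds, as its variables outside `cv` lie in the head of `cl`, where the
    -- two agree.
    set κ : ℕ → M := fun y => if y ∈ cv.vars then μ y else ν y with hκ
    have hκcl : ∀ y ∈ cl.vars, κ y = ν y := fun y hy =>
      if_neg fun hyv => Set.disjoint_left.1 h.fresh hyv hy
    have hκA : Sat κ (cl.builtins + cl.guard) := by
      refine (sat_congr fun y hy => ?_).2 (sat_add.2 ⟨hνb, hνg⟩)
      refine hκcl y ?_
      rw [builtinVars_add] at hy
      simp only [Rule.vars, Set.mem_union] at hy ⊢
      tauto
    have hκD : Sat κ D := by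
      refine (sat_congr fun y hy => ?_).2 hμD
      by_cases hyv : y ∈ cv.vars
      · exact if_pos hyv
      · have hyh := (h.mem_residual_vars hy).resolve_right hyv
        rw [← hagree y hyh]
        exact if_neg hyv
    have hhead : headVars (cv.kept ++ cv.removed) ⊆ cv.vars :=
      fun y hy => Or.inl (Or.inl (Or.inl hy))
    -- Evaluating `θ` under `κ` solves both parts: the head takes the values of `S₁`, `S₂` by the
    -- entailed matching, and the whole guard follows from its residual part.
    refine ⟨valSubst θ κ, fun y hy => ?_, sat_add.2 ⟨?_, ?_⟩⟩
    · rw [valSubst_eq_of_dom h.dom fun hyh => hy (hhead hyh)]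
      exact if_neg hy
    · rw [h.headEq.sat_iff, ← h.val_eq hκA]
      refine heads_val_congr fun y hy => valSubst_eq_of_dom h.dom fun hyh => ?_
      refine Set.disjoint_left.1 h.fresh (hhead hyh) (Or.inl (Or.inr ?_))
      rw [h.body, atomVars_add, atomVars_coe]
      exact Or.inr hy
    · rw [← sat_residualGuard hκA, ← h.residual]
      exact hκD
  · have hids : (shiftList n S₁ ++ shiftList n S₂).map IdAtom.id =
        ((S₁ ++ S₂).map IdAtom.id).map (n + ·) := by
      simp [shiftList, Function.comp_def]
    rw [hids]
    obtain ⟨s, hs⟩ := List.exists_mem_of_ne_nil _ (h.headEq.ne_nil hne)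
    have hmem : n + s.id ∈ ((S₁ ++ S₂).map IdAtom.id).map (n + ·) :=
      List.mem_map_of_mem (List.mem_map_of_mem hs)
    have hpos : 1 ≤ s.id := hcl.1 _ ⟨s, hSbody s hs, rfl⟩
    -- The token is new: its identifiers exceed `n`, which rules out old tokens and the token of
    -- `cl`, and the unfolding condition excludes the local tokens of `cl`.
    rintro ((ht | ht) | ⟨t, ht, hte⟩)
    · have := hT _ ⟨_, ht, hmem⟩
      omega
    · rw [Set.mem_singleton_iff, Token.mk.injEq] at ht
      rw [ht.2] at hmem
      have := hH _ hmem
      omega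
    · refine h.token ?_
      obtain ⟨nm, is⟩ := t
      rw [Token.mk.injEq] at hte
      have : is = (S₁ ++ S₂).map IdAtom.id :=
        List.map_injective_iff.2 (add_right_injective n) hte.2
      rw [← this, ← hte.1]
      exact ht

/-- Firing the two original rules simulates firing the unfolded rule. -/
theorem UnfoldsBy.simulates (hCT : ClarkEquality CT) (h : UnfoldsBy CT cl cv S₁ S₂ θ K Eθ E D)
    (hcl : cl.LocalIds) (hcv : cv.LocalIds) (hnd : (cl.body.map IdAtom.id).Nodup)
    (hf : (unfoldedRule cl cv S₁ K E D).Fires CT H₁ H₂ G B C F T n)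
    (hH : ∀ i ∈ atomIds (Multiset.ofList (H₁ ++ H₂) + G), i ≤ n) (hT : ∀ i ∈ tokenIds T, i ≤ n) :
    Simulates CT
      (cv.result (shiftList n S₁) (shiftList n S₂) (shiftAtoms n K + Multiset.ofList H₁ + G) B
        (cl.builtins + (F + cl.guard + C)) E (cl.result H₁ H₂ G B C F T n).tokens
        (cl.result H₁ H₂ G B C F T n).counter)
      ((unfoldedRule cl cv S₁ K E D).result H₁ H₂ G B C F T n) := by
  have hHids : ∀ i ∈ (H₁ ++ H₂).map IdAtom.id, i ≤ n := by
    intro i hi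
    refine hH i ?_
    rw [atomIds_add, atomIds_coe]
    exact Or.inl hi
  have hu := h.localIds hcl hcv
  have hids : (shiftList n S₁ ++ shiftList n S₂).map IdAtom.id =
      ((S₁ ++ S₂).map IdAtom.id).map (n + ·) := by
    simp [shiftList, Function.comp_def]
  have hvu := Rule.vars_result (G := G) (B := B) (C := C) (T := T) (n := n) hf.headEq
  have hvl := Rule.vars_result (G := G) (B := B) (C := C) (T := T) (n := n) (h.fires_left hf).headEq
  have hS : HeadEq (shiftList n S₁) (shiftList n S₂) cv.kept cv.removed E := h.headEq.mapIds _
  have hvr := Rule.vars_result (G := shiftAtoms n K + Multiset.ofList H₁ + G) (B := B)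
    (C := cl.builtins + (F + cl.guard + C)) (T := (cl.result H₁ H₂ G B C F T n).tokens)
    (n := (cl.result H₁ H₂ G B C F T n).counter) hS
  rw [h.source_vars_eq, hvl] at hvr
  -- The shift used by unfolding equals the increase of the counter caused by `cl`, so the
  -- identifiers coincide literally; only the counters may differ.
  refine ⟨⟨id, strictMono_id, fun i hi => ?_, ?_, ?_⟩, hu.atom_le_result hH,
    hu.token_le_result hT hHids, ?_, ?_, ?_⟩
  · have := h.maxId_le hcl hcv
    simp only [Rule.result, id] at hi ⊢
    omega
  · rw [mapIds_id]
    simp only [Rule.result, unfoldedRule, shiftAtoms_add, shiftAtoms_shiftAtoms]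
    rw [coe_shiftList]
    ac_rfl
  · intro t ht
    have hHG : ∀ i ∈ atomIds (Multiset.ofList H₁ + G), i ≤ n := by
      intro i hi
      refine hH i ?_
      simp only [atomIds_add, atomIds_coe, List.map_append] at hi ⊢
      exact hi.imp (List.mem_append_left _) id
    have key := h.mem_tokens_iff hcl hcv hnd hHG t (by
      simpa only [Rule.result, add_assoc] using ht)
    rw [List.map_id]
    simp only [Rule.result, Set.mem_union, hids, Set.mem_singleton_iff, key]
    simp only [unfoldedRule]
    tauto
  · refine hcv.token_le_result (hcl.token_le_result hT hHids) ?_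
    intro i hi
    rw [hids] at hi
    obtain ⟨j, hj, rfl⟩ := List.mem_map.1 hi
    have := hcl.le_maxId (i := j) (by
      rw [h.body, atomIds_add, atomIds_coe]
      exact Or.inr hj)
    simp only [Rule.result]
    omega
  · rw [hvu, hvr, Set.union_assoc]
    exact Set.union_subset_union_right _ h.unfoldedRule_vars_subset
  · intro M ν
    -- The totals differ just in the residual guard against the full guard of `cv`, which are
    -- equivalent under the remaining constraints. No projection is needed here.
    have key : ∀ μ : ℕ → M,
        Sat μ ((unfoldedRule cl cv S₁ K E D).result H₁ H₂ G B C F T n).total ↔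
        Sat μ (cv.result (shiftList n S₁) (shiftList n S₂)
          (shiftAtoms n K + Multiset.ofList H₁ + G) B
          (cl.builtins + (F + cl.guard + C)) E (cl.result H₁ H₂ G B C F T n).tokens
          (cl.result H₁ H₂ G B C F T n).counter).total := by
      intro μ
      have := h.sat_residual (hCT.injectiveFunctions M) (ν := μ)
      simp only [Rule.result, unfoldedRule, Conf.total, sat_add] at this ⊢
      tauto
    constructor
    · exact fun hν => ⟨ν, fun _ _ => rfl, (key ν).1 hν⟩
    · rintro ⟨μ, hμ, hsat⟩
      refine (sat_congr fun y hy => hμ y (not_not.2 ?_)).1 ((key μ).2 hsat)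
      rw [Conf.vars_eq]
      exact Or.inr hy

end UnfoldingStep

/-! ### Simulation of derivations and normal termination -/

section Termination

variable {L : FirstOrder.Language.{u, v}} {Q : ℕ → Type w} {N : Type x} {CT : L.Theory}
  {P U : Set (Rule L Q N)} {cl : Rule L Q N}

theorem Rule.LocalIds.rename {r : Rule L Q N} (h : r.LocalIds) (π : Equiv.Perm ℕ) :
    (r.rename π).LocalIds := by
  simpa only [Rule.LocalIds, Rule.rename, atomIds_map_subst] using h

theorem Simulates.exists_unfolded_apply (hCT : ClarkEquality CT) {cv : Rule L Q N}
    {S₁ S₂ : List (IdAtom L Q)} {θ : ℕ → L.Term ℕ} {K : Multiset (IdAtom L Q)}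
    {Eθ E D : Multiset (Builtin L)} (hu : UnfoldsBy CT cl cv S₁ S₂ θ K Eθ E D)
    (hclP : cl ∈ variants P) (hcvP : cv ∈ variants P) (hcl : cl.LocalIds) (hcv : cv.LocalIds)
    (hnd : (cl.body.map IdAtom.id).Nodup) (hne : cv.kept ++ cv.removed ≠ []) {a : Conf L Q N}
    {H₁ H₂ : List (IdAtom L Q)} {G : Multiset (IdAtom L Q)} {B C F : Multiset (Builtin L)}
    {T : Set (Token N)} {n : ℕ}
    (h : Simulates CT a ⟨Multiset.ofList (H₁ ++ H₂) + G, B, C, T, n⟩) (ha : a.pending = 0)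
    (hsat : ¬ Unsat CT (B + C)) (hf : (unfoldedRule cl cv S₁ K E D).Fires CT H₁ H₂ G B C F T n)
    (hfresh : Disjoint (unfoldedRule cl cv S₁ K E D).vars a.vars) (hfresh' : Disjoint cv.vars a.vars) :
    ∃ a₁, Relation.TransGen (NormalStep CT P) a a₁ ∧
      ((Unsat CT a₁.store ∧
          Unsat CT ((unfoldedRule cl cv S₁ K E D).result H₁ H₂ G B C F T n).total) ∨
        (Simulates CT a₁ ((unfoldedRule cl cv S₁ K E D).result H₁ H₂ G B C F T n) ∧
          a₁.pending = 0 ∧ a₁.vars = a.vars ∪ cl.vars ∪ cv.vars)) := by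
  have hclf := hu.fires_left hf
  obtain ⟨a₂, hsteps, h₂⟩ := h.exists_apply hclP hcl ha hsat hclf
    (hfresh.mono_left hu.vars_subset_unfoldedRule)
  have hmono : Unsat CT (cl.result H₁ H₂ G B C F T n).total →
      Unsat CT ((unfoldedRule cl cv S₁ K E D).result H₁ H₂ G B C F T n).total := by
    intro h M ν hν
    refine h M ν ?_
    simp only [Rule.result, unfoldedRule, Conf.total, sat_add] at hν ⊢
    tauto
  rcases h₂ with ⟨h₂, h₂'⟩ | ⟨h₂, ha₂, hv₂⟩
  · exact ⟨a₂, hsteps, Or.inl ⟨h₂, hmono h₂'⟩⟩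
  -- If the effect of `cl` is already inconsistent, `P` stops in a failed configuration, and the
  -- unfolded result is inconsistent as well.
  by_cases hs : Unsat CT (cl.result H₁ H₂ G B C F T n).total
  · refine ⟨a₂, hsteps, Or.inl ⟨?_, hmono hs⟩⟩
    have := h₂.unsat_iff.2 hs
    rwa [Conf.total, ha₂, zero_add] at this
  have hHG : ∀ i ∈ atomIds (Multiset.ofList (H₁ ++ H₂) + G), i ≤ n := h.atom_le
  have hT : ∀ i ∈ tokenIds T, i ≤ n := h.token_le
  have hHids : ∀ i ∈ (H₁ ++ H₂).map IdAtom.id, i ≤ n := by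
    intro i hi
    refine hHG i ?_
    rw [atomIds_add, atomIds_coe]
    exact Or.inl hi
  rw [← cl.result_total_eq] at hs
  have hcvf := hu.fires_right hCT hne hcl hf hHids hT
    (hfresh'.mono_right h.vars_subset) fun h => hs (h.mono (Multiset.le_add_left _ _))
  -- The built-ins of `cl` are placed in the store, as the guard of `cv` is to be entailed by the
  -- store; `B` stays pending. This intermediate configuration need not be reachable in `P'`.
  have hsrc := h₂.congr_right (b' := ⟨Multiset.ofList (shiftList n S₁ ++ shiftList n S₂) +
      (shiftAtoms n K + Multiset.ofList H₁ + G), B, cl.builtins + (F + cl.guard + C),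
      (cl.result H₁ H₂ G B C F T n).tokens, (cl.result H₁ H₂ G B C F T n).counter⟩)
    hu.source_atoms_eq rfl rfl cl.result_total_eq
  obtain ⟨a₄, hsteps', h₄⟩ := hsrc.exists_apply hcvP hcv ha₂ hs hcvf (by
    rw [hv₂, Set.disjoint_union_right]
    exact ⟨hfresh', hu.fresh⟩)
  have hsim := hu.simulates hCT hcl hcv hnd hf hHG hT
  refine ⟨a₄, hsteps.trans hsteps', ?_⟩
  rcases h₄ with ⟨h₄, h₄'⟩ | ⟨h₄, ha₄, hv₄⟩
  · exact Or.inl ⟨h₄, hsim.unsat_iff.1 h₄'⟩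
  · exact Or.inr ⟨h₄.trans hsim, ha₄, by rw [hv₄, hv₂]⟩

/-- A transition of the transformed program is simulated by the original program. -/
theorem Simulates.exists_transition (hCT : ClarkEquality CT) (hP : IsProgram P) (hcl : cl ∈ P)
    (hU : U ⊆ Unf CT P cl) {a b b₁ : Conf L Q N} (h : Simulates CT a b) (ha : a.pending = 0)
    (hsat : ¬ Unsat CT b.total) (hstep : ApplyStep CT ((P \ {cl}) ∪ U) b b₁)
    (hfresh : b₁.vars ∩ a.vars ⊆ b.vars) {S : Set ℕ} (hS : S.Finite) :
    ∃ a₁, Relation.TransGen (NormalStep CT P) a a₁ ∧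
      ((Unsat CT a₁.store ∧ Unsat CT b₁.total) ∨
        (Simulates CT a₁ b₁ ∧ a₁.pending = 0 ∧ a₁.vars ∩ S ⊆ a.vars ∪ b₁.vars)) := by
  obtain ⟨r, ⟨r₀, hr₀, π, rfl⟩, H₁, H₂, G, B, C, E, T, n, hf, rfl, rfl⟩ := hstep.exists_fires
  have hv := Rule.vars_result (G := G) (B := B) (C := C) (T := T) (n := n) hf.headEq
  have hdisj : Disjoint (r₀.rename π).vars a.vars := by
    rw [Set.disjoint_left]
    intro y hy hya
    exact Set.disjoint_left.1 hf.fresh hy (hfresh ⟨hv ▸ Or.inr hy, hya⟩)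
  rcases hr₀ with hr₀ | hr₀
  · obtain ⟨a₁, hsteps, h₁⟩ := h.exists_apply ⟨r₀, hr₀.1, π, rfl⟩
      ((hP.2 r₀ hr₀.1).localIds.rename π) ha hsat hf hdisj
    refine ⟨a₁, hsteps, h₁.imp id fun h₁ => ⟨h₁.1, h₁.2.1, ?_⟩⟩
    rw [h₁.2.2, hv]
    rintro y ⟨hy, -⟩
    exact hy.imp id Or.inr
  · obtain ⟨clv, hclv, S₁, S₂, hun⟩ := hU hr₀
    obtain ⟨π₀, θ, K, Eθ, F, D, hu, rfl⟩ := hun.exists_unfoldsBy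
    -- Variables of `cv` may be absent from the unfolded rule, for instance those occurring only in
    -- deleted guard conjuncts. The given variant does not control them, so they are sent away from
    -- `a` and `S`.
    obtain ⟨β, hβ, hβ'⟩ := exists_perm_fresh π
      (A := (unfoldedRule cl (clv.rename π₀) S₁ K F D).vars) (X := (clv.rename π₀).vars)
      (S := S ∪ a.vars) (Rule.finite_vars _) (Rule.finite_vars _) (hS.union a.finite_vars)
    have hu' := hu.rename β
    have hren := Rule.rename_congr (fun y hy => (hβ y hy).symm)
    have hcvS : ∀ y ∈ ((clv.rename π₀).rename β).vars, y ∈ S ∪ a.vars →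
        y ∈ ((unfoldedRule cl (clv.rename π₀) S₁ K F D).rename β).vars := by
      intro y hy hyS
      rw [Rule.vars_rename] at hy ⊢
      obtain ⟨z, hz, rfl⟩ := hy
      by_contra hc
      exact hβ' z hz (fun hzu => hc ⟨z, hzu, rfl⟩) hyS
    rw [hren] at hf hdisj hv ⊢
    rw [unfoldedRule_rename] at hf hdisj hcvS hv ⊢
    obtain ⟨a₁, hsteps, h₁⟩ := h.exists_unfolded_apply hCT hu' ⟨cl, hcl, β, rfl⟩
      ⟨clv, hclv, β * π₀, Rule.rename_rename _ _ _⟩ ((hP.2 cl hcl).localIds.rename β)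
      (((hP.2 clv hclv).localIds.rename π₀).rename β)
      (by
        have := (hP.2 cl hcl).ids_nodup
        simpa [Rule.rename, Multiset.map_map, Function.comp_def, IdAtom.subst] using this)
      (by
        have := (hP.2 clv hclv).head_ne
        simpa [Rule.rename] using this) ha hsat hf hdisj
      (by
        rw [Set.disjoint_left]
        intro y hy hya
        exact Set.disjoint_left.1 hdisj (hcvS y hy (Or.inr hya)) hya)
    refine ⟨a₁, hsteps, h₁.imp id fun h₁ => ⟨h₁.1, h₁.2.1, ?_⟩⟩
    rw [h₁.2.2, hv]
    rintro y ⟨(hy | hy) | hy, hyS⟩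
    · exact Or.inl hy
    · exact Or.inr (Or.inr (hu'.vars_subset_unfoldedRule hy))
    · exact Or.inr (Or.inr (hcvS y hy (Or.inl hyS)))

/-- In a normal derivation Apply' must wait until nothing is pending, and by then the store has
failed; so only Solve' steps occur, each lowering the number of pending constraints. -/
theorem acc_of_unsat_total {b : Conf L Q N} (h : Unsat CT b.total) :
    Acc (Function.swap (NormalStep CT P)) b := by
  induction hk : b.pending.card generalizing b with
  | zero =>
    refine ⟨_, fun c hc => ?_⟩
    have h0 := Multiset.card_eq_zero.1 hk
    rcases hc with hc | ⟨-, hc⟩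
    · have := hc.total_eq.2.2.2.2
      omega
    · obtain ⟨r, -, H₁, H₂, G, B, C, E, T, n, hf, rfl, rfl⟩ := hc.exists_fires
      simp only at h0
      subst h0
      rw [Conf.total, zero_add] at h
      exact absurd h hf.sat
  | succ k ih =>
    refine ⟨_, fun c hc => ?_⟩
    rcases hc with hc | ⟨h0, -⟩
    · obtain ⟨-, -, -, h₁, h₂⟩ := hc.total_eq
      exact ih (h₁ ▸ h) (by omega)
    · rw [Conf.BuiltinFree] at h0
      simp [h0] at hk

theorem acc_of_acc_rename {b : Conf L Q N} (π : Equiv.Perm ℕ)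
    (h : Acc (Function.swap (NormalStep CT P)) (b.rename π)) :
    Acc (Function.swap (NormalStep CT P)) b :=
  Subrelation.accessible (fun hxy => NormalStep.rename π hxy)
    (InvImage.accessible (Conf.rename π) h)

theorem Simulates.acc (hCT : ClarkEquality CT) (hP : IsProgram P) (hcl : cl ∈ P)
    (hU : U ⊆ Unf CT P cl) {a b : Conf L Q N} (h : Simulates CT a b) (ha : a.pending = 0)
    (hacc : Acc (Function.swap (NormalStep CT P)) a) :
    Acc (Function.swap (NormalStep CT ((P \ {cl}) ∪ U))) b := by
  -- One step from `b` may be answered by several from `a`, so the induction runs along the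
  -- transitive closure.
  have hacc' := hacc.transGen
  clear hacc
  induction hacc' generalizing b with
  | intro a _ ih =>
    -- Solve' steps of `b` leave `a` where it is; the pending constraints are the second component
    -- of the lexicographic descent.
    induction hk : b.pending.card using Nat.strong_induction_on generalizing b with
    | _ k ihk =>
      by_cases hs : Unsat CT b.total
      · exact acc_of_unsat_total hs
      refine ⟨_, fun c hc => ?_⟩
      rcases hc with hc | ⟨-, hc⟩
      · obtain ⟨h₁, h₂, h₃, h₄, h₅⟩ := hc.total_eq
        exact ihk _ (by omega) (h.congr_right h₁ h₂ h₃ h₄) rfl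
      -- The variables introduced in `c` may occur in `a`. They are renamed while `b` stays fixed,
      -- and accessibility is carried back through the renaming.
      · obtain ⟨α, hα, hα'⟩ := exists_perm_fresh 1 b.finite_vars c.finite_vars a.finite_vars
        have hstep := hc.rename α
        rw [Conf.rename_eq_self hα] at hstep
        obtain ⟨a₁, hsteps, h₁⟩ := h.exists_transition hCT hP hcl hU ha hs hstep (by
          rw [Conf.vars_rename]
          rintro _ ⟨⟨y, hy, rfl⟩, hya⟩
          by_cases hyb : y ∈ b.vars
          · rw [hα y hyb]; exact hyb
          · exact absurd hya (hα' y hy hyb)) Set.finite_empty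
        refine acc_of_acc_rename α ?_
        rcases h₁ with ⟨-, h₁⟩ | ⟨h₁, ha₁, -⟩
        · exact acc_of_unsat_total h₁
        · exact ih a₁ (Relation.transGen_swap.2 hsteps) h₁ ha₁

theorem normallyTerminating_iff :
    NormallyTerminating CT P ↔
      ∀ σ : Conf L Q N, σ.Valid → Acc (Function.swap (NormalStep CT P)) σ := by
  rw [NormallyTerminating]
  constructor
  · intro h σ hσ
    by_contra hc
    obtain ⟨f, h0, hf⟩ := not_acc_iff_exists_descending_chain.1 hc
    exact h ⟨f, h0 ▸ hσ, hf⟩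
  · rintro h ⟨f, h0, hf⟩
    exact not_acc_iff_exists_descending_chain.2 ⟨f, rfl, hf⟩ (h _ h0)

theorem acc_of_normalSteps {a b : Conf L Q N} (h : Relation.ReflTransGen (NormalStep CT P) a b)
    (ha : Acc (Function.swap (NormalStep CT P)) a) :
    Acc (Function.swap (NormalStep CT P)) b := by
  induction h with
  | refl => exact ha
  | tail _ h ih => exact ih.inv h

/-- Arbitrary derivations are covered, since the answer keeps `a` free of pending constraints and so
is normal anyway. Here the derivation cannot be renamed, as its endpoint is given: the private
variables of `a` are kept away from those of `c` instead. -/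
theorem Simulates.exists_derivation (hCT : ClarkEquality CT) (hP : IsProgram P) (hcl : cl ∈ P)
    (hU : U ⊆ Unf CT P cl) {a b c : Conf L Q N} (h : Simulates CT a b) (ha : a.pending = 0)
    (hsteps : Relation.ReflTransGen (Step CT ((P \ {cl}) ∪ U)) b c)
    (hfresh : a.vars ∩ c.vars ⊆ b.vars) :
    ∃ a₁, Relation.ReflTransGen (NormalStep CT P) a a₁ ∧
      ((Unsat CT a₁.store ∧ Unsat CT c.total) ∨ (Simulates CT a₁ c ∧ a₁.pending = 0)) := by
  induction hsteps using Relation.ReflTransGen.head_induction_on generalizing a with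
  | refl => exact ⟨a, .refl, Or.inr ⟨h, ha⟩⟩
  | @head b b₁ hstep hrest ih =>
    have hsub := steps_vars_subset hrest
    have hsub₁ := hstep.vars_subset
    by_cases hs : Unsat CT b.total
    · refine ⟨a, .refl, Or.inl ⟨?_, ?_⟩⟩
      · have := h.unsat_iff.2 hs
        rwa [Conf.total, ha, zero_add] at this
      · exact hs.mono (hstep.total_le.trans (steps_total_le hrest))
    rcases hstep with hstep | hstep
    · obtain ⟨h₁, h₂, h₃, h₄, -⟩ := hstep.total_eq
      exact ih (h.congr_right h₁ h₂ h₃ h₄) ha (hfresh.trans hsub₁)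
    · obtain ⟨a₁, hsteps, h₁⟩ := h.exists_transition hCT hP hcl hU ha hs hstep
        (fun y hy => hfresh ⟨hy.2, hsub hy.1⟩) c.finite_vars
      rcases h₁ with ⟨h₁, h₁'⟩ | ⟨h₁, ha₁, hv⟩
      · exact ⟨a₁, hsteps.to_reflTransGen, Or.inl ⟨h₁, h₁'.mono (steps_total_le hrest)⟩⟩
      · obtain ⟨a₂, hsteps', h₂⟩ := ih h₁ ha₁ (by
          rintro y ⟨hy, hyc⟩
          rcases hv ⟨hy, hyc⟩ with hy | hy
          · exact hsub₁ (hfresh ⟨hy, hyc⟩)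
          · exact hy)
        exact ⟨a₂, hsteps.to_reflTransGen.trans hsteps', h₂⟩

theorem Conf.Valid.exists_derivation (hCT : ClarkEquality CT) (hP : IsProgram P) (hcl : cl ∈ P)
    (hU : U ⊆ Unf CT P cl) {σ τ : Conf L Q N} (hσ : σ.Valid)
    (hsteps : Relation.ReflTransGen (Step CT ((P \ {cl}) ∪ U)) σ τ) :
    ∃ a, Relation.ReflTransGen (NormalStep CT P) σ a ∧
      ((Unsat CT a.store ∧ Unsat CT τ.total) ∨ (Simulates CT a τ ∧ a.pending = 0)) := by
  obtain ⟨a, hsolve, h₁, h₂, h₃, h₄, h₅⟩ := exists_solve CT σ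
  rcases h₅ with ⟨ha, -⟩ | ⟨ha, hs⟩
  · obtain ⟨a₁, hsteps', h⟩ := (hσ.simulates.congr_left h₁ h₂ h₃ h₄).exists_derivation
      hCT hP hcl hU ha hsteps (by
        rw [Conf.vars_eq a, h₁, h₄, ← Conf.vars_eq]
        exact Set.inter_subset_left)
    exact ⟨a₁, (solveSteps_normal hsolve).trans hsteps', h⟩
  · exact ⟨a, solveSteps_normal hsolve, Or.inl ⟨ha, hs.mono (steps_total_le hsteps)⟩⟩

/-- Stronger than termination from valid configurations: confluence must normalise configurations
reached by derivations that need not be normal. The simulating configuration of `P` is reached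
normally and is therefore accessible. -/
theorem acc_of_steps (hCT : ClarkEquality CT) (hP : IsProgram P) (hcl : cl ∈ P)
    (hU : U ⊆ Unf CT P cl) (hterm : NormallyTerminating CT P) {σ τ : Conf L Q N} (hσ : σ.Valid)
    (hsteps : Relation.ReflTransGen (Step CT ((P \ {cl}) ∪ U)) σ τ) :
    Acc (Function.swap (NormalStep CT ((P \ {cl}) ∪ U))) τ := by
  obtain ⟨a, ha, ⟨-, h⟩ | ⟨h, h0⟩⟩ := hσ.exists_derivation hCT hP hcl hU hsteps
  · exact acc_of_unsat_total h
  · exact h.acc hCT hP hcl hU h0 (acc_of_normalSteps ha (normallyTerminating_iff.1 hterm σ hσ))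

theorem NormallyTerminating.unfold (hCT : ClarkEquality CT) (hP : IsProgram P) (hcl : cl ∈ P)
    (hU : U ⊆ Unf CT P cl) (hterm : NormallyTerminating CT P) :
    NormallyTerminating CT ((P \ {cl}) ∪ U) :=
  normallyTerminating_iff.2 fun _ hσ => acc_of_steps hCT hP hcl hU hterm hσ .refl

theorem exists_normal_form {σ : Conf L Q N} (h : Acc (Function.swap (NormalStep CT P)) σ) :
    ∃ τ, Relation.ReflTransGen (NormalStep CT P) σ τ ∧ ∀ τ', ¬ NormalStep CT P τ τ' := by
  induction h with
  | intro σ _ ih =>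
    by_cases hσ : ∃ σ', NormalStep CT P σ σ'
    · obtain ⟨σ', hσ'⟩ := hσ
      obtain ⟨τ, hτ, hτ'⟩ := ih σ' hσ'
      exact ⟨τ, hτ.head hσ', hτ'⟩
    · exact ⟨σ, .refl, fun τ' h => hσ ⟨τ', h⟩⟩

end Termination

/-! ### Normal forms and confluence -/

section Confluence

variable {L : FirstOrder.Language.{u, v}} {Q : ℕ → Type w} {N : Type x} {CT : L.Theory}
  {P U : Set (Rule L Q N)} {cl : Rule L Q N}

/-- An unsatisfiable store can be replaced by `false`, and any two configurations with store `false`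
are identified. -/
theorem confEquiv_of_unsat (V : Set ℕ) {σ τ : Conf L Q N} (hσ : Unsat CT σ.store)
    (hτ : Unsat CT τ.store) : ConfEquiv CT V σ τ := by
  have key : ∀ ρ : Conf L Q N, Unsat CT ρ.store →
      ConfEquiv CT V ρ ⟨ρ.atoms, ρ.pending, {.fls}, ρ.tokens, ρ.counter⟩ := by
    intro ρ hρ
    refine .rel _ _ (EquivGen.logical _ _ _ _ _ _ fun M ν => ?_)
    constructor
    · rintro ⟨μ, -, h⟩
      exact absurd h (hρ M μ)
    · rintro ⟨μ, -, h⟩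
      exact (sat_singleton.1 h).elim
  exact (key σ hσ).trans _ _ _ (.trans _ _ _ (.rel _ _ (EquivGen.failed _ _ _ _ _ _ _ _))
    ((key τ hτ).symm _ _))

/-- Each ingredient of simulation matches one identification: projection of the store, renaming of
identifiers, and cleaning to forget dead tokens on both sides. -/
theorem Simulates.confEquiv {V : Set ℕ} {a b : Conf L Q N} (h : Simulates CT a b)
    (ha : a.pending = 0) (hb : b.pending = 0) (hV : V ⊆ b.vars) : ConfEquiv CT V b a := by
  classical
  obtain ⟨g, hg, hle, hatoms, htok⟩ := h.ids
  obtain ⟨A, B, C, T, n⟩ := a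
  obtain ⟨A', B', C', T', n'⟩ := b
  have htot := h.total
  have htoken_le' := h.token_le'
  have hatom_le := h.atom_le
  simp only [Conf.total] at ha hb hle hatoms htok htot htoken_le' hatom_le
  subst ha hb hatoms
  simp only [zero_add] at htot
  -- The identifier map need not be a permutation; it is replaced by a finite one that agrees with
  -- it on the identifiers of `A'`. This suffices once the tokens are cleaned.
  obtain ⟨ρ, hρ, hfin⟩ := exists_perm_extending (finite_atomIds A').toFinset g hg.injective.injOn
  replace hρ : ∀ i ∈ atomIds A', ρ i = g i := fun i hi => hρ i (by simpa using hi)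
  have hmap : renameAtoms ρ A' = mapIds g A' := by
    rw [renameAtoms_eq]
    exact mapIds_congr hρ
  have hclean : renameTokens ρ (clean A' T') = clean (mapIds g A') T := by
    ext t
    constructor
    · rintro ⟨s, ⟨hs, hsl⟩, rfl⟩
      have e : s.ids.map ρ = s.ids.map g := List.map_congr_left fun i hi => hρ i (hsl i hi)
      simp only [e]
      refine ⟨(htok s hsl).1 hs, fun i hi => ?_⟩
      obtain ⟨j, hj, rfl⟩ := List.mem_map.1 hi
      rw [atomIds_mapIds]
      exact ⟨j, hsl j hj, rfl⟩
    · rintro ⟨ht, htl⟩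
      have hpre : ∀ i ∈ t.ids, ρ.symm i ∈ atomIds A' ∧ g (ρ.symm i) = i := by
        intro i hi
        have := htl i hi
        rw [atomIds_mapIds] at this
        obtain ⟨j, hj, rfl⟩ := this
        have e : ρ.symm (g j) = j := by rw [← hρ j hj, Equiv.symm_apply_apply]
        rw [e]
        exact ⟨hj, rfl⟩
      have e : (t.ids.map ρ.symm).map g = t.ids := by
        rw [List.map_map]
        exact (List.map_congr_left fun i hi => (hpre i hi).2).trans (List.map_id _)
      have hlive : ∀ i ∈ t.ids.map ρ.symm, i ∈ atomIds A' := by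
        intro i hi
        obtain ⟨j, hj, rfl⟩ := List.mem_map.1 hi
        exact (hpre j hj).1
      refine ⟨⟨t.name, t.ids.map ρ.symm⟩, ⟨(htok _ hlive).2 ?_, hlive⟩, ?_⟩
      · simp only [e]
        exact ht
      · simp
  have h₁ : ConfEquiv CT V ⟨A', 0, C', T', n'⟩ ⟨A', 0, C, T', n'⟩ := by
    refine .rel _ _ (EquivGen.logical _ _ _ _ _ _ fun M ν => ?_)
    rw [builtinVars_zero, Set.union_empty]
    constructor
    · rintro ⟨μ, hμ, hC'⟩
      obtain ⟨κ, hκ, hC⟩ := (htot M μ).1 hC'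
      -- Only the quantified variables of `C` may change. The others occurring in `C` lie in the
      -- atoms or in `V`, hence in `b`, and there `κ` agrees with `ν`.
      refine ⟨fun y => if y ∈ builtinVars C \ (atomVars A' ∪ V) then κ y else ν y,
        fun y hy => if_neg hy, (sat_congr fun y hy => ?_).1 hC⟩
      split_ifs with hy'
      · rfl
      · have hyV : y ∈ atomVars A' ∪ V := by
          by_contra hc
          exact hy' ⟨hy, hc⟩
        rw [hκ y, hμ y fun h => h.2 hyV]
        refine not_not.2 ?_
        exact hyV.elim (fun h => Or.inl (Or.inl h)) fun h => hV h
    · rintro ⟨μ, hμ, hC⟩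
      have hC' := (htot M μ).2 ⟨μ, fun _ _ => rfl, hC⟩
      refine ⟨fun y => if y ∈ builtinVars C' \ (atomVars A' ∪ V) then μ y else ν y,
        fun y hy => if_neg hy, (sat_congr fun y hy => ?_).1 hC'⟩
      split_ifs with hy'
      · rfl
      · have hyV : y ∈ atomVars A' ∪ V := by
          by_contra hc
          exact hy' ⟨hy, hc⟩
        exact hμ y fun h => h.2 hyV
  have h₂ : ConfEquiv CT V (⟨A', 0, C, T', n'⟩ : Conf L Q N) ⟨A', 0, C, clean A' T', n'⟩ :=
    .rel _ _ (EquivGen.cleaning _ _ _ _ _)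
  have h₃ : ConfEquiv CT V (⟨A', 0, C, clean A' T', n'⟩ : Conf L Q N)
      ⟨mapIds g A', 0, C, clean (mapIds g A') T, n⟩ := by
    have := EquivGen.renameIds (CT := CT) (V := V) ρ hfin A' 0 C (clean A' T') n' n
    rw [hmap, hclean] at this
    refine .rel _ _ (this ?_)
    rintro i (hi | ⟨t, ht, hi⟩)
    · rw [atomIds_mapIds] at hi
      obtain ⟨j, hj, rfl⟩ := hi
      exact hle j (hatom_le j hj)
    · exact htoken_le' i ⟨t, ht.1, hi⟩
  have h₄ : ConfEquiv CT V (⟨mapIds g A', 0, C, T, n⟩ : Conf L Q N)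
      ⟨mapIds g A', 0, C, clean (mapIds g A') T, n⟩ :=
    .rel _ _ (EquivGen.cleaning _ _ _ _ _)
  exact h₁.trans _ _ _ (h₂.trans _ _ _ (h₃.trans _ _ _ (h₄.symm _ _)))

/-- If the unfolding leaves the guard unchanged up to equivalence, then no other choice of the
substitution and of the variant leaves a residual guard. -/
theorem UnfoldsBy.residual_eq_zero (hCT : ClarkEquality CT) {clv : Rule L Q N}
    {S₁ S₂ : List (IdAtom L Q)} {π₁ π₂ : Equiv.Perm ℕ} {θ₁ θ₂ : ℕ → L.Term ℕ}
    {K₁ K₂ : Multiset (IdAtom L Q)} {Eθ₁ E₁ D₁ Eθ₂ E₂ D₂ : Multiset (Builtin L)}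
    (h₁ : UnfoldsBy CT cl (clv.rename π₁) S₁ S₂ θ₁ K₁ Eθ₁ E₁ D₁)
    (h₂ : UnfoldsBy CT cl (clv.rename π₂) S₁ S₂ θ₂ K₂ Eθ₂ E₂ D₂)
    (hD : Entails CT cl.guard D₁) : D₂ = 0 := by
  classical
  rw [h₂.residual, Multiset.map_eq_zero, residualGuard, Multiset.filter_eq_nil]
  intro d hd
  obtain ⟨d₀, hd₀, rfl⟩ := Multiset.mem_map.1 hd
  rw [not_not]
  -- In the first unfolding every guard conjunct is implied: it was either deleted for that reason
  -- or kept in `D₁`, which follows from the guard of `cl`.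
  have hent : Entails CT (cl.builtins + cl.guard)
      {(d₀.subst fun y => .var (π₁ y)).subst θ₁} := by
    by_contra hc
    refine hc fun M ν hν => sat_singleton.2 (hD M ν (sat_add.1 hν).2 _ ?_)
    rw [h₁.residual]
    exact Multiset.mem_map_of_mem _ (Multiset.mem_filter.2 ⟨Multiset.mem_map_of_mem _ hd₀, hc⟩)
  intro M ν hν
  have hM := hCT.injectiveFunctions M
  -- Transports `ν` from the second variant to the first: the copy of a variable under `π₁` receives
  -- the value of its copy under `π₂`.
  set μ : ℕ → M := fun y => if y ∈ (clv.rename π₁).vars then ν (π₂ (π₁.symm y)) else ν y with hμ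
  have hμcl : ∀ y ∈ cl.vars, μ y = ν y := fun y hy =>
    if_neg fun h => Set.disjoint_left.1 h₁.fresh h hy
  have hμA : Sat μ (cl.builtins + cl.guard) := by
    refine (sat_congr fun y hy => hμcl y ?_).2 hν
    rw [builtinVars_add] at hy
    simp only [Rule.vars, Set.mem_union] at hy ⊢
    tauto
  have hvals : (clv.kept ++ clv.removed).map (UserAtom.val (valSubst θ₁ μ ∘ π₁)) =
      (clv.kept ++ clv.removed).map (UserAtom.val (valSubst θ₂ ν ∘ π₂)) := by
    have e₁ := h₁.val_eq hμA
    have e₂ := h₂.val_eq hν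
    have e : ((S₁ ++ S₂).map IdAtom.chr).map (UserAtom.val μ) =
        ((S₁ ++ S₂).map IdAtom.chr).map (UserAtom.val ν) := by
      refine heads_val_congr fun y hy => hμcl y (Or.inl (Or.inr ?_))
      rw [h₁.body, atomVars_add, atomVars_coe]
      exact Or.inr hy
    simp only [Rule.rename] at e₁ e₂
    rw [← List.map_append, heads_val_subst] at e₁ e₂
    exact e₁.symm.trans (e.trans e₂)
  -- Head variables are pinned down by the values of `S₁`, `S₂` through injectivity; on the others
  -- both substitutions are the identity and `μ` was built to agree.
  have hagree : ∀ y ∈ clv.vars, valSubst θ₁ μ (π₁ y) = valSubst θ₂ ν (π₂ y) := by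
    intro y hy
    by_cases hyh : y ∈ headVars (clv.kept ++ clv.removed)
    · exact hM.eq_of_heads_val_eq hvals y hyh
    · have hnot : ∀ π : Equiv.Perm ℕ,
          π y ∉ headVars ((clv.rename π).kept ++ (clv.rename π).removed) := by
        intro π h
        simp only [Rule.rename] at h
        rw [← List.map_append, headVars_rename] at h
        obtain ⟨z, hz, hzy⟩ := h
        exact hyh (π.injective hzy ▸ hz)
      rw [valSubst_eq_of_dom h₁.dom (hnot π₁), valSubst_eq_of_dom h₂.dom (hnot π₂)]
      have : π₁ y ∈ (clv.rename π₁).vars := by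
        rw [Rule.vars_rename]
        exact ⟨y, hy, rfl⟩
      simp [hμ, this]
  have h := sat_singleton.1 (hent M μ hμA)
  rw [sat_singleton, Builtin.realize_subst, Builtin.realize_subst]
  rw [Builtin.realize_subst, Builtin.realize_subst] at h
  refine (Builtin.realize_congr fun y hy => ?_).1 h
  exact hagree y (Or.inl (Or.inl (Or.inr ⟨d₀, hd₀, hy⟩)))

/-- The unfolding that witnesses weak safety need not itself belong to `U`, but `U` contains one at
the same position with the same rule, and its residual guard is empty too. The guards then agree
literally. -/
theorem WeaklySafelyReplaceable.exists_rule (hCT : ClarkEquality CT)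
    (hw : WeaklySafelyReplaceable CT P cl) (hU : IsUnf CT P cl U) :
    ∃ r ∈ U, r.name = cl.name ∧ r.kept = cl.kept ∧ r.removed = cl.removed ∧
      r.guard = cl.guard ∧ cl.vars ⊆ r.vars := by
  obtain ⟨r₀, ⟨clv, hclv, S₁, S₂, h₀⟩, hent, -⟩ := hw
  obtain ⟨r, hr, h⟩ := hU.covers clv hclv S₁ S₂ ⟨r₀, h₀⟩
  obtain ⟨π₁, θ₁, K₁, Eθ₁, E₁, D₁, h₁, rfl⟩ := h₀.exists_unfoldsBy
  obtain ⟨π₂, θ₂, K₂, Eθ₂, E₂, D₂, h₂, rfl⟩ := h.exists_unfoldsBy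
  have hD : D₂ = 0 := h₁.residual_eq_zero hCT h₂ fun M ν hν =>
    (sat_add.1 (show Sat ν (cl.guard + D₁) from hent M ν hν)).2
  refine ⟨_, hr, rfl, rfl, rfl, ?_, h₂.vars_subset_unfoldedRule⟩
  simp [unfoldedRule, hD]

theorem Rule.Fires.of_heads_eq {r r' : Rule L Q N} {H₁ H₂ : List (IdAtom L Q)}
    {G : Multiset (IdAtom L Q)} {B C E : Multiset (Builtin L)} {T : Set (Token N)} {n : ℕ}
    (h : r.Fires CT H₁ H₂ G B C E T n) (h₁ : r'.name = r.name) (h₂ : r'.kept = r.kept)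
    (h₃ : r'.removed = r.removed) (h₄ : r'.guard = r.guard) (h₅ : r.vars ⊆ r'.vars)
    (hfresh : Disjoint r'.vars
      (Conf.vars (N := N) ⟨Multiset.ofList (H₁ ++ H₂) + G, B, C, T, n⟩)) :
    r'.Fires CT H₁ H₂ G B C E T n := by
  refine ⟨h.sat, hfresh, by rw [h₂, h₃]; exact h.headEq, ?_, by rw [h₁]; exact h.token⟩
  intro M ν hν
  obtain ⟨μ, hμ, hs⟩ := h.guard M ν hν
  exact ⟨μ, fun y hy => hμ y fun h => hy (h₅ h), by rw [h₄]; exact hs⟩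

/-- The converse transfer, from `a` to `b`. The store of `b` is the projection of that of `a`, so a
solution of it extends to `a`, where the guard is known to be solvable. -/
theorem Simulates.fires {r : Rule L Q N} {H₁ H₂ : List (IdAtom L Q)}
    {G : Multiset (IdAtom L Q)} {C E : Multiset (Builtin L)} {T : Set (Token N)} {n : ℕ}
    {b : Conf L Q N} (h : Simulates CT ⟨Multiset.ofList (H₁ ++ H₂) + G, 0, C, T, n⟩ b)
    (hb : b.pending = 0) (hf : r.Fires CT H₁ H₂ G 0 C E T n) :
    ∃ H₁' H₂' G', b.atoms = Multiset.ofList (H₁' ++ H₂') + G' ∧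
      r.Fires CT H₁' H₂' G' 0 b.store E b.tokens b.counter := by
  classical
  obtain ⟨g, hg, hle, hatoms, htok⟩ := h.ids
  obtain ⟨A', B', C', T', n'⟩ := b
  have htot := h.total
  have hvs := h.vars_subset
  have hun := h.unsat_iff
  simp only [Conf.total] at hb hle hatoms htok htot hun
  subst hb
  simp only [zero_add] at htot hun
  -- A left inverse of the identifier map pulls the matched constraints back to `b`.
  obtain ⟨k, hk⟩ := hg.injective.hasLeftInverse
  have hA : A' = mapIds k (Multiset.ofList (H₁ ++ H₂) + G) := by
    rw [hatoms, mapIds_mapIds, hk.comp_eq_id, mapIds_id]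
  set H₁' := H₁.map fun a => (⟨a.chr, k a.id⟩ : IdAtom L Q) with hH₁'
  set H₂' := H₂.map fun a => (⟨a.chr, k a.id⟩ : IdAtom L Q) with hH₂'
  have hA' : A' = Multiset.ofList (H₁' ++ H₂') + mapIds k G := by
    rw [hA, mapIds_add, mapIds_coe, List.map_append]
  have hids : ((H₁' ++ H₂').map IdAtom.id).map g = (H₁ ++ H₂).map IdAtom.id := by
    have : (H₁' ++ H₂').map IdAtom.id = ((H₁ ++ H₂).map IdAtom.id).map k := by
      simp [hH₁', hH₂', Function.comp_def]
    rw [this, List.map_map]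
    refine (List.map_congr_left fun i hi => ?_).trans (List.map_id _)
    have : i ∈ atomIds (mapIds g A') := by
      rw [← hatoms, atomIds_add, atomIds_coe]
      exact Or.inl hi
    rw [atomIds_mapIds] at this
    obtain ⟨j, -, rfl⟩ := this
    simp [hk j]
  refine ⟨H₁', H₂', mapIds k G, hA', ?_, ?_, hf.headEq.mapIds k, ?_, ?_⟩
  · exact fun h => hf.sat (hun.2 h)
  · rw [← hA']
    exact hf.fresh.mono_right hvs
  · intro M ν hν
    obtain ⟨μ, hμ, hC⟩ := (htot M ν).1 hν
    obtain ⟨κ, hκ, hE⟩ := hf.guard M μ hC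
    -- Besides variables of the rule, the equations and guard mention just those of the matched
    -- constraints, which are variables of `b` and retain their values.
    refine ⟨fun y => if y ∈ r.vars then κ y else ν y, fun y hy => if_neg hy,
      (sat_congr fun y hy => ?_).1 hE⟩
    split_ifs with hyr
    · rfl
    · rw [hκ y hyr]
      refine hμ y (not_not.2 (Or.inl (Or.inl ?_)))
      rw [builtinVars_add, hf.headEq.vars_eq] at hy
      have hyH : y ∈ headVars ((H₁ ++ H₂).map IdAtom.chr) := by
        simp only [Rule.vars, Set.mem_union] at hyr hy
        tauto
      have : y ∈ atomVars (mapIds g A') := by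
        rw [← hatoms, atomVars_add, atomVars_coe]
        exact Or.inl hyH
      rwa [atomVars_mapIds] at this
  · intro hmem
    refine hf.token ?_
    rw [← hids]
    refine (htok ⟨r.name, (H₁' ++ H₂').map IdAtom.id⟩ fun i hi => ?_).1 hmem
    rw [hA', atomIds_add, atomIds_coe]
    exact Or.inl hi

/-- A normal form of the transformed program can only be simulated by a normal form. -/
theorem Simulates.not_step (hCT : ClarkEquality CT) (hw : WeaklySafelyReplaceable CT P cl)
    (hU : IsUnf CT P cl U) {a b : Conf L Q N} (h : Simulates CT a b) (ha : a.pending = 0)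
    (hb : b.pending = 0) (hnf : ∀ τ, ¬ ApplyStep CT ((P \ {cl}) ∪ U) b τ) (τ : Conf L Q N) :
    ¬ Step CT P a τ := by
  rintro (hs | hs)
  · have := hs.total_eq.2.2.2.2
    rw [ha] at this
    simp at this
  · obtain ⟨r, ⟨r₀, hr₀, π, rfl⟩, H₁, H₂, G, B, C, E, T, n, hf, rfl, rfl⟩ := hs.exists_fires
    simp only at ha
    subst ha
    obtain ⟨H₁', H₂', G', hatoms, hf'⟩ := h.fires hb hf
    obtain ⟨A', B', C', T', n'⟩ := b
    simp only at hatoms hb hf'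
    subst hatoms hb
    by_cases hr : r₀ = cl
    · subst hr
      obtain ⟨u, hu, h₁, h₂, h₃, h₄, h₅⟩ := hw.exists_rule hCT hU
      -- Extends the variant of `cl` to one of `u`, whose additional variables must be fresh for
      -- `b`.
      obtain ⟨β, hβ, hβ'⟩ := exists_perm_fresh π (A := r₀.vars) (X := u.vars)
        (S := Conf.vars (N := N) ⟨Multiset.ofList (H₁' ++ H₂') + G', 0, C', T', n'⟩)
        r₀.finite_vars u.finite_vars (Conf.finite_vars _)
      rw [Rule.rename_congr fun y hy => (hβ y hy).symm] at hf'
      have hfu : (u.rename β).Fires CT H₁' H₂' G' 0 C' E T' n' := by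
        refine hf'.of_heads_eq ?_ ?_ ?_ ?_ ?_ ?_
        · exact h₁
        · simp only [Rule.rename, h₂]
        · simp only [Rule.rename, h₃]
        · simp only [Rule.rename, h₄]
        · rw [Rule.vars_rename, Rule.vars_rename]
          exact Set.image_mono h₅
        · rw [Set.disjoint_left]
          intro y hy hyb
          rw [Rule.vars_rename] at hy
          obtain ⟨z, hz, rfl⟩ := hy
          by_cases hzr : z ∈ r₀.vars
          · refine Set.disjoint_left.1 hf'.fresh ?_ hyb
            rw [Rule.vars_rename]
            exact ⟨z, hzr, rfl⟩
          · exact hβ' z hz hzr hyb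
      exact hnf _ (hfu.applyStep ⟨u, Or.inr hu, β, rfl⟩)
    · exact hnf _ (hf'.applyStep ⟨r₀, Or.inl ⟨hr₀, hr⟩, π, rfl⟩)

theorem not_step_of_unsat {σ τ : Conf L Q N} (h : Unsat CT σ.store) : ¬ Step CT P σ τ := by
  rintro (hs | hs)
  · obtain ⟨c, G, B, C, T, n, hC⟩ := hs
    exact hC h
  · obtain ⟨r, -, H₁, H₂, G, B, C, E, T, n, hf, rfl, rfl⟩ := hs.exists_fires
    exact hf.sat h

/-- Reduces confluence of `P'` to that of `P`: every derivation of `P'` can be prolonged until it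
meets, up to equivalence, a normal form of `P` from the same start. -/
theorem exists_equiv_normal_form (hCT : ClarkEquality CT) (hP : IsProgram P) (hcl : cl ∈ P)
    (hw : WeaklySafelyReplaceable CT P cl) (hU : IsUnf CT P cl U)
    (hterm : NormallyTerminating CT P) {σ σ' : Conf L Q N} (hσ : σ.Valid)
    (hsteps : Relation.ReflTransGen (Step CT ((P \ {cl}) ∪ U)) σ σ') :
    ∃ τ a, Relation.ReflTransGen (Step CT ((P \ {cl}) ∪ U)) σ' τ ∧
      Relation.ReflTransGen (Step CT P) σ a ∧ (∀ ρ, ¬ Step CT P a ρ) ∧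
      ConfEquiv CT σ.vars τ a := by
  obtain ⟨τ, hτ, hnf⟩ := exists_normal_form (acc_of_steps hCT hP hcl hU.subset hterm hσ hsteps)
  have hτ' : Relation.ReflTransGen (Step CT ((P \ {cl}) ∪ U)) σ' τ :=
    Relation.ReflTransGen.mono (fun _ _ => NormalStep.step) _ _ hτ
  have hall := hsteps.trans hτ'
  obtain ⟨a, ha, h⟩ := hσ.exists_derivation hCT hP hcl hU.subset hall
  refine ⟨τ, a, hτ', Relation.ReflTransGen.mono (fun _ _ => NormalStep.step) _ _ ha, ?_⟩
  by_cases hs : Unsat CT τ.store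
  · have haU : Unsat CT a.store := by
      rcases h with ⟨h, -⟩ | ⟨h, h0⟩
      · exact h
      · have := h.unsat_iff.2 (hs.mono (Multiset.le_add_left _ _))
        rwa [Conf.total, h0, zero_add] at this
    exact ⟨fun ρ => not_step_of_unsat haU, confEquiv_of_unsat _ hs haU⟩
  -- A pending constraint would permit a Solve' step, the store being consistent.
  · have hb : τ.pending = 0 := by
      by_contra hne
      obtain ⟨A, B, C, T, n⟩ := τ
      obtain ⟨c, hc⟩ := Multiset.exists_mem_of_ne_zero hne
      obtain ⟨B', rfl⟩ := Multiset.exists_cons_of_mem hc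
      exact hnf _ (Or.inl (SolveStep.mk c A B' C T n hs))
    rcases h with ⟨-, h⟩ | ⟨h, h0⟩
    · rw [Conf.total, hb, zero_add] at h
      exact absurd h hs
    · exact ⟨h.not_step hCT hw hU h0 hb fun ρ hρ => hnf ρ (Or.inr ⟨hb, hρ⟩),
        h.confEquiv h0 hb (steps_vars_subset hall)⟩

theorem eq_of_steps_of_not_step {σ τ : Conf L Q N} (h : Relation.ReflTransGen (Step CT P) σ τ)
    (hσ : ∀ ρ, ¬ Step CT P σ ρ) : τ = σ := by
  rcases Relation.ReflTransGen.cases_head h with h | ⟨ρ, h, -⟩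
  · exact h.symm
  · exact absurd h (hσ ρ)

theorem Confluent.unfold (hCT : ClarkEquality CT) (hP : IsProgram P) (hcl : cl ∈ P)
    (hw : WeaklySafelyReplaceable CT P cl) (hU : IsUnf CT P cl U)
    (hterm : NormallyTerminating CT P) (hconf : Confluent CT P) :
    Confluent CT ((P \ {cl}) ∪ U) := by
  intro σ σ₁ σ₂ hσ h₁ h₂
  obtain ⟨τ₁, a₁, hτ₁, ha₁, hn₁, he₁⟩ := exists_equiv_normal_form hCT hP hcl hw hU hterm hσ h₁
  obtain ⟨τ₂, a₂, hτ₂, ha₂, hn₂, he₂⟩ := exists_equiv_normal_form hCT hP hcl hw hU hterm hσ h₂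
  obtain ⟨ρ₁, ρ₂, hρ₁, hρ₂, he⟩ := hconf σ a₁ a₂ hσ ha₁ ha₂
  obtain rfl := eq_of_steps_of_not_step hρ₁ hn₁
  obtain rfl := eq_of_steps_of_not_step hρ₂ hn₂
  exact ⟨τ₁, τ₂, hτ₁, hτ₂, he₁.trans _ _ _ (he.trans _ _ _ (he₂.symm _ _))⟩

end Confluence

end CHR

theorem proposition4 {L : FirstOrder.Language.{u, v}} {Q : ℕ → Type w} {N : Type x}
    (CT : L.Theory) (hCT : CHR.ClarkEquality CT)
    (P : Set (CHR.Rule L Q N)) (hP : CHR.IsProgram P)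
    (cl : CHR.Rule L Q N) (hcl : cl ∈ P) (hw : CHR.WeaklySafelyReplaceable CT P cl)
    (U : Set (CHR.Rule L Q N)) (hU : CHR.IsUnf CT P cl U)
    (P' : Set (CHR.Rule L Q N)) (hP' : P' = (P \ {cl}) ∪ U) :
    (CHR.NormallyTerminating CT P → CHR.NormallyTerminating CT P') ∧
      (CHR.NormallyTerminating CT P → CHR.Confluent CT P → CHR.Confluent CT P') := by
  subst hP'
  exact ⟨CHR.NormallyTerminating.unfold hCT hP hcl hU.subset,
    CHR.Confluent.unfold hCT hP hcl hw hU⟩
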